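/- **Theorem (the DFT in the Word-RAM model).** For an integer $z$ put $\operatorname{size}(z)=1+\lceil\log_2(|z|+1)\rceil$, for a rational number $p/q$ in lowest terms put $\operatorname{size}(p/q)=\operatorname{size}(p)+\operatorname{size}(q)$, and for a rational complex number $z=a+bi$ ($a,b\in\mathbb{Q}$) put $\operatorname{size}(z)=\operatorname{size}(a)+\operatorname{size}(b)$. The computational model is the Word-RAM whose words hold rational numbers: additions, subtractions, multiplications, divisions, integer parts and comparisons of rational numbers, and accesses to a memory cell at a computed address, are single operations. There are a program for this machine and absolute constants $C,K_1,K_2,K_3$ such that the following holds. Let $\mathcal{G}$ be a finite Abelian group of order $n$ with a basis $b_1,\dots,b_s$ of nonzero elements: every $g\in\mathcal{G}$ is uniquely of the form $g=i_1b_1+\dots+i_sb_s$ with $0\le i_j<m_j$, where $m_j\geq 2$ is the order of $b_j$. Let $\alpha'$ be a function from $\mathcal{G}$ to the rational complex numbers, $\gamma=\max_{g\in\mathcal{G}}\operatorname{size}(\alpha'(g))$, and let $\varepsilon\in\mathbb{Q}\cap(0,1)$ satisfy $\varepsilon<1/n^{C}$. The input consists of $s$, $\varepsilon$, $m_1,\dots,m_s$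 and the values of $\alpha'$, where $g=\sum_j i_jb_j$ has the position $\sum_j i_j\prod_{l<j}m_l$. On this input the program halts and outputs rational complex numbers $\hat\alpha'(\chi)$ for all characters $\chi\colon\mathcal{G}\to\{z\in\mathbb{C}:|z|=1\}$, where the character with $\chi(b_j)=e^{2\pi i k_j/m_j}$, $0\le k_j<m_j$, has the position $\sum_j k_j\prod_{l<j}m_l$, such that: 1. for every $\alpha\colon\mathcal{G}\to\mathbb{C}$ with $\|\alpha-\alpha'\|_\infty\le\varepsilon$, the discrete Fourier transform $\hat\alpha(\chi)=\sum_{g\in\mathcal{G}}\alpha(g)\,\overline{\chi(g)}$ satisfies $\|\hat\alpha'-\hat\alpha\|_\infty\le n^{K_1}\cdot\varepsilon$; 2. the program performs at most $K_2\cdot n\cdot\bigl(\log_2 n+\gamma+\log_2(1/\varepsilon)\bigr)$ operations, all on rational numbers of size at most $K_3\cdot\bigl(\log_2 n+\gamma+\operatorname{size}(\varepsilon)\bigr)$. In particular, the algorithm runs in polynomial time. -/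

import Mathlib

/-! ### Encoding sizes and rational complex numbers -/

/-- Bit size of an integer: `1 + ⌈log₂ (|z| + 1)⌉`. -/
def intSize (z : ℤ) : ℕ := 1 + Nat.clog 2 (z.natAbs + 1)

/-- Bit size of a rational number: sizes of its coprime numerator and denominator. -/
def ratSize (r : ℚ) : ℕ := intSize r.num + intSize (r.den : ℤ)

/-- A rational complex number `re + im * i` with `re, im ∈ ℚ`. -/
structure RatComplex where
  re : ℚ
  im : ℚ

/-- The complex number that a rational complex number denotes. -/
def RatComplex.toComplex (z : RatComplex) : ℂ := ⟨(z.re : ℝ), (z.im : ℝ)⟩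

/-- Bit size of a rational complex number. -/
def RatComplex.size (z : RatComplex) : ℕ := ratSize z.re + ratSize z.im

/-- `γ`: the maximal size of a value of `α`. -/
def maxSize {G : Type*} [Fintype G] (α : G → RatComplex) : ℕ :=
  Finset.univ.sup fun g => (α g).size

/-! ### The Word-RAM

The machine has registers and a random-access memory, whose cells hold rational numbers. At unit
cost it adds, subtracts, multiplies and divides, takes the integer part, compares two numbers, and
reads or writes a memory cell at a computed address. Programs are finite and are written in
structured form (sequencing, conditionals, loops). With word size `w`, every operand, address and
result of every operation has to be a rational number of size at most `w`. -/

/-- A configuration of the machine: contents of the registers and of the memory cells. -/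
structure RamState where
  reg : ℕ → ℚ
  mem : ℕ → ℚ

/-- Expressions: integer constants, registers, memory cells at a computed address, arithmetic. -/
inductive RamExpr where
  | lit (z : ℤ)
  | reg (r : ℕ)
  | load (a : RamExpr)
  | add (a b : RamExpr)
  | sub (a b : RamExpr)
  | mul (a b : RamExpr)
  | div (a b : RamExpr)
  | floor (a : RamExpr)

/-- The number of operations that evaluating an expression takes. -/
def RamExpr.cost : RamExpr → ℕ
  | .lit _ => 1
  | .reg _ => 1
  | .load a => a.cost + 1
  | .add a b => a.cost + b.cost + 1
  | .sub a b => a.cost + b.cost + 1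
  | .mul a b => a.cost + b.cost + 1
  | .div a b => a.cost + b.cost + 1
  | .floor a => a.cost + 1

/-- The value of an expression. Division by zero and addresses that are not natural numbers are
excluded by `RamExpr.Fits`. -/
def RamExpr.eval (σ : RamState) : RamExpr → ℚ
  | .lit z => (z : ℚ)
  | .reg r => σ.reg r
  | .load a => σ.mem (a.eval σ).num.toNat
  | .add a b => a.eval σ + b.eval σ
  | .sub a b => a.eval σ - b.eval σ
  | .mul a b => a.eval σ * b.eval σ
  | .div a b => a.eval σ / b.eval σ
  | .floor a => (⌊a.eval σ⌋ : ℚ)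

/-- The expression can be evaluated with word size `w`: addresses are natural numbers, divisors are
nonzero, and the values of the expression and of all its subexpressions have size at most `w`. -/
def RamExpr.Fits (w : ℕ) (σ : RamState) : RamExpr → Prop
  | .lit z => ratSize (z : ℚ) ≤ w
  | .reg r => ratSize (σ.reg r) ≤ w
  | .load a => a.Fits w σ ∧ (∃ k : ℕ, a.eval σ = k) ∧ ratSize (RamExpr.eval σ (.load a)) ≤ w
  | .add a b => a.Fits w σ ∧ b.Fits w σ ∧ ratSize (a.eval σ + b.eval σ) ≤ w
  | .sub a b => a.Fits w σ ∧ b.Fits w σ ∧ ratSize (a.eval σ - b.eval σ) ≤ w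
  | .mul a b => a.Fits w σ ∧ b.Fits w σ ∧ ratSize (a.eval σ * b.eval σ) ≤ w
  | .div a b => a.Fits w σ ∧ b.Fits w σ ∧ b.eval σ ≠ 0 ∧ ratSize (a.eval σ / b.eval σ) ≤ w
  | .floor a => a.Fits w σ ∧ ratSize (⌊a.eval σ⌋ : ℚ) ≤ w

/-- Programs. The tests of `branch` and `loop` are `a < b`. -/
inductive RamProgram where
  | skip
  | setReg (r : ℕ) (e : RamExpr)
  | store (a e : RamExpr)
  | seq (p q : RamProgram)
  | branch (a b : RamExpr) (p q : RamProgram)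
  | loop (a b : RamExpr) (p : RamProgram)

/-- `p.Exec w σ t σ'`: started in `σ`, the program `p` halts in `σ'` after exactly `t` operations,
all of them on rational numbers of size at most `w`. -/
inductive RamProgram.Exec (w : ℕ) : RamProgram → RamState → ℕ → RamState → Prop
  | skip (σ : RamState) : Exec w .skip σ 1 σ
  | setReg (σ : RamState) (r : ℕ) (e : RamExpr) (he : e.Fits w σ) :
      Exec w (.setReg r e) σ (e.cost + 1) ⟨Function.update σ.reg r (e.eval σ), σ.mem⟩
  | store (σ : RamState) (a e : RamExpr) (k : ℕ) (ha : a.Fits w σ) (hk : a.eval σ = k)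
      (he : e.Fits w σ) :
      Exec w (.store a e) σ (a.cost + e.cost + 1) ⟨σ.reg, Function.update σ.mem k (e.eval σ)⟩
  | seq {σ τ ρ : RamState} {t u : ℕ} {p q : RamProgram} (hp : Exec w p σ t τ)
      (hq : Exec w q τ u ρ) : Exec w (.seq p q) σ (t + u) ρ
  | branch_true {σ τ : RamState} {t : ℕ} {a b : RamExpr} {p q : RamProgram} (ha : a.Fits w σ)
      (hb : b.Fits w σ) (hab : a.eval σ < b.eval σ) (hp : Exec w p σ t τ) :
      Exec w (.branch a b p q) σ (a.cost + b.cost + 1 + t) τ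
  | branch_false {σ τ : RamState} {t : ℕ} {a b : RamExpr} {p q : RamProgram} (ha : a.Fits w σ)
      (hb : b.Fits w σ) (hab : ¬ a.eval σ < b.eval σ) (hq : Exec w q σ t τ) :
      Exec w (.branch a b p q) σ (a.cost + b.cost + 1 + t) τ
  | loop_true {σ τ ρ : RamState} {t u : ℕ} {a b : RamExpr} {p : RamProgram} (ha : a.Fits w σ)
      (hb : b.Fits w σ) (hab : a.eval σ < b.eval σ) (hp : Exec w p σ t τ)
      (hl : Exec w (.loop a b p) τ u ρ) :
      Exec w (.loop a b p) σ (a.cost + b.cost + 1 + t + u) ρ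
  | loop_false {σ : RamState} {a b : RamExpr} {p : RamProgram} (ha : a.Fits w σ)
      (hb : b.Fits w σ) (hab : ¬ a.eval σ < b.eval σ) :
      Exec w (.loop a b p) σ (a.cost + b.cost + 1) σ

/-! ### Finite Abelian groups given by a basis, and the discrete Fourier transform -/

section Group

variable {G : Type*} [AddCommGroup G] {s : ℕ}

/-- `b` is a basis of `G`: every element is `∑ j, i j • b j` for exactly one family of
coefficients with `0 ≤ i j < ord (b j)`. -/
def IsGroupBasis (b : Fin s → G) : Prop :=
  ∀ g : G, ∃! i : Fin s → ℕ, (∀ j, i j < addOrderOf (b j)) ∧ g = ∑ j, i j • b j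

/-- The `j`-th digit of `p` in the mixed radix system with radices `ord (b 0), ord (b 1), …`,
least significant digit first. -/
noncomputable def digit (b : Fin s → G) (p : ℕ) (j : Fin s) : ℕ :=
  p / (∏ i ∈ Finset.univ.filter (fun i => i < j), addOrderOf (b i)) % addOrderOf (b j)

/-- The group element at position `p` in the natural order of `G`. -/
noncomputable def eltAt (b : Fin s → G) (p : ℕ) : G := ∑ j, digit b p j • b j

/-- The character `χ` is at position `p` in the natural order of the dual group:
`χ (b j) = exp (2 π i k_j / ord (b j))`, where `k_j` are the digits of `p`. -/
def IsCharAt (b : Fin s → G) (p : ℕ) (χ : AddChar G Circle) : Prop :=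
  ∀ j, χ (b j) = Circle.exp (2 * Real.pi * (digit b p j : ℝ) / (addOrderOf (b j) : ℝ))

/-- The discrete Fourier transform on `G`; characters are homomorphisms from `G` to the unit
circle. -/
noncomputable def dft [Fintype G] (α : G → ℂ) (χ : AddChar G Circle) : ℂ :=
  ∑ g, α g * (starRingEnd ℂ) (χ g : ℂ)

/-- The input as a sequence of rational numbers: the number of basis elements, the accuracy, the
orders of the basis elements, and the real and imaginary parts of the values of `α'` in the natural
order of `G`. -/
noncomputable def inputList [Fintype G] (b : Fin s → G) (α' : G → RatComplex) (ε : ℚ) : List ℚ :=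
  [(s : ℚ), ε] ++ List.ofFn (fun j => (addOrderOf (b j) : ℚ)) ++
    (List.range (Fintype.card G)).flatMap fun p => [(α' (eltAt b p)).re, (α' (eltAt b p)).im]

/-- The initial configuration: the input is in the first memory cells, all other memory cells and
all registers are zero. -/
noncomputable def initialState [Fintype G] (b : Fin s → G) (α' : G → RatComplex) (ε : ℚ) :
    RamState where
  reg := fun _ => 0
  mem := fun a => (inputList b α' ε).getD a 0

/-- The first memory cells hold the real and imaginary parts of the values of `β`, in the natural
order of the dual group. -/
def HoldsDualTable [Fintype G] (b : Fin s → G) (mem : ℕ → ℚ)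
    (β : AddChar G Circle → RatComplex) : Prop :=
  ∀ χ : AddChar G Circle, ∃ p < Fintype.card G, IsCharAt b p χ ∧
    mem (2 * p) = (β χ).re ∧ mem (2 * p + 1) = (β χ).im

end Group

/-! ### Sizes of rational numbers under arithmetic -/

/-! Write m_j for the orders of the basis elements. The transform on G is a composition of
transforms of length m_j, one for each coordinate. One pass transforms the least significant digit
of the position and puts the resulting frequency into the most significant place, so after s passes
all digits are again in natural order (`iterRotateDft_eq`, `IsCharAt.dft_eq`). A length m that is
not a power of two is handled by Bluestein's identity 2ik = i² + k² - (k-i)²: up to multiplications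
by values of the chirp exp(iπd²/m), the transform is a convolution with the chirp, and fast Fourier
transforms of length M = 2^r with 2m ≤ M ≤ 4m evaluate it (`cyclicDft_eq_convolution`,
`fftStage_succ`).

Accuracy: computed complex values are rounded to multiples of 1/D with D = S^64, where S dominates
n, 1/ε and all values of α'. The constants come from power series with N = 2⌈log₂ D⌉ terms: π is 4
Im(-log(1-z)) at z = (1+i)/2, and the roots of unity and chirps are exponentials, with an error of
at most μ = 2^27 N²/D. A butterfly stage multiplies the error by at most 5, a fast Fourier transform
by at most M³, a pass by at most (4m)^11 ≤ m^33, hence all passes by at most n^33. If Y bounds the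
values, the passes end with an error of at most n^34 Y μ, which is at most ε because D is so large a
power of S (`accuracy_le`, `groupDft_spec`). Replacing α' by α costs another nε.

Time: N = O(log n + γ + log(1/ε)). The tables of a coordinate cost O(m_j N), and ∑ m_j ≤ n. The
n/m_j transforms of a pass cost O(m_j log m_j) each, and the logarithms of the m_j add up to log n.
The total is O(n(log n + N)).

Word size: the program is written and analysed for an abstract machine with natural numbers, complex
numbers and complex arrays, and `CpxProgram.Exec.simulate` transfers each of its runs to the
Word-RAM. Cells hold input numbers, natural numbers of at most D², or multiples of 1/D of absolute
value at most D. The expressions between two assignments are fixed, so they lengthen numbers only by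
a constant factor (`RamExpr.fits_of_safe`). -/

theorem intSize_le_iff {z : ℤ} {k : ℕ} : intSize z ≤ 1 + k ↔ z.natAbs < 2 ^ k := by
  unfold intSize
  rw [Nat.add_le_add_iff_left, Nat.clog_le_iff_le_pow (by norm_num)]
  exact Nat.succ_le_iff

theorem intSize_mono {a b : ℤ} (h : a.natAbs ≤ b.natAbs) : intSize a ≤ intSize b := by
  unfold intSize
  gcongr

theorem natAbs_lt_of_intSize (z : ℤ) : z.natAbs < 2 ^ Nat.clog 2 (z.natAbs + 1) :=
  Nat.le_pow_clog (by norm_num) _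

/-- Cancelling common factors replaces p and q by divisors of them, so every fraction that
represents x bounds its size, not only the reduced one. -/
theorem ratSize_le_of_eq_div {x : ℚ} {p q : ℤ} {a b : ℕ} (hq : q ≠ 0) (hx : x = p / q)
    (hp : p.natAbs < 2 ^ a) (hqb : q.natAbs < 2 ^ b) : ratSize x ≤ 2 + a + b := by
  have h1 : x = Rat.divInt p q := by rw [hx, Rat.divInt_eq_div]
  have hden : intSize (x.den : ℤ) ≤ 1 + b := by
    rw [intSize_le_iff]
    refine lt_of_le_of_lt ?_ hqb
    apply Nat.le_of_dvd (Int.natAbs_pos.2 hq)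
    rw [h1, Int.natAbs_dvd_natAbs]
    exact Rat.den_dvd p q
  have hnum : intSize x.num ≤ 1 + a := by
    rw [intSize_le_iff]
    refine lt_of_le_of_lt ?_ hp
    by_cases h0 : p = 0
    · simp [hx, h0]
    · apply Nat.le_of_dvd (Int.natAbs_pos.2 h0)
      rw [h1, Int.natAbs_dvd_natAbs]
      exact Rat.num_dvd p hq
  unfold ratSize
  omega

theorem ratSize_pos (x : ℚ) : 2 ≤ ratSize x := by
  unfold ratSize intSize
  omega

/-- Over the common denominator, the numerator of the sum has at most one bit more than the two
numerators and denominators together. A bound linear in the sizes, the same for both operations,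
lets `RamExpr.growth` be a factor that depends on the expression only. -/
theorem ratSize_add_mul_bounds (a b : ℚ) : ratSize (a + b) ≤ 2 * (ratSize a + ratSize b) ∧
    ratSize (a * b) ≤ 2 * (ratSize a + ratSize b) := by
  have ha := natAbs_lt_of_intSize a.num
  have hb := natAbs_lt_of_intSize b.num
  have ha' := natAbs_lt_of_intSize (a.den : ℤ)
  have hb' := natAbs_lt_of_intSize (b.den : ℤ)
  have e1 : ratSize a = 2 + Nat.clog 2 (a.num.natAbs + 1) + Nat.clog 2 ((a.den : ℤ).natAbs + 1) := by
    unfold ratSize intSize; omega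
  have e2 : ratSize b = 2 + Nat.clog 2 (b.num.natAbs + 1) + Nat.clog 2 ((b.den : ℤ).natAbs + 1) := by
    unfold ratSize intSize; omega
  generalize Nat.clog 2 (a.num.natAbs + 1) = A1 at *
  generalize Nat.clog 2 (b.num.natAbs + 1) = B1 at *
  generalize Nat.clog 2 ((a.den : ℤ).natAbs + 1) = A2 at *
  generalize Nat.clog 2 ((b.den : ℤ).natAbs + 1) = B2 at *
  have hne : ((a.den : ℤ) * b.den) ≠ 0 := by
    have := a.den_ne_zero; have := b.den_ne_zero; positivity
  have hden : ((a.den : ℤ) * b.den).natAbs < 2 ^ (A2 + B2) := by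
    rw [Int.natAbs_mul, pow_add]; exact Nat.mul_lt_mul'' ha' hb'
  have had : (a.den : ℚ) ≠ 0 := by exact_mod_cast a.den_ne_zero
  have hbd : (b.den : ℚ) ≠ 0 := by exact_mod_cast b.den_ne_zero
  constructor
  · have hx : a + b = ((a.num * b.den + b.num * a.den : ℤ) : ℚ) / ((a.den * b.den : ℤ) : ℚ) := by
      push_cast
      conv_lhs => rw [← Rat.num_div_den a, ← Rat.num_div_den b]
      field_simp
    have hnum : (a.num * b.den + b.num * a.den : ℤ).natAbs < 2 ^ (A1 + A2 + B1 + B2 + 1) := by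
      have t1 : (a.num * b.den : ℤ).natAbs < 2 ^ (A1 + A2 + B1 + B2) := by
        rw [Int.natAbs_mul]
        calc _ < 2 ^ A1 * 2 ^ B2 := Nat.mul_lt_mul'' ha hb'
          _ ≤ _ := by rw [← pow_add]; exact Nat.pow_le_pow_right (by norm_num) (by omega)
      have t2 : (b.num * a.den : ℤ).natAbs < 2 ^ (A1 + A2 + B1 + B2) := by
        rw [Int.natAbs_mul]
        calc _ < 2 ^ B1 * 2 ^ A2 := Nat.mul_lt_mul'' hb ha'
          _ ≤ _ := by rw [← pow_add]; exact Nat.pow_le_pow_right (by norm_num) (by omega)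
      have := Int.natAbs_add_le (a.num * b.den) (b.num * a.den)
      rw [pow_succ]; omega
    have := ratSize_le_of_eq_div hne hx hnum hden
    omega
  · have hx : a * b = ((a.num * b.num : ℤ) : ℚ) / ((a.den * b.den : ℤ) : ℚ) := by
      push_cast
      conv_lhs => rw [← Rat.num_div_den a, ← Rat.num_div_den b]
      field_simp
    have hnum : (a.num * b.num : ℤ).natAbs < 2 ^ (A1 + B1) := by
      rw [Int.natAbs_mul, pow_add]; exact Nat.mul_lt_mul'' ha hb
    have := ratSize_le_of_eq_div hne hx hnum hden
    omega

theorem ratSize_neg (a : ℚ) : ratSize (-a) = ratSize a := by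
  simp [ratSize, intSize]

theorem ratSize_inv (a : ℚ) (h : a ≠ 0) : ratSize a⁻¹ ≤ ratSize a := by
  have hn : a.num ≠ 0 := Rat.num_ne_zero.2 h
  have hx : a⁻¹ = ((a.den : ℤ) : ℚ) / ((a.num : ℤ) : ℚ) := by
    conv_lhs => rw [← Rat.num_div_den a]
    rw [inv_div]; simp
  have := ratSize_le_of_eq_div hn hx (natAbs_lt_of_intSize _) (natAbs_lt_of_intSize _)
  unfold ratSize intSize at *
  omega

/-- For q ≥ 1 the integer part of p/q has absolute value at most |p|; for negative p this is p ≤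
⌊p/q⌋ < 0. -/
theorem ratSize_floor (a : ℚ) : ratSize (⌊a⌋ : ℚ) ≤ ratSize a := by
  have hd : (0 : ℤ) < a.den := by exact_mod_cast a.den_pos
  have h1 : (⌊a⌋ : ℤ).natAbs ≤ a.num.natAbs := by
    rw [show ⌊a⌋ = a.num / (a.den : ℤ) from Rat.floor_def']
    rcases le_or_gt 0 a.num with h | h
    · have h2 : 0 ≤ a.num / (a.den : ℤ) := Int.ediv_nonneg h hd.le
      have h3 : a.num / (a.den : ℤ) ≤ a.num := Int.ediv_le_self _ h
      omega
    · have h2 : a.num / (a.den : ℤ) < 0 := Int.ediv_neg_of_neg_of_pos h hd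
      have h3 : a.num ≤ a.num / (a.den : ℤ) := by
        rw [Int.le_ediv_iff_mul_le hd]; nlinarith
      omega
  unfold ratSize
  have h4 : intSize ((⌊a⌋ : ℚ).num) ≤ intSize a.num := by
    rw [Rat.num_intCast]; exact intSize_mono h1
  have h5 : intSize (((⌊a⌋ : ℚ).den : ℕ) : ℤ) ≤ intSize (a.den : ℤ) := by
    rw [Rat.den_intCast]; apply intSize_mono; have := a.den_pos; simp; omega
  omega

/-! ### Evaluation of expressions with bounded contents -/

/-- All registers and memory cells have size at most `W`. -/
def RamState.Small (W : ℕ) (σ : RamState) : Prop :=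
  (∀ r, ratSize (σ.reg r) ≤ W) ∧ ∀ a, ratSize (σ.mem a) ≤ W

/-- All addresses are natural numbers and all divisors are nonzero. -/
def RamExpr.Safe (σ : RamState) : RamExpr → Prop
  | .lit _ => True
  | .reg _ => True
  | .load a => a.Safe σ ∧ ∃ k : ℕ, a.eval σ = k
  | .add a b => a.Safe σ ∧ b.Safe σ
  | .sub a b => a.Safe σ ∧ b.Safe σ
  | .mul a b => a.Safe σ ∧ b.Safe σ
  | .div a b => a.Safe σ ∧ b.Safe σ ∧ b.eval σ ≠ 0
  | .floor a => a.Safe σ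

/-- A factor by which evaluating an expression can increase sizes. -/
def RamExpr.growth : RamExpr → ℕ
  | .lit z => ratSize z
  | .reg _ => 1
  | .load a => a.growth + 1
  | .add a b => 2 * (a.growth + b.growth)
  | .sub a b => 2 * (a.growth + b.growth)
  | .mul a b => 2 * (a.growth + b.growth)
  | .div a b => 2 * (a.growth + b.growth)
  | .floor a => a.growth

/-- Structural induction: a memory access yields a value of size at most W whatever the address was,
and an arithmetic operation at most doubles the sum of the sizes. This separates the bookkeeping of
word lengths from the legality of addresses and divisors. -/
theorem RamExpr.fits_of_safe {W w : ℕ} {σ : RamState} (hσ : σ.Small W) (e : RamExpr)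
    (he : e.Safe σ) (hw : e.growth * W ≤ w) : e.Fits w σ ∧ ratSize (e.eval σ) ≤ e.growth * W := by
  have hW : 1 ≤ W := le_trans (le_trans (by norm_num) (ratSize_pos _)) (hσ.1 0)
  have key : ∀ a b c : ℕ, c ≤ 2 * (a * W + b * W) → c ≤ 2 * (a + b) * W := by
    intro a b c h; linarith [h, show 2 * (a + b) * W = 2 * (a * W + b * W) by ring]
  have kl : ∀ a b : ℕ, 2 * (a + b) * W ≤ w → a * W ≤ w ∧ b * W ≤ w := by
    intro a b h; have : 2 * (a + b) * W = 2 * (a * W) + 2 * (b * W) := by ring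
    omega
  induction e with
  | lit z =>
    have : ratSize (z : ℚ) ≤ ratSize (z : ℚ) * W := Nat.le_mul_of_pos_right _ hW
    exact ⟨this.trans hw, this⟩
  | reg r =>
    have : ratSize (σ.reg r) ≤ 1 * W := by simpa using hσ.1 r
    exact ⟨this.trans hw, this⟩
  | load a ih =>
    have h1 : a.growth * W ≤ (a.growth + 1) * W := by gcongr; omega
    have h2 := hσ.2 (a.eval σ).num.toNat
    have h3 : ratSize (RamExpr.eval σ (.load a)) ≤ (a.growth + 1) * W :=
      h2.trans (Nat.le_mul_of_pos_left _ (by omega))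
    exact ⟨⟨(ih he.1 (h1.trans hw)).1, he.2, h3.trans hw⟩, h3⟩
  | add a b iha ihb =>
    have h := kl _ _ hw
    have ha := iha he.1 h.1
    have hb := ihb he.2 h.2
    have h3 := key a.growth b.growth _ ((ratSize_add_mul_bounds (a.eval σ) (b.eval σ)).1.trans
      (Nat.mul_le_mul_left 2 (Nat.add_le_add ha.2 hb.2)))
    exact ⟨⟨ha.1, hb.1, h3.trans hw⟩, h3⟩
  | sub a b iha ihb =>
    have h := kl _ _ hw
    have ha := iha he.1 h.1
    have hb := ihb he.2 h.2
    have h4 := (ratSize_add_mul_bounds (a.eval σ) (-b.eval σ)).1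
    rw [ratSize_neg, ← sub_eq_add_neg] at h4
    have h3 := key a.growth b.growth _ (h4.trans
      (Nat.mul_le_mul_left 2 (Nat.add_le_add ha.2 hb.2)))
    exact ⟨⟨ha.1, hb.1, h3.trans hw⟩, h3⟩
  | mul a b iha ihb =>
    have h := kl _ _ hw
    have ha := iha he.1 h.1
    have hb := ihb he.2 h.2
    have h3 := key a.growth b.growth _ ((ratSize_add_mul_bounds (a.eval σ) (b.eval σ)).2.trans
      (Nat.mul_le_mul_left 2 (Nat.add_le_add ha.2 hb.2)))
    exact ⟨⟨ha.1, hb.1, h3.trans hw⟩, h3⟩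
  | div a b iha ihb =>
    have h := kl _ _ hw
    have ha := iha he.1 h.1
    have hb := ihb he.2.1 h.2
    have h4 := (ratSize_add_mul_bounds (a.eval σ) (b.eval σ)⁻¹).2
    rw [← div_eq_mul_inv] at h4
    have h5 := ratSize_inv _ he.2.2
    have h3 := key a.growth b.growth _ (h4.trans
      (Nat.mul_le_mul_left 2 (Nat.add_le_add ha.2 (h5.trans hb.2))))
    exact ⟨⟨ha.1, hb.1, he.2.2, h3.trans hw⟩, h3⟩
  | floor a ih =>
    have ha := ih he hw
    have h3 := (ratSize_floor (a.eval σ)).trans ha.2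
    exact ⟨⟨ha.1, h3.trans hw⟩, h3⟩

/-- If D < 2^k, then numerators up to D² have 2k bits and the denominator has k. Rounding to this
grid prevents sizes from accumulating in the course of a computation. -/
theorem ratSize_grid {D : ℕ} {x : ℚ} {z : ℤ} (hD : 0 < D) (hx : x = z / D)
    (hz : z.natAbs ≤ D ^ 2) : ratSize x ≤ 3 * Nat.clog 2 (D + 1) + 2 := by
  have h := Nat.le_pow_clog (b := 2) (by norm_num) (D + 1)
  set k := Nat.clog 2 (D + 1)
  have h1 : z.natAbs < 2 ^ (2 * k) := by
    rw [mul_comm, pow_mul]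
    exact lt_of_le_of_lt hz (Nat.pow_lt_pow_left (by omega) (by norm_num))
  have := ratSize_le_of_eq_div (x := x) (p := z) (q := D) (a := 2 * k) (b := k) (by omega)
    (by rw [hx]; simp) h1 (by simpa using h)
  omega

theorem ratSize_natCast {D v : ℕ} (hv : v ≤ D ^ 2) :
    ratSize (v : ℚ) ≤ 3 * Nat.clog 2 (D + 1) + 3 := by
  have h := Nat.le_pow_clog (b := 2) (by norm_num) (D + 1)
  set k := Nat.clog 2 (D + 1)
  have h1 : ((v : ℤ)).natAbs < 2 ^ (2 * k) := by
    rw [mul_comm, pow_mul]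
    exact lt_of_le_of_lt (by simpa using hv) (Nat.pow_lt_pow_left (by omega) (by norm_num))
  have := ratSize_le_of_eq_div (x := (v : ℚ)) (p := v) (q := 1) (a := 2 * k) (b := 1) (by omega)
    (by simp) h1 (by norm_num)
  omega

/-! ### A machine with natural and complex registers and complex arrays -/

/-- Expressions with natural values: constants, registers, arithmetic. -/
inductive NatExpr where
  | lit (k : ℕ)
  | reg (r : ℕ)
  | add (a b : NatExpr)
  | sub (a b : NatExpr)
  | mul (a b : NatExpr)
  | div (a b : NatExpr)
  | mod (a b : NatExpr)

/-- Expressions with complex values: registers, array entries, arithmetic. -/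
inductive CpxExpr where
  | reg (r : ℕ)
  | load (k : ℕ) (i : NatExpr)
  | I
  | ofNat (e : NatExpr)
  | add (x y : CpxExpr)
  | mul (x y : CpxExpr)
  | conj (x : CpxExpr)
  | im (x : CpxExpr)
  | divNat (x : CpxExpr) (e : NatExpr)

/-- Contents of the natural registers, the complex registers, the complex arrays, and the memory
cells below the arrays. -/
structure CpxState where
  nat : ℕ → ℕ
  cpx : ℕ → ℂ
  arr : ℕ → ℕ → ℂ
  low : ℕ → ℝ

namespace NatExpr

/-- The value of an expression. -/
def eval (f : ℕ → ℕ) : NatExpr → ℕ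
  | lit k => k
  | reg r => f r
  | add a b => a.eval f + b.eval f
  | sub a b => a.eval f - b.eval f
  | mul a b => a.eval f * b.eval f
  | div a b => a.eval f / b.eval f
  | mod a b => a.eval f % b.eval f

/-- Differences are nonnegative and divisors nonzero. -/
def Ok (f : ℕ → ℕ) : NatExpr → Prop
  | lit _ => True
  | reg _ => True
  | add a b => a.Ok f ∧ b.Ok f
  | sub a b => a.Ok f ∧ b.Ok f ∧ b.eval f ≤ a.eval f
  | mul a b => a.Ok f ∧ b.Ok f
  | div a b => a.Ok f ∧ b.Ok f ∧ b.eval f ≠ 0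
  | mod a b => a.Ok f ∧ b.Ok f ∧ b.eval f ≠ 0

/-- Translation into machine expressions; the natural register `r` is the register `4 * r`. -/
def toRam : NatExpr → RamExpr
  | lit k => .lit k
  | reg r => .reg (4 * r)
  | add a b => .add a.toRam b.toRam
  | sub a b => .sub a.toRam b.toRam
  | mul a b => .mul a.toRam b.toRam
  | div a b => .floor (.div a.toRam b.toRam)
  | mod a b => .sub a.toRam (.mul b.toRam (.floor (.div a.toRam b.toRam)))

theorem toRam_spec {σ : RamState} {f : ℕ → ℕ} (h : ∀ r, σ.reg (4 * r) = f r) (e : NatExpr)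
    (he : e.Ok f) : e.toRam.Safe σ ∧ e.toRam.eval σ = e.eval f := by
  induction e with
  | lit k => simp [toRam, RamExpr.Safe, RamExpr.eval, eval]
  | reg r => simp [toRam, RamExpr.Safe, RamExpr.eval, eval, h]
  | add a b iha ihb =>
    simp [toRam, RamExpr.Safe, RamExpr.eval, eval, iha he.1, ihb he.2]
  | sub a b iha ihb =>
    simp [toRam, RamExpr.Safe, RamExpr.eval, eval, iha he.1, ihb he.2.1, Nat.cast_sub he.2.2]
  | mul a b iha ihb =>
    simp [toRam, RamExpr.Safe, RamExpr.eval, eval, iha he.1, ihb he.2]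
  | div a b iha ihb =>
    have := he.2.2
    simp [toRam, RamExpr.Safe, RamExpr.eval, eval, iha he.1, ihb he.2.1, this,
      Rat.floor_natCast_div_natCast]
    norm_cast
  | mod a b iha ihb =>
    have := he.2.2
    simp only [toRam, RamExpr.Safe, RamExpr.eval, eval, iha he.1, ihb he.2.1,
      Rat.floor_natCast_div_natCast, true_and, ne_eq, Nat.cast_eq_zero, this, not_false_eq_true]
    have h1 := Nat.div_add_mod (a.eval f) (b.eval f)
    have h2 : ((b.eval f * (a.eval f / b.eval f) + a.eval f % b.eval f : ℕ) : ℚ) = a.eval f := by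
      rw [h1]
    rw [← h2, ← Int.natCast_div, Int.cast_natCast]
    push_cast
    ring

end NatExpr

/-- The address of the real part of the entry `i` of the array `k`. -/
def arrayAddr (k : ℕ) (i : NatExpr) : NatExpr :=
  .add (.reg 0) (.add (.mul (.lit 16) i) (.lit (2 * k)))

namespace CpxExpr

/-- The value of an expression. -/
noncomputable def eval (A : CpxState) : CpxExpr → ℂ
  | reg r => A.cpx r
  | load k i => A.arr k (i.eval A.nat)
  | I => Complex.I
  | ofNat e => (e.eval A.nat : ℂ)
  | add x y => x.eval A + y.eval A
  | mul x y => x.eval A * y.eval A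
  | conj x => (starRingEnd ℂ) (x.eval A)
  | im x => ((x.eval A).im : ℂ)
  | divNat x e => x.eval A / (e.eval A.nat : ℂ)

/-- Indices and divisors are legal; `B` is the first cell that belongs to an array. -/
def Ok (B : ℕ) (A : CpxState) : CpxExpr → Prop
  | reg _ => True
  | load k i => k < 8 ∧ i.Ok A.nat ∧ A.nat 0 = B
  | I => True
  | ofNat e => e.Ok A.nat
  | add x y => x.Ok B A ∧ y.Ok B A
  | mul x y => x.Ok B A ∧ y.Ok B A
  | conj x => x.Ok B A
  | im x => x.Ok B A
  | divNat x e => x.Ok B A ∧ e.Ok A.nat ∧ e.eval A.nat ≠ 0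

/-- Translation into machine expressions for the real and the imaginary part; the complex register
`r` consists of the registers `4 * r + 1` and `4 * r + 2`. -/
def toRam : CpxExpr → RamExpr × RamExpr
  | reg r => (.reg (4 * r + 1), .reg (4 * r + 2))
  | load k i => (.load (arrayAddr k i).toRam, .load (.add (arrayAddr k i).toRam (.lit 1)))
  | I => (.lit 0, .lit 1)
  | ofNat e => (e.toRam, .lit 0)
  | add x y => (.add x.toRam.1 y.toRam.1, .add x.toRam.2 y.toRam.2)
  | mul x y => (.sub (.mul x.toRam.1 y.toRam.1) (.mul x.toRam.2 y.toRam.2),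
      .add (.mul x.toRam.1 y.toRam.2) (.mul x.toRam.2 y.toRam.1))
  | conj x => (x.toRam.1, .sub (.lit 0) x.toRam.2)
  | im x => (x.toRam.2, .lit 0)
  | divNat x e => (.div x.toRam.1 e.toRam, .div x.toRam.2 e.toRam)

end CpxExpr

/-- The Word-RAM configuration `σ` represents `A`. -/
structure Represents (B : ℕ) (σ : RamState) (A : CpxState) : Prop where
  nat : ∀ r, σ.reg (4 * r) = A.nat r
  re : ∀ r, (σ.reg (4 * r + 1) : ℝ) = (A.cpx r).re
  im : ∀ r, (σ.reg (4 * r + 2) : ℝ) = (A.cpx r).im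
  low : ∀ a < B, (σ.mem a : ℝ) = A.low a
  arr_re : ∀ k < 8, ∀ i, (σ.mem (B + (16 * i + 2 * k)) : ℝ) = (A.arr k i).re
  arr_im : ∀ k < 8, ∀ i, (σ.mem (B + (16 * i + 2 * k) + 1) : ℝ) = (A.arr k i).im

/-- The eight arrays are interleaved above cell B with period 16, so that none of them needs a
length in advance and different entries occupy different cells. -/
theorem arrayAddr_spec {B : ℕ} {σ : RamState} {A : CpxState} (h : Represents B σ A) {k : ℕ}
    {i : NatExpr} (hi : i.Ok A.nat) (hB : A.nat 0 = B) :
    (arrayAddr k i).toRam.Safe σ ∧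
      (arrayAddr k i).toRam.eval σ = ((B + (16 * i.eval A.nat + 2 * k) : ℕ) : ℚ) := by
  have := NatExpr.toRam_spec h.nat (arrayAddr k i) (by simp [arrayAddr, NatExpr.Ok, hi])
  refine ⟨this.1, this.2.trans ?_⟩
  simp [arrayAddr, NatExpr.eval, hB]

theorem CpxExpr.toRam_spec {B : ℕ} {σ : RamState} {A : CpxState} (h : Represents B σ A)
    (x : CpxExpr) (hx : x.Ok B A) : (x.toRam.1.Safe σ ∧ x.toRam.2.Safe σ) ∧
      (x.toRam.1.eval σ : ℝ) = (x.eval A).re ∧ (x.toRam.2.eval σ : ℝ) = (x.eval A).im := by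
  induction x with
  | reg r => simp [toRam, RamExpr.Safe, RamExpr.eval, eval, h.re, h.im]
  | load k i =>
    obtain ⟨h1, h2⟩ := arrayAddr_spec (k := k) h hx.2.1 hx.2.2
    refine ⟨⟨⟨h1, _, h2⟩, ⟨⟨h1, trivial⟩, B + (16 * i.eval A.nat + 2 * k) + 1, ?_⟩⟩, ?_, ?_⟩
    · simp only [RamExpr.eval, h2]; push_cast; ring
    · simp only [toRam, RamExpr.eval, h2, eval]
      rw [Rat.num_natCast, Int.toNat_natCast]
      exact h.arr_re _ hx.1 _
    · simp only [toRam, RamExpr.eval, h2, eval]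
      rw [show (((B + (16 * i.eval A.nat + 2 * k) : ℕ) : ℚ) + ((1 : ℤ) : ℚ)) =
        ((B + (16 * i.eval A.nat + 2 * k) + 1 : ℕ) : ℚ) by push_cast; ring]
      rw [Rat.num_natCast, Int.toNat_natCast]
      exact h.arr_im _ hx.1 _
  | I => simp [toRam, RamExpr.Safe, RamExpr.eval, eval]
  | ofNat e =>
    obtain ⟨h1, h2⟩ := e.toRam_spec h.nat hx
    simp [toRam, RamExpr.Safe, RamExpr.eval, eval, h1, h2]
  | add x y ihx ihy =>
    obtain ⟨⟨a1, a2⟩, a3, a4⟩ := ihx hx.1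
    obtain ⟨⟨b1, b2⟩, b3, b4⟩ := ihy hx.2
    simp [toRam, RamExpr.Safe, RamExpr.eval, eval, a1, a2, a3, a4, b1, b2, b3, b4]
  | mul x y ihx ihy =>
    obtain ⟨⟨a1, a2⟩, a3, a4⟩ := ihx hx.1
    obtain ⟨⟨b1, b2⟩, b3, b4⟩ := ihy hx.2
    simp [toRam, RamExpr.Safe, RamExpr.eval, eval, a1, a2, a3, a4, b1, b2, b3, b4]
  | conj x ihx =>
    obtain ⟨⟨a1, a2⟩, a3, a4⟩ := ihx hx
    simp [toRam, RamExpr.Safe, RamExpr.eval, eval, a1, a2, a3, a4]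
  | im x ihx =>
    obtain ⟨⟨a1, a2⟩, a3, a4⟩ := ihx hx
    simp [toRam, RamExpr.Safe, RamExpr.eval, eval, a2, a4]
  | divNat x e ihx =>
    obtain ⟨⟨a1, a2⟩, a3, a4⟩ := ihx hx.1
    obtain ⟨h1, h2⟩ := e.toRam_spec h.nat hx.2.1
    have h3 := hx.2.2
    simp [toRam, RamExpr.Safe, RamExpr.eval, eval, a1, a2, a3, a4, h1, h2, h3]

/-- Rounding of real and imaginary part to multiples of `1 / D`. -/
noncomputable def gridRound (D : ℕ) (z : ℂ) : ℂ :=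
  ⟨(⌊z.re * D⌋ : ℝ) / D, (⌊z.im * D⌋ : ℝ) / D⟩

/-- Programs of the machine with complex arrays. -/
inductive CpxProgram where
  | skip
  | setNat (r : ℕ) (e : NatExpr)
  | readNat (r : ℕ) (a : NatExpr)
  | recip (r : ℕ) (a : NatExpr)
  | readCpx (r : ℕ) (a : NatExpr)
  | writeCpx (a : NatExpr) (r : ℕ)
  | normSq (r c : ℕ)
  | setCpx (r : ℕ) (x : CpxExpr)
  | load (r k : ℕ) (i : NatExpr)
  | store (k : ℕ) (i : NatExpr) (r : ℕ)
  | seq (p q : CpxProgram)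
  | branch (a b : NatExpr) (p q : CpxProgram)
  | loop (a b : NatExpr) (p : CpxProgram)

namespace CpxState

/-- Assignment to a natural register. -/
def setNat (A : CpxState) (r v : ℕ) : CpxState := { A with nat := Function.update A.nat r v }

/-- Assignment to a complex register. -/
noncomputable def setCpx (A : CpxState) (r : ℕ) (z : ℂ) : CpxState :=
  { A with cpx := Function.update A.cpx r z }

/-- Assignment to an array entry. -/
noncomputable def setArr (A : CpxState) (k i : ℕ) (z : ℂ) : CpxState :=
  { A with arr := Function.update A.arr k (Function.update (A.arr k) i z) }

/-- Assignment to two consecutive low memory cells. -/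
noncomputable def setLow (A : CpxState) (a : ℕ) (z : ℂ) : CpxState :=
  { A with low := Function.update (Function.update A.low a z.re) (a + 1) z.im }

end CpxState

open CpxState in
/-- `p.Exec B D A t A'`: started in `A`, the program halts in `A'` after `t` steps. Arrays begin
at the memory cell `B`, and `1 / D` is the accuracy of complex assignments. -/
inductive CpxProgram.Exec (B D : ℕ) : CpxProgram → CpxState → ℕ → CpxState → Prop
  | skip (A : CpxState) : Exec B D .skip A 1 A
  | setNat (A : CpxState) (r : ℕ) (e : NatExpr) (h : NatExpr.Ok A.nat e) (hv : e.eval A.nat ≤ D ^ 2) :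
      Exec B D (.setNat r e) A 1 (A.setNat r (e.eval A.nat))
  | readNat (A : CpxState) (r : ℕ) (a : NatExpr) (v : ℕ) (h : NatExpr.Ok A.nat a) (ha : a.eval A.nat < B)
      (hv : A.low (a.eval A.nat) = v) : Exec B D (.readNat r a) A 1 (A.setNat r v)
  | recip (A : CpxState) (r : ℕ) (a : NatExpr) (h : NatExpr.Ok A.nat a) (ha : a.eval A.nat < B)
      (h0 : 0 < A.low (a.eval A.nat)) (hv : ⌊1 / A.low (a.eval A.nat)⌋₊ ≤ D ^ 2) :
      Exec B D (.recip r a) A 1 (A.setNat r ⌊1 / A.low (a.eval A.nat)⌋₊)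
  | readCpx (A : CpxState) (r : ℕ) (a : NatExpr) (h : NatExpr.Ok A.nat a) (ha : a.eval A.nat + 1 < B) :
      Exec B D (.readCpx r a) A 1
        (A.setCpx r ⟨A.low (a.eval A.nat), A.low (a.eval A.nat + 1)⟩)
  | writeCpx (A : CpxState) (a : NatExpr) (r : ℕ) (h : NatExpr.Ok A.nat a) (ha : a.eval A.nat + 1 < B) :
      Exec B D (.writeCpx a r) A 1 (A.setLow (a.eval A.nat) (A.cpx r))
  | normSq (A : CpxState) (r : ℕ) (c : ℕ) (hv : ⌊Complex.normSq (A.cpx c)⌋₊ ≤ D ^ 2) :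
      Exec B D (.normSq r c) A 1 (A.setNat r ⌊Complex.normSq (A.cpx c)⌋₊)
  | setCpx (A : CpxState) (r : ℕ) (x : CpxExpr) (hD : A.nat 1 = D) (h : CpxExpr.Ok B A x) (hx : ‖x.eval A‖ + 1 ≤ D) :
      Exec B D (.setCpx r x) A 1 (A.setCpx r (gridRound D (x.eval A)))
  | load (A : CpxState) (r : ℕ) (k : ℕ) (i : NatExpr) (hk : k < 8) (h : NatExpr.Ok A.nat i) (hB : A.nat 0 = B) :
      Exec B D (.load r k i) A 1 (A.setCpx r (A.arr k (i.eval A.nat)))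
  | store (A : CpxState) (k : ℕ) (i : NatExpr) (r : ℕ) (hk : k < 8) (h : NatExpr.Ok A.nat i) (hB : A.nat 0 = B) :
      Exec B D (.store k i r) A 1 (A.setArr k (i.eval A.nat) (A.cpx r))
  | seq {A A' A'' : CpxState} {t u : ℕ} {p q : CpxProgram} (hp : Exec B D p A t A') (hq : Exec B D q A' u A'') :
      Exec B D (.seq p q) A (t + u) A''
  | branch_true {A A' : CpxState} {t : ℕ} {a b : NatExpr} {p q : CpxProgram} (ha : NatExpr.Ok A.nat a) (hb : NatExpr.Ok A.nat b)
      (hab : a.eval A.nat < b.eval A.nat) (hp : Exec B D p A t A') :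
      Exec B D (.branch a b p q) A (1 + t) A'
  | branch_false {A A' : CpxState} {t : ℕ} {a b : NatExpr} {p q : CpxProgram} (ha : NatExpr.Ok A.nat a) (hb : NatExpr.Ok A.nat b)
      (hab : ¬ a.eval A.nat < b.eval A.nat) (hq : Exec B D q A t A') :
      Exec B D (.branch a b p q) A (1 + t) A'
  | loop_true {A A' A'' : CpxState} {t u : ℕ} {a b : NatExpr} {p : CpxProgram} (ha : NatExpr.Ok A.nat a) (hb : NatExpr.Ok A.nat b)
      (hab : a.eval A.nat < b.eval A.nat) (hp : Exec B D p A t A')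
      (hl : Exec B D (.loop a b p) A' u A'') : Exec B D (.loop a b p) A (1 + t + u) A''
  | loop_false {A : CpxState} {a b : NatExpr} {p : CpxProgram} (ha : NatExpr.Ok A.nat a) (hb : NatExpr.Ok A.nat b)
      (hab : ¬ a.eval A.nat < b.eval A.nat) : Exec B D (.loop a b p) A 1 A

namespace CpxProgram

/-- Rounding to a multiple of `1 / D`, where `D` is in the natural register `1`. -/
def roundRam (e : RamExpr) : RamExpr := .div (.floor (.mul e (.reg 4))) (.reg 4)

/-- Translation into Word-RAM programs. -/
def toRam : CpxProgram → RamProgram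
  | skip => .skip
  | setNat r e => .setReg (4 * r) e.toRam
  | readNat r a => .setReg (4 * r) (.load a.toRam)
  | recip r a => .setReg (4 * r) (.floor (.div (.lit 1) (.load a.toRam)))
  | readCpx r a => .seq (.setReg (4 * r + 1) (.load a.toRam))
      (.setReg (4 * r + 2) (.load (.add a.toRam (.lit 1))))
  | writeCpx a r => .seq (.store a.toRam (.reg (4 * r + 1)))
      (.store (.add a.toRam (.lit 1)) (.reg (4 * r + 2)))
  | normSq r c => .setReg (4 * r) (.floor (.add (.mul (.reg (4 * c + 1)) (.reg (4 * c + 1)))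
      (.mul (.reg (4 * c + 2)) (.reg (4 * c + 2)))))
  | setCpx r x => .seq (.seq (.setReg 3 (roundRam x.toRam.1)) (.setReg 7 (roundRam x.toRam.2)))
      (.seq (.setReg (4 * r + 1) (.reg 3)) (.setReg (4 * r + 2) (.reg 7)))
  | load r k i => .seq (.setReg (4 * r + 1) (.load (arrayAddr k i).toRam))
      (.setReg (4 * r + 2) (.load (.add (arrayAddr k i).toRam (.lit 1))))
  | store k i r => .seq (.store (arrayAddr k i).toRam (.reg (4 * r + 1)))
      (.store (.add (arrayAddr k i).toRam (.lit 1)) (.reg (4 * r + 2)))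
  | seq p q => .seq p.toRam q.toRam
  | branch a b p q => .branch a.toRam b.toRam p.toRam q.toRam
  | loop a b p => .loop a.toRam b.toRam p.toRam

end CpxProgram

namespace RamProgram

/-- A bound on the growth of the expressions in a program. -/
def growth : RamProgram → ℕ
  | skip => 0
  | setReg _ e => e.growth
  | store a e => a.growth + e.growth
  | seq p q => p.growth + q.growth
  | branch a b p q => a.growth + b.growth + (p.growth + q.growth)
  | loop a b p => a.growth + b.growth + p.growth

/-- A bound on the cost of the elementary statements of a program. -/
def unitCost : RamProgram → ℕ
  | skip => 1
  | setReg _ e => e.cost + 1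
  | store a e => a.cost + e.cost + 1
  | seq p q => p.unitCost + q.unitCost
  | branch a b p q => a.cost + b.cost + 1 + (p.unitCost + q.unitCost)
  | loop a b p => a.cost + b.cost + 1 + p.unitCost

end RamProgram

/-! ### Simulation on the Word-RAM -/

theorem RamState.Small.setReg {W : ℕ} {σ : RamState} (h : σ.Small W) (r : ℕ) {v : ℚ}
    (hv : ratSize v ≤ W) : RamState.Small W ⟨Function.update σ.reg r v, σ.mem⟩ := by
  refine ⟨fun q => ?_, h.2⟩
  simp only [Function.update_apply]
  split_ifs
  · exact hv
  · exact h.1 q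

theorem RamState.Small.setMem {W : ℕ} {σ : RamState} (h : σ.Small W) (a : ℕ) {v : ℚ}
    (hv : ratSize v ≤ W) : RamState.Small W ⟨σ.reg, Function.update σ.mem a v⟩ := by
  refine ⟨h.1, fun q => ?_⟩
  simp only [Function.update_apply]
  split_ifs
  · exact hv
  · exact h.2 q

namespace Represents

variable {B : ℕ} {σ : RamState} {A : CpxState}

theorem setNat (h : Represents B σ A) (r v : ℕ) {x : ℚ} (hx : x = v) :
    Represents B ⟨Function.update σ.reg (4 * r) x, σ.mem⟩ (A.setNat r v) := by
  constructor
  · intro q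
    simp only [CpxState.setNat, Function.update_apply, hx, h.nat q]
    by_cases hq : q = r <;> simp [hq]
  · intro q
    (dsimp only; rw [Function.update_of_ne (by omega)]); exact h.re q
  · intro q
    (dsimp only; rw [Function.update_of_ne (by omega)]); exact h.im q
  · exact h.low
  · exact h.arr_re
  · exact h.arr_im

/-- Registers with index 3 modulo 4 represent nothing and serve as scratch space. -/
theorem setTemp (h : Represents B σ A) (r : ℕ) (x : ℚ) :
    Represents B ⟨Function.update σ.reg (4 * r + 3) x, σ.mem⟩ A := by
  constructor
  · intro q
    (dsimp only; rw [Function.update_of_ne (by omega)]); exact h.nat q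
  · intro q
    (dsimp only; rw [Function.update_of_ne (by omega)]); exact h.re q
  · intro q
    (dsimp only; rw [Function.update_of_ne (by omega)]); exact h.im q
  · exact h.low
  · exact h.arr_re
  · exact h.arr_im

theorem setCpx (h : Represents B σ A) (r : ℕ) {x y : ℚ} {z : ℂ} (hx : (x : ℝ) = z.re)
    (hy : (y : ℝ) = z.im) :
    Represents B ⟨Function.update (Function.update σ.reg (4 * r + 1) x) (4 * r + 2) y, σ.mem⟩
      (A.setCpx r z) := by
  constructor
  · intro q
    (dsimp only; rw [Function.update_of_ne (by omega), Function.update_of_ne (by omega)]); exact h.nat q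
  · intro q
    (dsimp only; rw [Function.update_of_ne (by omega)])
    by_cases hq : q = r
    · subst hq; simp [CpxState.setCpx, hx]
    · simp [CpxState.setCpx, hq, h.re q]
  · intro q
    by_cases hq : q = r
    · subst hq; simp [CpxState.setCpx, hy]
    · have : 4 * q + 2 ≠ 4 * r + 1 := by omega
      simp [CpxState.setCpx, hq, h.im q, this]
  · exact h.low
  · exact h.arr_re
  · exact h.arr_im

theorem setLow (h : Represents B σ A) {a : ℕ} (ha : a + 1 < B) {x y : ℚ} {z : ℂ}
    (hx : (x : ℝ) = z.re) (hy : (y : ℝ) = z.im) :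
    Represents B ⟨σ.reg, Function.update (Function.update σ.mem a x) (a + 1) y⟩
      (A.setLow a z) := by
  constructor
  · exact h.nat
  · exact h.re
  · exact h.im
  · intro q hq
    simp only [CpxState.setLow, Function.update_apply]
    split_ifs
    · exact hy
    · exact hx
    · exact h.low q hq
  · intro k hk i
    (dsimp only; rw [Function.update_of_ne (by omega), Function.update_of_ne (by omega)]); exact h.arr_re k hk i
  · intro k hk i
    (dsimp only; rw [Function.update_of_ne (by omega), Function.update_of_ne (by omega)]); exact h.arr_im k hk i

theorem setArr (h : Represents B σ A) {k : ℕ} (hk : k < 8) (i : ℕ) {x y : ℚ} {z : ℂ}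
    (hx : (x : ℝ) = z.re) (hy : (y : ℝ) = z.im) :
    Represents B ⟨σ.reg, Function.update (Function.update σ.mem (B + (16 * i + 2 * k)) x)
      (B + (16 * i + 2 * k) + 1) y⟩ (A.setArr k i z) := by
  constructor
  · exact h.nat
  · exact h.re
  · exact h.im
  · intro q hq
    (dsimp only; rw [Function.update_of_ne (by omega), Function.update_of_ne (by omega)]); exact h.low q hq
  · intro k' hk' i'
    (dsimp only; rw [Function.update_of_ne (by omega)])
    by_cases hq : k' = k ∧ i' = i
    · obtain ⟨rfl, rfl⟩ := hq; simp [CpxState.setArr, hx]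
    · (rw [Function.update_of_ne (by omega), h.arr_re k' hk' i'])
      simp only [CpxState.setArr, Function.update_apply]
      split_ifs with h1
      · subst h1
        rw [Function.update_of_ne (by tauto)]
      · rfl
  · intro k' hk' i'
    by_cases hq : k' = k ∧ i' = i
    · obtain ⟨rfl, rfl⟩ := hq; simp [CpxState.setArr, hy]
    · (dsimp only; rw [Function.update_of_ne (by omega), Function.update_of_ne (by omega), h.arr_im k' hk' i'])
      simp only [CpxState.setArr, Function.update_apply]
      split_ifs with h1
      · subst h1
        rw [Function.update_of_ne (by tauto)]
      · rfl

end Represents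

theorem natFloor_ratCast (x : ℚ) : ⌊(x : ℝ)⌋₊ = ⌊x⌋₊ := by
  rw [← Int.floor_toNat, Rat.floor_cast, Int.floor_toNat]

/-- A real number whose product with `D` is rounded to an integer. -/
theorem ratSize_round {D W : ℕ} (hD : 0 < D) (hW : 3 * Nat.clog 2 (D + 1) + 3 ≤ W) {x : ℚ}
    (hx : |(x : ℝ)| + 1 ≤ D) : ratSize ((⌊x * D⌋ : ℚ) / D) ≤ W := by
  have h1 : |x| + 1 ≤ D := by exact_mod_cast hx
  have hD' : (1 : ℚ) ≤ D := by exact_mod_cast hD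
  have h2 : ((⌊x * D⌋.natAbs : ℤ) : ℚ) ≤ ((D ^ 2 : ℕ) : ℤ) := by
    rw [Int.natCast_natAbs]
    push_cast
    -- The margin 1 in the hypothesis absorbs the rounding: |⌊xD⌋| ≤ (D-1)D + 1 ≤ D².
    have h3 : |x * D| ≤ (D - 1) * D := by
      rw [abs_mul, abs_of_pos (show (0 : ℚ) < D by positivity)]
      gcongr; linarith
    have h4 := Int.floor_le (x * D)
    have h5 := Int.lt_floor_add_one (x * D)
    obtain ⟨h6, h7⟩ := abs_le.1 h3
    rw [abs_le]
    constructor <;> nlinarith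
  have h3 : ⌊x * D⌋.natAbs ≤ D ^ 2 := by exact_mod_cast h2
  have := ratSize_grid hD (x := (⌊x * D⌋ : ℚ) / D) rfl h3
  omega

namespace CpxProgram

theorem simulate_setReg {w W κ : ℕ} {σ : RamState} (hσ : σ.Small W) (r : ℕ) {e : RamExpr}
    (he : e.Safe σ) (hw : e.growth * W ≤ w) {v : ℚ} (hv : e.eval σ = v) (hκ : e.cost + 1 ≤ κ) :
    ∃ u ≤ κ, RamProgram.Exec w (.setReg r e) σ u ⟨Function.update σ.reg r v, σ.mem⟩ := by
  have := RamProgram.Exec.setReg σ r e (e.fits_of_safe hσ he hw).1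
  rw [hv] at this
  exact ⟨_, hκ, this⟩

theorem simulate_store {w W κ : ℕ} {σ : RamState} (hσ : σ.Small W) {a e : RamExpr} {k : ℕ}
    (ha : a.Safe σ) (hk : a.eval σ = k) (he : e.Safe σ) (hw : (a.growth + e.growth) * W ≤ w)
    {v : ℚ} (hv : e.eval σ = v) (hκ : a.cost + e.cost + 1 ≤ κ) :
    ∃ u ≤ κ, RamProgram.Exec w (.store a e) σ u ⟨σ.reg, Function.update σ.mem k v⟩ := by
  rw [add_mul] at hw
  have := RamProgram.Exec.store σ a e k (a.fits_of_safe (w := w) hσ ha (by omega)).1 hk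
    (e.fits_of_safe (w := w) hσ he (by omega)).1
  rw [hv] at this
  exact ⟨_, hκ, this⟩

theorem simulate_seq {w κ₁ κ₂ κ : ℕ} {σ τ ρ : RamState} {p q : RamProgram}
    (hp : ∃ u ≤ κ₁, RamProgram.Exec w p σ u τ) (hq : ∃ u ≤ κ₂, RamProgram.Exec w q τ u ρ) (h : κ₁ + κ₂ ≤ κ) :
    ∃ u ≤ κ, RamProgram.Exec w (.seq p q) σ u ρ := by
  obtain ⟨u, hu, hp⟩ := hp
  obtain ⟨v, hv, hq⟩ := hq
  exact ⟨u + v, by omega, .seq hp hq⟩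

variable {B D W w κ : ℕ}

/-- The effect of a register that holds `D`. -/
theorem roundRam_spec {σ : RamState} {A : CpxState} (h : Represents B σ A) (hD : 0 < D)
    (hAD : A.nat 1 = D) {e : RamExpr} (he : e.Safe σ) :
    (roundRam e).Safe σ ∧ (roundRam e).eval σ = (⌊e.eval σ * D⌋ : ℚ) / D := by
  have h1 : σ.reg 4 = D := by rw [← hAD]; exact h.nat 1
  have : (D : ℚ) ≠ 0 := by exact_mod_cast hD.ne'
  simp [roundRam, RamExpr.Safe, RamExpr.eval, he, h1, this]

/-- The expression may read the register that is assigned. Therefore both rounded parts go to the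
scratch registers 3 and 7 before either target register changes; the scratch writes leave the
represented state, and with it the value of the imaginary part, as it was. -/
theorem simulate_setCpx {σ : RamState} {A : CpxState} (h : Represents B σ A) (hσ : σ.Small W)
    (hD : 0 < D) (hW : 3 * Nat.clog 2 (D + 1) + 3 ≤ W) (r : ℕ) (x : CpxExpr) (hAD : A.nat 1 = D)
    (hx : x.Ok B A) (hb : ‖x.eval A‖ + 1 ≤ D) (hg : (toRam (.setCpx r x)).growth * W ≤ w)
    (hκ : (toRam (.setCpx r x)).unitCost ≤ κ) : ∃ u σ', u ≤ κ ∧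
      (toRam (.setCpx r x)).Exec w σ u σ' ∧
      Represents B σ' (A.setCpx r (gridRound D (x.eval A))) ∧ σ'.Small W := by
  obtain ⟨⟨s1, s2⟩, e1, e2⟩ := x.toRam_spec h hx
  simp only [toRam, RamProgram.growth, RamProgram.unitCost] at hg hκ
  simp only [add_mul] at hg
  have b1 : |((x.toRam.1.eval σ : ℚ) : ℝ)| + 1 ≤ D := by
    rw [e1]; linarith [Complex.abs_re_le_norm (x.eval A)]
  have b2 : |((x.toRam.2.eval σ : ℚ) : ℝ)| + 1 ≤ D := by
    rw [e2]; linarith [Complex.abs_im_le_norm (x.eval A)]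
  have z1 := ratSize_round hD hW b1
  have z2 := ratSize_round hD hW b2
  set v1 : ℚ := (⌊x.toRam.1.eval σ * D⌋ : ℚ) / D with hv1
  set v2 : ℚ := (⌊x.toRam.2.eval σ * D⌋ : ℚ) / D with hv2
  obtain ⟨t1, f1⟩ := roundRam_spec h hD hAD s1
  have k1 := simulate_setReg (w := w) (κ := (roundRam x.toRam.1).cost + 1) hσ 3 t1 (by omega) f1 le_rfl
  have h1 := h.setTemp 0 v1
  have hσ1 := hσ.setReg 3 z1
  obtain ⟨⟨_, s2'⟩, _, e2'⟩ := x.toRam_spec h1 hx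
  have e3 : x.toRam.2.eval ⟨Function.update σ.reg (4 * 0 + 3) v1, σ.mem⟩ = x.toRam.2.eval σ := by
    have := e2'.trans e2.symm
    exact_mod_cast this
  obtain ⟨t2, f2⟩ := roundRam_spec h1 hD hAD s2'
  rw [e3] at f2
  have k2 := simulate_setReg (w := w) (κ := (roundRam x.toRam.2).cost + 1) hσ1 7 t2 (by omega) f2 le_rfl
  have h2 := h1.setTemp 1 v2
  have hσ2 := hσ1.setReg 7 z2
  have k3 := simulate_setReg (κ := 2) (w := w) (e := .reg 3) (v := v1) hσ2 (4 * r + 1) trivial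
    (by simp only [RamExpr.growth] at hg ⊢; omega) (by simp [RamExpr.eval]) le_rfl
  have hσ3 := hσ2.setReg (4 * r + 1) z1
  have k4 := simulate_setReg (κ := 2) (w := w) (e := .reg 7) (v := v2) hσ3 (4 * r + 2) trivial
    (by simp only [RamExpr.growth] at hg ⊢; omega)
    (by simp only [RamExpr.eval]; (rw [Function.update_of_ne (by omega)]); simp) le_rfl
  have h4 := h2.setCpx r (x := v1) (y := v2) (z := gridRound D (x.eval A))
    (by simp only [gridRound, ← e1, hv1]; push_cast; rw [← Rat.floor_cast (α := ℝ)]; push_cast; rfl)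
    (by simp only [gridRound, ← e2, hv2]; push_cast; rw [← Rat.floor_cast (α := ℝ)]; push_cast; rfl)
  obtain ⟨u, hu, k⟩ := simulate_seq (simulate_seq k1 k2 le_rfl) (simulate_seq k3 k4 le_rfl) le_rfl
  refine ⟨u, _, ?_, k, h4, hσ3.setReg _ z2⟩
  simp only [RamExpr.cost] at hκ
  omega

/-- The real part is written before the imaginary part is read, so the address is evaluated in two
different configurations; `ha'` says that it is the same in both. This holds for translated natural
expressions because they use only registers divisible by 4. -/
theorem simulate_read {σ : RamState} {A : CpxState} (h : Represents B σ A) (hσ : σ.Small W)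
    (r k : ℕ) {a : RamExpr} (ha : a.Safe σ) (hk : a.eval σ = k)
    (ha' : ∀ x, RamExpr.Safe ⟨Function.update σ.reg (4 * r + 1) x, σ.mem⟩ a ∧
      a.eval ⟨Function.update σ.reg (4 * r + 1) x, σ.mem⟩ = k)
    {z : ℂ} (hre : (σ.mem k : ℝ) = z.re) (him : (σ.mem (k + 1) : ℝ) = z.im)
    (hg : (RamProgram.seq (.setReg (4 * r + 1) (.load a))
      (.setReg (4 * r + 2) (.load (.add a (.lit 1))))).growth * W ≤ w)
    (hκ : (RamProgram.seq (.setReg (4 * r + 1) (.load a))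
      (.setReg (4 * r + 2) (.load (.add a (.lit 1))))).unitCost ≤ κ) : ∃ u σ', u ≤ κ ∧
      (RamProgram.seq (.setReg (4 * r + 1) (.load a))
        (.setReg (4 * r + 2) (.load (.add a (.lit 1))))).Exec w σ u σ' ∧
      Represents B σ' (A.setCpx r z) ∧ σ'.Small W := by
  simp only [RamProgram.growth, RamProgram.unitCost] at hg hκ
  rw [add_mul] at hg
  have k1 := simulate_setReg (w := w) (e := .load a) (v := σ.mem k) hσ (4 * r + 1)
    ⟨ha, k, hk⟩ (by omega) (by simp [RamExpr.eval, hk]) le_rfl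
  have hσ1 := hσ.setReg (4 * r + 1) (hσ.2 k)
  obtain ⟨s1, s2⟩ := ha' (σ.mem k)
  have e1 : RamExpr.eval ⟨Function.update σ.reg (4 * r + 1) (σ.mem k), σ.mem⟩
      (.add a (.lit 1)) = ((k + 1 : ℕ) : ℚ) := by simp [RamExpr.eval, s2]
  have k2 := simulate_setReg (w := w) (e := .load (.add a (.lit 1))) (v := σ.mem (k + 1)) hσ1
    (4 * r + 2) ⟨⟨s1, trivial⟩, k + 1, e1⟩ (by omega)
    (by simp only [RamExpr.eval] at e1 ⊢; rw [e1, Rat.num_natCast, Int.toNat_natCast]) le_rfl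
  obtain ⟨u, hu, k⟩ := simulate_seq k1 k2 hκ
  exact ⟨u, _, hu, k, h.setCpx r hre him, hσ1.setReg _ (hσ.2 _)⟩

theorem simulate_write {σ : RamState} (hσ : σ.Small W)
    (r k : ℕ) {a : RamExpr} (ha : a.Safe σ) (hk : a.eval σ = k)
    (ha' : ∀ x, RamExpr.Safe ⟨σ.reg, Function.update σ.mem k x⟩ a ∧
      a.eval ⟨σ.reg, Function.update σ.mem k x⟩ = k)
    (hg : (RamProgram.seq (.store a (.reg (4 * r + 1)))
      (.store (.add a (.lit 1)) (.reg (4 * r + 2)))).growth * W ≤ w)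
    (hκ : (RamProgram.seq (.store a (.reg (4 * r + 1)))
      (.store (.add a (.lit 1)) (.reg (4 * r + 2)))).unitCost ≤ κ) : ∃ u ≤ κ,
      (RamProgram.seq (.store a (.reg (4 * r + 1)))
        (.store (.add a (.lit 1)) (.reg (4 * r + 2)))).Exec w σ u
        ⟨σ.reg, Function.update (Function.update σ.mem k (σ.reg (4 * r + 1))) (k + 1)
          (σ.reg (4 * r + 2))⟩ ∧
      RamState.Small W ⟨σ.reg, Function.update (Function.update σ.mem k (σ.reg (4 * r + 1)))
        (k + 1) (σ.reg (4 * r + 2))⟩ := by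
  simp only [RamProgram.growth, RamProgram.unitCost] at hg hκ
  rw [add_mul] at hg
  have k1 := simulate_store (w := w) (e := .reg (4 * r + 1)) (v := σ.reg (4 * r + 1)) hσ
    ha hk trivial (by omega) rfl le_rfl
  have hσ1 := hσ.setMem k (hσ.1 (4 * r + 1))
  obtain ⟨s1, s2⟩ := ha' (σ.reg (4 * r + 1))
  have k2 := simulate_store (w := w) (a := .add a (.lit 1)) (k := k + 1) (e := .reg (4 * r + 2))
    (v := σ.reg (4 * r + 2)) hσ1 ⟨s1, trivial⟩ (by simp [RamExpr.eval, s2]) trivial (by omega)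
    rfl le_rfl
  obtain ⟨u, hu, k⟩ := simulate_seq k1 k2 hκ
  exact ⟨u, hu, k, hσ1.setMem _ (hσ.1 _)⟩

/-- Every run of the abstract machine is simulated on the Word-RAM, with constant slowdown and
with words longer than the contents of the cells by a constant factor. -/
theorem Exec.simulate (hD : 0 < D) (hW : 3 * Nat.clog 2 (D + 1) + 3 ≤ W) {p : CpxProgram}
    {A A' : CpxState} {t : ℕ} (h : p.Exec B D A t A') :
    ∀ σ, Represents B σ A → σ.Small W → p.toRam.growth * W ≤ w → p.toRam.unitCost ≤ κ →
      ∃ u σ', u ≤ κ * t ∧ p.toRam.Exec w σ u σ' ∧ Represents B σ' A' ∧ σ'.Small W := by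
  have nat_case : ∀ (A : CpxState) (σ : RamState) (r v : ℕ) (e : RamExpr), Represents B σ A →
      σ.Small W → e.Safe σ → e.eval σ = v → ratSize (v : ℚ) ≤ W → e.growth * W ≤ w →
      e.cost + 1 ≤ κ → ∃ u σ', u ≤ κ * 1 ∧ RamProgram.Exec w (.setReg (4 * r) e) σ u σ' ∧
        Represents B σ' (A.setNat r v) ∧ σ'.Small W := by
    intro A σ r v e hr hs he hv hvs hg hκ
    obtain ⟨u, hu, k⟩ := simulate_setReg hs (4 * r) he hg hv hκ
    exact ⟨u, _, by omega, k, hr.setNat r v rfl, hs.setReg _ hvs⟩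
  have test : ∀ (A : CpxState) (σ : RamState) (a b : NatExpr) (g : ℕ), Represents B σ A →
      σ.Small W → a.Ok A.nat → b.Ok A.nat →
      (a.toRam.growth + b.toRam.growth + g) * W ≤ w →
      a.toRam.Fits w σ ∧ b.toRam.Fits w σ ∧
        (a.toRam.eval σ < b.toRam.eval σ ↔ a.eval A.nat < b.eval A.nat) := by
    intro A σ a b g hr hs ha hb hg
    obtain ⟨a1, a2⟩ := a.toRam_spec hr.nat ha
    obtain ⟨b1, b2⟩ := b.toRam_spec hr.nat hb
    simp only [add_mul] at hg
    refine ⟨(a.toRam.fits_of_safe hs a1 (by omega)).1, (b.toRam.fits_of_safe hs b1 (by omega)).1, ?_⟩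
    rw [a2, b2, Nat.cast_lt]
  induction h with
  | skip A =>
    intro σ hr hs hg hκ
    exact ⟨1, σ, by simpa [toRam, RamProgram.unitCost] using hκ, .skip σ, hr, hs⟩
  | setNat A r e h hv =>
    intro σ hr hs hg hκ
    obtain ⟨a1, a2⟩ := e.toRam_spec hr.nat h
    exact nat_case A σ r _ e.toRam hr hs a1 a2 ((ratSize_natCast hv).trans hW) hg hκ
  | readNat A r a v h ha hv =>
    intro σ hr hs hg hκ
    obtain ⟨a1, a2⟩ := a.toRam_spec hr.nat h
    have h1 : σ.mem (a.eval A.nat) = v := by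
      have := (hr.low _ ha).trans hv
      exact_mod_cast this
    refine nat_case A σ r v (.load a.toRam) hr hs ⟨a1, _, a2⟩ (by simp [RamExpr.eval, a2, h1]) ?_ hg hκ
    rw [← h1]; exact hs.2 _
  | recip A r a h ha h0 hv =>
    intro σ hr hs hg hκ
    obtain ⟨a1, a2⟩ := a.toRam_spec hr.nat h
    have h1 := hr.low _ ha
    have h2 : σ.mem (a.eval A.nat) ≠ 0 := by
      intro h3; rw [h3] at h1; simp at h1; linarith
    -- The Word-RAM takes integer parts in ℤ, the abstract machine in ℕ; they agree because the
    -- quotient is positive.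
    have h4 : ((⌊1 / σ.mem (a.eval A.nat)⌋ : ℤ) : ℚ) = ((⌊1 / A.low (a.eval A.nat)⌋₊ : ℕ) : ℚ) := by
      rw [← h1]
      have h5 : (1 / (σ.mem (a.eval A.nat) : ℝ)) = ((1 / σ.mem (a.eval A.nat) : ℚ) : ℝ) := by
        push_cast; rfl
      have h6 : 0 ≤ 1 / σ.mem (a.eval A.nat) := by
        have : 0 < σ.mem (a.eval A.nat) := by rw [← h1] at h0; exact_mod_cast h0
        positivity
      rw [h5, natFloor_ratCast]
      rw [← Int.natCast_floor_eq_floor h6]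
      simp
    exact nat_case A σ r _ (.floor (.div (.lit 1) (.load a.toRam))) hr hs
      ⟨trivial, ⟨a1, _, a2⟩, by simpa [RamExpr.eval, a2] using h2⟩
      (by rw [← h4]; simp [RamExpr.eval, a2]) ((ratSize_natCast hv).trans hW) hg hκ
  | readCpx A r a h ha =>
    intro σ hr hs hg hκ
    obtain ⟨a1, a2⟩ := a.toRam_spec hr.nat h
    obtain ⟨u, σ', h1, h2, h3, h4⟩ := simulate_read hr hs r (a.eval A.nat) a1 a2
      (fun x => a.toRam_spec (f := A.nat) (fun q => by
        (dsimp only; rw [Function.update_of_ne (by omega)]); exact hr.nat q) h)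
      (z := ⟨A.low (a.eval A.nat), A.low (a.eval A.nat + 1)⟩)
      (hr.low _ (by omega)) (hr.low _ ha) hg hκ
    exact ⟨u, σ', by omega, h2, h3, h4⟩
  | writeCpx A a r h ha =>
    intro σ hr hs hg hκ
    obtain ⟨a1, a2⟩ := a.toRam_spec hr.nat h
    obtain ⟨u, h1, h2, h3⟩ := simulate_write hs r (a.eval A.nat) a1 a2
      (fun x => a.toRam_spec (σ := ⟨σ.reg, Function.update σ.mem (a.eval A.nat) x⟩) (f := A.nat) hr.nat h) hg hκ
    exact ⟨u, _, by omega, h2, hr.setLow ha (hr.re r) (hr.im r), h3⟩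
  | normSq A r c hv =>
    intro σ hr hs hg hκ
    have h1 := hr.re c
    have h2 := hr.im c
    refine nat_case A σ r _ _ hr hs (by simp [RamExpr.Safe]) ?_ ((ratSize_natCast hv).trans hW) hg hκ
    simp only [RamExpr.eval]
    rw [Complex.normSq_apply, ← h1, ← h2]
    have h5 : ((σ.reg (4 * c + 1) : ℝ) * (σ.reg (4 * c + 1) : ℝ) +
      (σ.reg (4 * c + 2) : ℝ) * (σ.reg (4 * c + 2) : ℝ)) =
      ((σ.reg (4 * c + 1) * σ.reg (4 * c + 1) + σ.reg (4 * c + 2) * σ.reg (4 * c + 2) : ℚ) : ℝ) := by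
      push_cast; rfl
    have h6 : 0 ≤ σ.reg (4 * c + 1) * σ.reg (4 * c + 1) + σ.reg (4 * c + 2) * σ.reg (4 * c + 2) := by
      nlinarith [mul_self_nonneg (σ.reg (4 * c + 1)), mul_self_nonneg (σ.reg (4 * c + 2))]
    rw [h5, natFloor_ratCast]
    rw [← Int.natCast_floor_eq_floor h6]
    simp
  | setCpx A r x hAD h hx =>
    intro σ hr hs hg hκ
    obtain ⟨u, σ', h1, h2⟩ := simulate_setCpx hr hs hD hW r x hAD h hx hg hκ
    exact ⟨u, σ', by omega, h2⟩
  | load A r k i hk h hB =>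
    intro σ hr hs hg hκ
    obtain ⟨a1, a2⟩ := arrayAddr_spec (k := k) hr h hB
    obtain ⟨u, σ', h1, h2, h3, h4⟩ := simulate_read hr hs r _ a1 a2
      (fun x => by
        rw [← a2]
        have h1 := NatExpr.toRam_spec (σ := ⟨Function.update σ.reg (4 * r + 1) x, σ.mem⟩)
          (f := A.nat) (fun q => by
          (dsimp only; rw [Function.update_of_ne (by omega)]); exact hr.nat q) (arrayAddr k i)
          (by simp [arrayAddr, NatExpr.Ok, h])
        have h2 := NatExpr.toRam_spec hr.nat (arrayAddr k i) (by simp [arrayAddr, NatExpr.Ok, h])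
        exact ⟨h1.1, h1.2.trans h2.2.symm⟩)
      (hr.arr_re k hk _) (hr.arr_im k hk _) hg hκ
    exact ⟨u, σ', by omega, h2, h3, h4⟩
  | store A k i r hk h hB =>
    intro σ hr hs hg hκ
    obtain ⟨a1, a2⟩ := arrayAddr_spec (k := k) hr h hB
    obtain ⟨u, h1, h2, h3⟩ := simulate_write hs r _ a1 a2
      (fun x => by
        rw [← a2]
        have h1 := NatExpr.toRam_spec
          (σ := ⟨σ.reg, Function.update σ.mem (B + (16 * i.eval A.nat + 2 * k)) x⟩)
          (f := A.nat) hr.nat (arrayAddr k i) (by simp [arrayAddr, NatExpr.Ok, h])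
        have h2 := NatExpr.toRam_spec hr.nat (arrayAddr k i) (by simp [arrayAddr, NatExpr.Ok, h])
        exact ⟨h1.1, h1.2.trans h2.2.symm⟩) hg hκ
    exact ⟨u, _, by omega, h2, hr.setArr hk _ (hr.re r) (hr.im r), h3⟩
  | seq hp hq ihp ihq =>
    intro σ hr hs hg hκ
    simp only [toRam, RamProgram.growth, RamProgram.unitCost, add_mul] at hg hκ
    obtain ⟨u, σ', h1, h2, h3, h4⟩ := ihp σ hr hs (by omega) (by omega)
    obtain ⟨u', σ'', h5, h6, h7, h8⟩ := ihq σ' h3 h4 (by omega) (by omega)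
    exact ⟨u + u', σ'', by rw [mul_add]; omega, .seq h2 h6, h7, h8⟩
  | branch_true ha hb hab hp ih =>
    intro σ hr hs hg hκ
    obtain ⟨f1, f2, f3⟩ := test _ σ _ _ _ hr hs ha hb hg
    simp only [toRam, RamProgram.growth, RamProgram.unitCost, add_mul] at hg hκ
    obtain ⟨u, σ', h1, h2, h3, h4⟩ := ih σ hr hs (by omega) (by omega)
    exact ⟨_, σ', by rw [mul_add]; omega, .branch_true f1 f2 (f3.2 hab) h2, h3, h4⟩
  | branch_false ha hb hab hp ih =>
    intro σ hr hs hg hκ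
    obtain ⟨f1, f2, f3⟩ := test _ σ _ _ _ hr hs ha hb hg
    simp only [toRam, RamProgram.growth, RamProgram.unitCost, add_mul] at hg hκ
    obtain ⟨u, σ', h1, h2, h3, h4⟩ := ih σ hr hs (by omega) (by omega)
    exact ⟨_, σ', by rw [mul_add]; omega, .branch_false f1 f2 (f3.not.2 hab) h2, h3, h4⟩
  | loop_true ha hb hab hp hl ih ihl =>
    intro σ hr hs hg hκ
    obtain ⟨f1, f2, f3⟩ := test _ σ _ _ _ hr hs ha hb hg
    have hg' := hg
    have hκ' := hκ
    simp only [toRam, RamProgram.growth, RamProgram.unitCost, add_mul] at hg hκ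
    obtain ⟨u, σ', h1, h2, h3, h4⟩ := ih σ hr hs (by omega) (by omega)
    obtain ⟨u', σ'', h5, h6, h7, h8⟩ := ihl σ' h3 h4 hg' hκ'
    exact ⟨_, σ'', by rw [mul_add, mul_add]; omega, .loop_true f1 f2 (f3.2 hab) h2 h6, h7, h8⟩
  | loop_false ha hb hab =>
    intro σ hr hs hg hκ
    obtain ⟨f1, f2, f3⟩ := test _ σ _ _ _ hr hs ha hb hg
    simp only [toRam, RamProgram.growth, RamProgram.unitCost, add_mul] at hg hκ
    exact ⟨_, σ, by omega, .loop_false f1 f2 (f3.not.2 hab), hr, hs⟩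

end CpxProgram

/-! ### Reasoning about programs -/

namespace CpxState

variable (A : CpxState) (r v q k i : ℕ) (z : ℂ)

@[simp] theorem setNat_nat : (A.setNat r v).nat q = if q = r then v else A.nat q := by
  simp [setNat, Function.update_apply]
@[simp] theorem setNat_cpx : (A.setNat r v).cpx = A.cpx := rfl
@[simp] theorem setNat_arr : (A.setNat r v).arr = A.arr := rfl
@[simp] theorem setNat_low : (A.setNat r v).low = A.low := rfl
@[simp] theorem setCpx_nat : (A.setCpx r z).nat = A.nat := rfl
@[simp] theorem setCpx_cpx : (A.setCpx r z).cpx q = if q = r then z else A.cpx q := by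
  simp [setCpx, Function.update_apply]
@[simp] theorem setCpx_arr : (A.setCpx r z).arr = A.arr := rfl
@[simp] theorem setCpx_low : (A.setCpx r z).low = A.low := rfl
@[simp] theorem setArr_nat : (A.setArr k i z).nat = A.nat := rfl
@[simp] theorem setArr_cpx : (A.setArr k i z).cpx = A.cpx := rfl
@[simp] theorem setArr_low : (A.setArr k i z).low = A.low := rfl

theorem setArr_arr_same (i' : ℕ) : (A.setArr k i z).arr k i' = if i' = i then z else A.arr k i' := by
  simp [setArr, Function.update_apply]

theorem setArr_arr_of_ne {k' : ℕ} (h : k' ≠ k) : (A.setArr k i z).arr k' = A.arr k' := by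
  simp [setArr, h]

end CpxState

namespace CpxProgram

/-- The program does not assign to the natural register `r`. -/
def keepsNat (r : ℕ) : CpxProgram → Bool
  | setNat q _ | readNat q _ | recip q _ | normSq q _ => !(q == r)
  | seq p q | branch _ _ p q => p.keepsNat r && q.keepsNat r
  | loop _ _ p => p.keepsNat r
  | _ => true

/-- The program does not assign to the complex register `r`. -/
def keepsCpx (r : ℕ) : CpxProgram → Bool
  | setCpx q _ | readCpx q _ | load q _ _ => !(q == r)
  | seq p q | branch _ _ p q => p.keepsCpx r && q.keepsCpx r
  | loop _ _ p => p.keepsCpx r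
  | _ => true

/-- The program does not write to the array `k`. -/
def keepsArr (k : ℕ) : CpxProgram → Bool
  | store q _ _ => !(q == k)
  | seq p q | branch _ _ p q => p.keepsArr k && q.keepsArr k
  | loop _ _ p => p.keepsArr k
  | _ => true

/-- The program does not write to the low memory cells. -/
def keepsLow : CpxProgram → Bool
  | writeCpx _ _ => false
  | seq p q | branch _ _ p q => p.keepsLow && q.keepsLow
  | loop _ _ p => p.keepsLow
  | _ => true

/-- The two states differ only in what the program assigns to. -/
structure Frame (p : CpxProgram) (A A' : CpxState) : Prop where
  nat : ∀ r, p.keepsNat r = true → A'.nat r = A.nat r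
  cpx : ∀ r, p.keepsCpx r = true → A'.cpx r = A.cpx r
  arr : ∀ k, p.keepsArr k = true → A'.arr k = A.arr k
  low : p.keepsLow = true → A'.low = A.low

theorem Frame.refl (p : CpxProgram) (A : CpxState) : p.Frame A A :=
  ⟨fun _ _ => rfl, fun _ _ => rfl, fun _ _ => rfl, fun _ => rfl⟩

theorem Frame.trans {p : CpxProgram} {A A' A'' : CpxState} (h : p.Frame A A')
    (h' : p.Frame A' A'') : p.Frame A A'' :=
  ⟨fun r hr => (h'.nat r hr).trans (h.nat r hr), fun r hr => (h'.cpx r hr).trans (h.cpx r hr),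
    fun r hr => (h'.arr r hr).trans (h.arr r hr), fun hr => (h'.low hr).trans (h.low hr)⟩

theorem Frame.weaken {p q : CpxProgram} {A A' : CpxState} (h : p.Frame A A')
    (h1 : ∀ r, q.keepsNat r = true → p.keepsNat r = true)
    (h2 : ∀ r, q.keepsCpx r = true → p.keepsCpx r = true)
    (h3 : ∀ r, q.keepsArr r = true → p.keepsArr r = true)
    (h4 : q.keepsLow = true → p.keepsLow = true) : q.Frame A A' :=
  ⟨fun r hr => h.nat r (h1 r hr), fun r hr => h.cpx r (h2 r hr),
    fun r hr => h.arr r (h3 r hr), fun hr => h.low (h4 hr)⟩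

theorem Frame.seq_left {p q : CpxProgram} {A A' : CpxState} (h : p.Frame A A') :
    (seq p q).Frame A A' :=
  h.weaken (by simp +contextual [keepsNat]) (by simp +contextual [keepsCpx])
    (by simp +contextual [keepsArr]) (by simp +contextual [keepsLow])

theorem Frame.seq_right {p q : CpxProgram} {A A' : CpxState} (h : q.Frame A A') :
    (seq p q).Frame A A' :=
  h.weaken (by simp +contextual [keepsNat]) (by simp +contextual [keepsCpx])
    (by simp +contextual [keepsArr]) (by simp +contextual [keepsLow])

theorem Frame.branch_left {a b : NatExpr} {p q : CpxProgram} {A A' : CpxState}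
    (h : p.Frame A A') : (branch a b p q).Frame A A' :=
  h.weaken (by simp +contextual [keepsNat]) (by simp +contextual [keepsCpx])
    (by simp +contextual [keepsArr]) (by simp +contextual [keepsLow])

theorem Frame.branch_right {a b : NatExpr} {p q : CpxProgram} {A A' : CpxState}
    (h : q.Frame A A') : (branch a b p q).Frame A A' :=
  h.weaken (by simp +contextual [keepsNat]) (by simp +contextual [keepsCpx])
    (by simp +contextual [keepsArr]) (by simp +contextual [keepsLow])

theorem Frame.loop {a b : NatExpr} {p : CpxProgram} {A A' : CpxState}
    (h : p.Frame A A') : (loop a b p).Frame A A' :=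
  h.weaken (by simp [keepsNat]) (by simp [keepsCpx]) (by simp [keepsArr]) (by simp [keepsLow])

theorem frame_setNat {p : CpxProgram} {A : CpxState} {r v : ℕ}
    (h : ∀ q, p.keepsNat q = true → q ≠ r) : p.Frame A (A.setNat r v) :=
  ⟨fun q hq => by simp [h q hq], fun _ _ => rfl, fun _ _ => rfl, fun _ => rfl⟩

theorem frame_setCpx {p : CpxProgram} {A : CpxState} {r : ℕ} {z : ℂ}
    (h : ∀ q, p.keepsCpx q = true → q ≠ r) : p.Frame A (A.setCpx r z) :=
  ⟨fun _ _ => rfl, fun q hq => by simp [h q hq], fun _ _ => rfl, fun _ => rfl⟩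

variable {B D : ℕ}

/-- What a program can change is read off its text by Boolean functions, so that later proofs obtain
the preservation of most registers and arrays by `rfl`. -/
theorem Exec.frame {p : CpxProgram} {A A' : CpxState} {t : ℕ} (h : p.Exec B D A t A') :
    p.Frame A A' := by
  induction h with
  | skip A => exact .refl _ _
  | setNat A r e h hv => exact frame_setNat fun q hq => by simp [keepsNat] at hq; tauto
  | readNat A r e h hv => exact frame_setNat fun q hq => by simp [keepsNat] at hq; tauto
  | recip A r e h hv => exact frame_setNat fun q hq => by simp [keepsNat] at hq; tauto
  | normSq A r e h => exact frame_setNat fun q hq => by simp [keepsNat] at hq; tauto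
  | readCpx A r e h hv => exact frame_setCpx fun q hq => by simp [keepsCpx] at hq; tauto
  | setCpx A r e h hv => exact frame_setCpx fun q hq => by simp [keepsCpx] at hq; tauto
  | load A r e h hv => exact frame_setCpx fun q hq => by simp [keepsCpx] at hq; tauto
  | writeCpx A a r h ha =>
    exact ⟨fun _ _ => rfl, fun _ _ => rfl, fun _ _ => rfl, fun h => by simp [keepsLow] at h⟩
  | store A k i r hk h hB =>
    exact ⟨fun _ _ => rfl, fun _ _ => rfl, fun q hq => A.setArr_arr_of_ne _ _ _
      (by simp [keepsArr] at hq; tauto), fun _ => rfl⟩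
  | seq hp hq ihp ihq => exact ihp.seq_left.trans ihq.seq_right
  | branch_true ha hb hab hp ih => exact ih.branch_left
  | branch_false ha hb hab hp ih => exact ih.branch_right
  | loop_true ha hb hab hp hl ih ihl => exact ih.loop.trans ihl
  | loop_false ha hb hab => exact .refl _ _

/-- Started in `A`, the program halts after at most `T` steps in a state that satisfies `Q`. -/
def Runs (B D : ℕ) (p : CpxProgram) (A : CpxState) (T : ℕ) (Q : CpxState → Prop) : Prop :=
  ∃ t A', p.Exec B D A t A' ∧ t ≤ T ∧ Q A'

namespace Runs

variable {p q : CpxProgram} {A : CpxState} {T T₁ T₂ : ℕ} {Q R : CpxState → Prop}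

theorem mono (h : Runs B D p A T₁ R) (hT : T₁ ≤ T) (hQ : ∀ A', p.Frame A A' → R A' → Q A') :
    Runs B D p A T Q := by
  obtain ⟨t, A', h1, h2, h3⟩ := h
  exact ⟨t, A', h1, h2.trans hT, hQ A' h1.frame h3⟩

theorem seq (hp : Runs B D p A T₁ R) (hT : T₁ + T₂ ≤ T)
    (hq : ∀ A', p.Frame A A' → R A' → Runs B D q A' T₂ Q) :
    Runs B D (.seq p q) A T Q := by
  obtain ⟨t, A', h1, h2, h3⟩ := hp
  obtain ⟨u, A'', h4, h5, h6⟩ := hq A' h1.frame h3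
  exact ⟨t + u, A'', .seq h1 h4, by omega, h6⟩

theorem setNat {r : ℕ} {e : NatExpr} (v : ℕ) (hv : e.eval A.nat = v) (he : e.Ok A.nat)
    (hD : v ≤ D ^ 2) (h : Q (A.setNat r v)) : Runs B D (.setNat r e) A 1 Q := by
  subst hv
  exact ⟨1, _, .setNat A r e he hD, le_rfl, h⟩

theorem readNat {r : ℕ} {a : NatExpr} (c v : ℕ) (hc : a.eval A.nat = c) (ha : a.Ok A.nat)
    (hB : c < B) (hv : A.low c = v) (h : Q (A.setNat r v)) :
    Runs B D (.readNat r a) A 1 Q := by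
  subst hc
  exact ⟨1, _, .readNat A r a v ha hB hv, le_rfl, h⟩

theorem recip {r : ℕ} {a : NatExpr} (c : ℕ) (hc : a.eval A.nat = c) (ha : a.Ok A.nat)
    (hB : c < B) (h0 : 0 < A.low c) (hv : ⌊1 / A.low c⌋₊ ≤ D ^ 2)
    (h : Q (A.setNat r ⌊1 / A.low c⌋₊)) : Runs B D (.recip r a) A 1 Q := by
  subst hc
  exact ⟨1, _, .recip A r a ha hB h0 hv, le_rfl, h⟩

theorem readCpx {r : ℕ} {a : NatExpr} (c : ℕ) (hc : a.eval A.nat = c) (ha : a.Ok A.nat)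
    (hB : c + 1 < B) (h : Q (A.setCpx r ⟨A.low c, A.low (c + 1)⟩)) :
    Runs B D (.readCpx r a) A 1 Q := by
  subst hc
  exact ⟨1, _, .readCpx A r a ha hB, le_rfl, h⟩

theorem writeCpx {r : ℕ} {a : NatExpr} (c : ℕ) (hc : a.eval A.nat = c) (ha : a.Ok A.nat)
    (hB : c + 1 < B) (h : Q (A.setLow c (A.cpx r))) :
    Runs B D (.writeCpx a r) A 1 Q := by
  subst hc
  exact ⟨1, _, .writeCpx A a r ha hB, le_rfl, h⟩

theorem normSq {r c : ℕ} (hv : ⌊Complex.normSq (A.cpx c)⌋₊ ≤ D ^ 2)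
    (h : Q (A.setNat r ⌊Complex.normSq (A.cpx c)⌋₊)) : Runs B D (.normSq r c) A 1 Q :=
  ⟨1, _, .normSq A r c hv, le_rfl, h⟩

theorem setCpx {r : ℕ} {x : CpxExpr} (hD : A.nat 1 = D) (hx : x.Ok B A)
    (hn : ‖x.eval A‖ + 1 ≤ D) (h : Q (A.setCpx r (gridRound D (x.eval A)))) :
    Runs B D (.setCpx r x) A 1 Q :=
  ⟨1, _, .setCpx A r x hD hx hn, le_rfl, h⟩

theorem load {r k : ℕ} {i : NatExpr} (c : ℕ) (hc : i.eval A.nat = c) (hk : k < 8)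
    (hi : i.Ok A.nat) (hB : A.nat 0 = B) (h : Q (A.setCpx r (A.arr k c))) :
    Runs B D (.load r k i) A 1 Q := by
  subst hc
  exact ⟨1, _, .load A r k i hk hi hB, le_rfl, h⟩

theorem store {r k : ℕ} {i : NatExpr} (c : ℕ) (hc : i.eval A.nat = c) (hk : k < 8)
    (hi : i.Ok A.nat) (hB : A.nat 0 = B) (h : Q (A.setArr k c (A.cpx r))) :
    Runs B D (.store k i r) A 1 Q := by
  subst hc
  exact ⟨1, _, .store A k i r hk hi hB, le_rfl, h⟩

theorem branch {a b : NatExpr} (ha : a.Ok A.nat) (hb : b.Ok A.nat)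
    (ht : a.eval A.nat < b.eval A.nat → Runs B D p A T₁ Q)
    (hf : ¬ a.eval A.nat < b.eval A.nat → Runs B D q A T₁ Q) (hT : T₁ + 1 ≤ T) :
    Runs B D (.branch a b p q) A T Q := by
  by_cases h : a.eval A.nat < b.eval A.nat
  · obtain ⟨t, A', h1, h2, h3⟩ := ht h
    exact ⟨1 + t, A', .branch_true ha hb h h1, by omega, h3⟩
  · obtain ⟨t, A', h1, h2, h3⟩ := hf h
    exact ⟨1 + t, A', .branch_false ha hb h h1, by omega, h3⟩

/-- Induction on the number j of remaining iterations, because a run of a loop is assembled from its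
end. The frame hypotheses refer to the state before the loop, so invariants need not mention what
the body leaves alone. -/
theorem loop {a b : NatExpr} (I : ℕ → CpxState → Prop) (K : ℕ) (S : ℕ → ℕ) (h0 : I 0 A)
    (hstep : ∀ k < K, ∀ A', p.Frame A A' → I k A' → a.Ok A'.nat ∧ b.Ok A'.nat ∧
      a.eval A'.nat < b.eval A'.nat ∧ Runs B D p A' (S k) (I (k + 1)))
    (hend : ∀ A', p.Frame A A' → I K A' → a.Ok A'.nat ∧ b.Ok A'.nat ∧
      ¬ a.eval A'.nat < b.eval A'.nat) :
    Runs B D (.loop a b p) A ((∑ k ∈ Finset.range K, (S k + 1)) + 1)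
      fun A' => p.Frame A A' ∧ I K A' := by
  have key : ∀ j ≤ K, ∀ A', p.Frame A A' → I (K - j) A' →
      Runs B D (.loop a b p) A' ((∑ k ∈ Finset.Ico (K - j) K, (S k + 1)) + 1)
        fun A' => p.Frame A A' ∧ I K A' := by
    intro j
    induction j with
    | zero =>
      intro _ A' hF hI
      obtain ⟨h1, h2, h3⟩ := hend A' hF hI
      exact ⟨1, A', .loop_false h1 h2 h3, by omega, hF, hI⟩
    | succ j ih =>
      intro hj A' hF hI
      obtain ⟨h1, h2, h3, t, A'', h4, h5, h6⟩ := hstep (K - (j + 1)) (by omega) A' hF hI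
      rw [show K - (j + 1) + 1 = K - j by omega] at h6
      obtain ⟨u, A''', h7, h8, h9⟩ := ih (by omega) A'' (hF.trans h4.frame) h6
      refine ⟨1 + t + u, A''', .loop_true h1 h2 h3 h4 h7, ?_, h9⟩
      rw [Finset.sum_eq_sum_Ico_succ_bot (by omega),
        show K - (j + 1) + 1 = K - j by omega]
      omega
  have := key K le_rfl A (.refl _ _) (by simpa using h0)
  simpa using this

end Runs

/-- `for r in 0, …, b - 1 do p`, where `r` and `b` are natural registers. -/
def forLoop (r b : ℕ) (p : CpxProgram) : CpxProgram :=
  .seq (.setNat r (.lit 0))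
    (.loop (.reg r) (.reg b) (.seq p (.setNat r (.add (.reg r) (.lit 1)))))

/-- Each iteration pays 2 extra steps for the test and the increment, and the last 2 are the
initialization and the failing test. The invariant is required after the increment. The time may
depend on i, which is needed where the iterations are transforms of different lengths. -/
theorem Runs.forLoop' {p : CpxProgram} {A : CpxState} {r b N : ℕ} (I : ℕ → CpxState → Prop)
    (S : ℕ → ℕ) (hN : A.nat b = N) (hND : N ≤ D ^ 2) (hrb : b ≠ r) (hb : p.keepsNat b = true)
    (hr : p.keepsNat r = true) (h0 : I 0 (A.setNat r 0))
    (hstep : ∀ i < N, ∀ A', (CpxProgram.forLoop r b p).Frame A A' → A'.nat r = i → I i A' →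
      Runs B D p A' (S i) fun A'' => I (i + 1) (A''.setNat r (i + 1))) :
    Runs B D (CpxProgram.forLoop r b p) A ((∑ i ∈ Finset.range N, (S i + 2)) + 2) (I N) := by
  set body := CpxProgram.seq p (.setNat r (.add (.reg r) (.lit 1))) with hbody
  have hF0 : (CpxProgram.forLoop r b p).Frame A (A.setNat r 0) :=
    frame_setNat fun q hq => by simp [CpxProgram.forLoop, keepsNat] at hq; tauto
  have hFb : ∀ {A'}, body.Frame (A.setNat r 0) A' → (CpxProgram.forLoop r b p).Frame A A' :=
    fun h => hF0.trans h.loop.seq_right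
  have hnb : ∀ {A'}, body.Frame (A.setNat r 0) A' → A'.nat b = N := by
    intro A' h
    rw [h.nat b (by simp [hbody, keepsNat, hb]; omega)]
    simp [hrb, hN]
  have hloop := Runs.loop (B := B) (D := D) (a := .reg r) (b := .reg b) (p := body)
    (A := A.setNat r 0)
    (fun i A' => A'.nat r = i ∧ I i A') N (fun i => S i + 1) ⟨by simp, h0⟩
    (fun i hi A' hF hI => by
      refine ⟨trivial, trivial, by simp [NatExpr.eval, hI.1, hnb hF, hi], ?_⟩
      refine Runs.seq (hstep i hi A' (hFb hF) hI.1 hI.2) le_rfl fun A'' hF' hI' => ?_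
      refine Runs.setNat (i + 1) (by simp [NatExpr.eval, hF'.nat r hr, hI.1]) ⟨trivial, trivial⟩
        (by omega) ⟨by simp, hI'⟩)
    (fun A' hF hI => ⟨trivial, trivial, by simp [NatExpr.eval, hI.1, hnb hF]⟩)
  have hset : Runs B D (.setNat r (.lit 0)) A 1 fun A' => A' = A.setNat r 0 :=
    Runs.setNat 0 rfl trivial (Nat.zero_le _) rfl
  refine Runs.seq hset (T₂ := (∑ i ∈ Finset.range N, (S i + 2)) + 1) (by omega) ?_
  rintro _ _ rfl
  exact hloop.mono le_rfl fun A' _ h => h.2.2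

theorem Runs.forLoop {p : CpxProgram} {A : CpxState} {r b N : ℕ} (I : ℕ → CpxState → Prop)
    (S : ℕ) (hN : A.nat b = N) (hND : N ≤ D ^ 2) (hrb : b ≠ r) (hb : p.keepsNat b = true)
    (hr : p.keepsNat r = true) (h0 : I 0 (A.setNat r 0))
    (hstep : ∀ i < N, ∀ A', (CpxProgram.forLoop r b p).Frame A A' → A'.nat r = i → I i A' →
      Runs B D p A' S fun A'' => I (i + 1) (A''.setNat r (i + 1))) :
    Runs B D (CpxProgram.forLoop r b p) A (N * (S + 2) + 2) (I N) := by
  have := Runs.forLoop' (B := B) (D := D) I (fun _ => S) hN hND hrb hb hr h0 hstep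
  simpa using this

end CpxProgram

theorem norm_gridRound_sub_le {D : ℕ} (hD : 0 < D) (z : ℂ) : ‖gridRound D z - z‖ ≤ 2 / D := by
  have hD' : (0 : ℝ) < D := by exact_mod_cast hD
  have key : ∀ x : ℝ, |(⌊x * D⌋ : ℝ) / D - x| ≤ 1 / D := by
    intro x
    have h1 := Int.floor_le (x * D)
    have h2 := Int.lt_floor_add_one (x * D)
    have h3 : (⌊x * D⌋ : ℝ) / D - x = (⌊x * D⌋ - x * D) / D := by field_simp
    rw [h3, abs_div, abs_of_pos hD']
    gcongr
    rw [abs_le]; constructor <;> linarith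
  calc ‖gridRound D z - z‖ ≤ |(gridRound D z - z).re| + |(gridRound D z - z).im| :=
        Complex.norm_le_abs_re_add_abs_im _
    _ ≤ 1 / D + 1 / D := add_le_add (by simpa [gridRound] using key z.re)
        (by simpa [gridRound] using key z.im)
    _ = 2 / D := by ring

/-! ### Power series, `π`, and values of the exponential function -/

namespace CpxProgram

variable {B D N : ℕ} {A : CpxState}

/-- Adds `N` terms of a series to the complex register `2`; the term is in the complex register
`1`, its index in the natural register `15`, and `x` computes the next term. -/
def series (x : CpxExpr) : CpxProgram :=
  forLoop 15 5 (.seq (.setCpx 2 (.add (.reg 2) (.reg 1))) (.setCpx 1 x))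

/-- Adding a term contributes its error e k and one rounding error 2/D. The particular series enters
only through `hx`, the recursion for the errors of the terms; `hG` keeps the partial sums inside the
range where rounding is allowed. -/
theorem series_spec {x : CpxExpr} (T : ℕ → ℂ) (e : ℕ → ℝ) (G : ℝ) (hD : 0 < D)
    (h1 : A.nat 1 = D) (h5 : A.nat 5 = N) (hT : ∀ k ≤ N, ‖T k‖ ≤ G) (he : ∀ k ≤ N, e k ≤ 1)
    (hG : (N + 1) * (G + 3) + 1 ≤ D) (hND : N ≤ D ^ 2)
    (hx : ∀ k < N, ∀ A' : CpxState, A'.nat 15 = k → (series x).Frame A A' →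
      ‖A'.cpx 1 - T k‖ ≤ e k → x.Ok B A' ∧ ‖x.eval A' - T (k + 1)‖ + 2 / D ≤ e (k + 1))
    (h0 : ‖A.cpx 1 - T 0‖ ≤ e 0) (hS : A.cpx 2 = 0) :
    Runs B D (series x) A (N * 4 + 2) fun A' =>
      ‖A'.cpx 2 - ∑ k ∈ Finset.range N, T k‖ ≤ ∑ k ∈ Finset.range N, (e k + 2 / D) := by
  have hD1 : (1 : ℝ) ≤ D := by exact_mod_cast hD
  have hD2 : (2 : ℝ) / D ≤ 2 := div_le_self (by norm_num) hD1
  have hG0 : 0 ≤ G := (norm_nonneg _).trans (hT 0 (Nat.zero_le _))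
  refine (Runs.forLoop (fun k A' => ‖A'.cpx 1 - T k‖ ≤ e k ∧
    ‖A'.cpx 2 - ∑ k ∈ Finset.range k, T k‖ ≤ ∑ k ∈ Finset.range k, (e k + 2 / D)) 2 h5 hND
    (by norm_num) rfl rfl ⟨by simpa using h0, by simp [hS]⟩ ?_).mono le_rfl fun _ _ h => h.2
  intro k hk A' hF h15 ⟨ht, hs⟩
  have hk1 : (k : ℝ) + 1 ≤ N := by exact_mod_cast hk
  have hA1 : A'.nat 1 = D := (hF.nat 1 rfl).trans h1
  have b1 : ‖∑ k ∈ Finset.range k, T k‖ ≤ k * G := by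
    refine (norm_sum_le _ _).trans ((Finset.sum_le_card_nsmul _ _ G fun i hi => hT i ?_).trans ?_)
    · have := Finset.mem_range.1 hi; omega
    · simp
  -- Here 3 is the sum of the bounds e k ≤ 1 and 2/D ≤ 2.
  have b2 : ∑ k ∈ Finset.range k, (e k + 2 / D) ≤ k * 3 := by
    refine (Finset.sum_le_card_nsmul _ _ 3 fun i hi => ?_).trans ?_
    · have := he i (by have := Finset.mem_range.1 hi; omega)
      linarith
    · simp
  have b3 : ‖A'.cpx 2‖ ≤ k * (G + 3) := by
    calc ‖A'.cpx 2‖ = ‖(A'.cpx 2 - ∑ k ∈ Finset.range k, T k) + ∑ k ∈ Finset.range k, T k‖ := by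
          congr 1; ring
      _ ≤ k * 3 + k * G := (norm_add_le _ _).trans (add_le_add (hs.trans b2) b1)
      _ = _ := by ring
  have b4 : ‖A'.cpx 1‖ ≤ G + 1 := by
    calc ‖A'.cpx 1‖ = ‖(A'.cpx 1 - T k) + T k‖ := by congr 1; ring
      _ ≤ 1 + G := (norm_add_le _ _).trans (add_le_add (ht.trans (he k hk.le)) (hT k hk.le))
      _ = _ := by ring
  have b5 : ‖A'.cpx 2 + A'.cpx 1‖ + 1 ≤ D := by
    have := norm_add_le (A'.cpx 2) (A'.cpx 1)
    nlinarith
  refine Runs.seq (T₁ := 1) (T₂ := 1) (R := fun A'' => A'' = A'.setCpx 2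
    (gridRound D (A'.cpx 2 + A'.cpx 1))) ?_ le_rfl ?_
  · exact Runs.setCpx hA1 ⟨trivial, trivial⟩ b5 rfl
  rintro A'' hF' rfl
  set S' := gridRound D (A'.cpx 2 + A'.cpx 1)
  have hF2 : (series x).Frame A (A'.setCpx 2 S') := by
    refine hF.trans (hF'.seq_left (q := .setCpx 1 x)).seq_left.loop.seq_right
  obtain ⟨c1, c2⟩ := hx k hk (A'.setCpx 2 S') h15 hF2 (by simpa using ht)
  have b6 : ‖x.eval (A'.setCpx 2 S')‖ ≤ G + 1 := by
    calc ‖x.eval (A'.setCpx 2 S')‖ = ‖(x.eval (A'.setCpx 2 S') - T (k + 1)) + T (k + 1)‖ := by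
          congr 1; ring
      _ ≤ 1 + G := (norm_add_le _ _).trans (add_le_add (by
          have := he (k + 1) hk
          have : (0 : ℝ) ≤ 2 / D := by positivity
          linarith) (hT (k + 1) hk))
      _ = _ := by ring
  refine Runs.setCpx (by simpa using hA1) c1 (by nlinarith) ⟨?_, ?_⟩
  · simp only [CpxState.setNat_cpx, CpxState.setCpx_cpx, if_true]
    calc ‖gridRound D (x.eval (A'.setCpx 2 S')) - T (k + 1)‖
        = ‖(gridRound D (x.eval (A'.setCpx 2 S')) - x.eval (A'.setCpx 2 S')) +
          (x.eval (A'.setCpx 2 S') - T (k + 1))‖ := by congr 1; ring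
      _ ≤ 2 / D + ‖x.eval (A'.setCpx 2 S') - T (k + 1)‖ :=
          (norm_add_le _ _).trans (add_le_add (norm_gridRound_sub_le hD _) le_rfl)
      _ ≤ _ := by linarith
  · simp only [CpxState.setNat_cpx, CpxState.setCpx_cpx, Finset.sum_range_succ]
    simp only [OfNat.ofNat_ne_one, if_false, if_true]
    calc ‖S' - (∑ k ∈ Finset.range k, T k + T k)‖
        = ‖(S' - (A'.cpx 2 + A'.cpx 1)) + (A'.cpx 2 - ∑ k ∈ Finset.range k, T k) +
          (A'.cpx 1 - T k)‖ := by congr 1; ring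
      _ ≤ 2 / D + ∑ k ∈ Finset.range k, (e k + 2 / D) + e k :=
          (norm_add₃_le).trans (add_le_add (add_le_add (norm_gridRound_sub_le hD _) hs) ht)
      _ = _ := by ring

theorem gridRound_zero : gridRound D 0 = 0 := by
  apply Complex.ext <;> simp [gridRound]

theorem norm_gridRound_sub_le_add (hD : 0 < D) {z w : ℂ} {e : ℝ} (h : ‖z - w‖ ≤ e) :
    ‖gridRound D z - w‖ ≤ e + 2 / D := by
  calc ‖gridRound D z - w‖ = ‖(gridRound D z - z) + (z - w)‖ := by congr 1; ring
    _ ≤ _ := (norm_add_le _ _).trans (by linarith [norm_gridRound_sub_le hD z])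

/-- Computes `exp (i θ)` in the complex register `2`, where `θ` is in the complex register `4`. -/
def expI : CpxProgram :=
  .seq (.setCpx 1 (.ofNat (.lit 1))) (.seq (.setCpx 2 (.ofNat (.lit 0)))
    (series (.divNat (.mul (.mul (.reg 1) (.reg 4)) .I) (.add (.reg 15) (.lit 1)))))

/-- The quotient of consecutive terms of the exponential series at |θ| ≤ 7 is at most 7/(k+1), which
is at most 7 while k < 7 and at most 1 afterwards. So terms and propagated errors never grow by more
than 7^7, independently of the number of terms. -/
theorem exp_series_step (k : ℕ) : (7 : ℝ) ^ min k 7 * (7 / (k + 1)) ≤ 7 ^ min (k + 1) 7 := by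
  rcases lt_or_ge k 7 with h | h
  · rw [min_eq_left h.le, min_eq_left (show k + 1 ≤ 7 by omega), pow_succ]
    gcongr
    apply div_le_self (by norm_num)
    have : (0 : ℝ) ≤ k := by positivity
    linarith
  · rw [min_eq_right h, min_eq_right (show 7 ≤ k + 1 by omega)]
    apply mul_le_of_le_one_right (by positivity)
    rw [div_le_one (by positivity)]
    have : (7 : ℝ) ≤ k := by exact_mod_cast h
    linarith

theorem exp_fourteen_le : Real.exp 14 ≤ 3 ^ 14 := by
  have h1 : Real.exp 1 ≤ 3 := by linarith [Real.exp_one_lt_d9]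
  calc Real.exp 14 = Real.exp 1 ^ 14 := by rw [← Real.exp_nat_mul]; norm_num
    _ ≤ 3 ^ 14 := by gcongr

/-- From N ≥ 13 on the quotients of terms are at most 1/2, so the tail is at most twice the first
omitted term. That term is at most 7^N/N! = (14^N/N!)/2^N ≤ e^14/2^N. -/
theorem exp_tail {θ : ℂ} (hθ : ‖θ‖ ≤ 7) (hN : 13 ≤ N) (hD : 0 < D) (hDN : D ≤ 2 ^ N) :
    ‖Complex.exp θ - ∑ k ∈ Finset.range N, θ ^ k / k.factorial‖ ≤ 2 * 3 ^ 14 / D := by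
  have hN' : (13 : ℝ) ≤ N := by exact_mod_cast hN
  have hD0 : (0 : ℝ) < D := by exact_mod_cast hD
  have hDN' : (D : ℝ) ≤ 2 ^ N := by exact_mod_cast hDN
  have h1 : ‖θ‖ / (N.succ : ℝ) ≤ 1 / 2 := by
    rw [div_le_iff₀ (by positivity)]; push_cast; linarith
  refine (Complex.exp_bound' h1).trans ?_
  have h2 : ‖θ‖ ^ N / N.factorial ≤ 3 ^ 14 / D := by
    calc ‖θ‖ ^ N / N.factorial ≤ 7 ^ N / N.factorial := by gcongr
      _ = (14 ^ N / N.factorial) / 2 ^ N := by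
        rw [show (14 : ℝ) = 7 * 2 by norm_num, mul_pow]; field_simp
      _ ≤ 3 ^ 14 / 2 ^ N := by
        gcongr
        exact (Real.pow_div_factorial_le_exp 14 (by norm_num) N).trans exp_fourteen_le
      _ ≤ 3 ^ 14 / D := by gcongr
  calc _ ≤ (3 ^ 14 / D * 2 : ℝ) := by gcongr
    _ = _ := by ring

theorem expI_spec (h1 : A.nat 1 = D) (h5 : A.nat 5 = N) (hD : 2 ^ 30 * (N + 1) ^ 2 ≤ D)
    (hDN : D ≤ 2 ^ N) (hθ : ‖A.cpx 4‖ ≤ 7) : Runs B D expI A (N * 4 + 4) fun A' =>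
      ‖A'.cpx 2 - Complex.exp (A.cpx 4 * Complex.I)‖ ≤ 2 ^ 24 * N ^ 2 / D := by
  have hD0 : 0 < D := lt_of_lt_of_le (by positivity) hD
  have hN : 13 ≤ N := by
    by_contra h
    have h3 : 2 ^ N ≤ 2 ^ 13 := Nat.pow_le_pow_right (by norm_num) (by omega)
    nlinarith [Nat.zero_le N]
  have hDr : (2 : ℝ) ^ 30 * (N + 1) ^ 2 ≤ D := by exact_mod_cast hD
  have hD0' : (0 : ℝ) < D := by exact_mod_cast hD0
  have hN' : (13 : ℝ) ≤ N := by exact_mod_cast hN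
  set θ := A.cpx 4 with hθd
  have one_le_pow7 : ∀ k : ℕ, (7 : ℝ) ^ min k 7 ≤ 7 ^ 7 := fun k =>
    pow_le_pow_right₀ (by norm_num) (min_le_right _ _)
  have hTn : ∀ k : ℕ, ‖(θ * Complex.I) ^ k / k.factorial‖ ≤ 7 ^ min k 7 := by
    intro k
    induction k with
    | zero => simp
    | succ k ih =>
      have : (θ * Complex.I) ^ (k + 1) / (k + 1).factorial =
          (θ * Complex.I) ^ k / k.factorial * (θ * Complex.I / (k + 1)) := by
        rw [Nat.factorial_succ]; push_cast; field_simp; ring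
      rw [this, norm_mul]
      refine le_trans ?_ (exp_series_step k)
      have : ‖θ * Complex.I / ((k : ℂ) + 1)‖ ≤ 7 / (k + 1) := by
        rw [norm_div, norm_mul, Complex.norm_I, mul_one]
        rw [show ((k : ℂ) + 1) = ((k + 1 : ℕ) : ℂ) by push_cast; rfl, Complex.norm_natCast]
        push_cast
        gcongr
      gcongr
  refine Runs.seq (T₁ := 1) (T₂ := N * 4 + 3) (R := fun A' => A' = A.setCpx 1 (gridRound D 1)) ?_
    (by omega) ?_
  · refine Runs.setCpx h1 trivial ?_ (by simp [CpxExpr.eval, NatExpr.eval])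
    simp only [CpxExpr.eval, NatExpr.eval]
    norm_num
    nlinarith
  rintro _ - rfl
  refine Runs.seq (T₁ := 1) (T₂ := N * 4 + 2)
    (R := fun A' => A' = (A.setCpx 1 (gridRound D 1)).setCpx 2 0) ?_ (by omega) ?_
  · refine Runs.setCpx h1 trivial ?_ (by simp [CpxExpr.eval, NatExpr.eval, gridRound_zero])
    simp only [CpxExpr.eval, NatExpr.eval]
    norm_num
    nlinarith
  rintro _ - rfl
  -- The error of term k+1 is 7/(k+1) times the error of term k plus a new rounding error 2/D. Every
  -- product of such factors is dominated by 7^min(k,7), and k+1 rounding errors have entered up to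
  -- term k.
  have hmain := series_spec (B := B) (D := D) (N := N)
    (A := (A.setCpx 1 (gridRound D 1)).setCpx 2 0)
    (x := .divNat (.mul (.mul (.reg 1) (.reg 4)) .I) (.add (.reg 15) (.lit 1)))
    (fun k => (θ * Complex.I) ^ k / k.factorial)
    (fun k => 7 ^ min k 7 * ((k + 1) * (2 / D))) (7 ^ 7) hD0 h1 h5
    (fun k _ => (hTn k).trans (one_le_pow7 k))
    (fun k hk => by
      have hk' : (k : ℝ) ≤ N := by exact_mod_cast hk
      calc (7 : ℝ) ^ min k 7 * ((k + 1) * (2 / D)) ≤ 7 ^ 7 * ((N + 1) * (2 / D)) := by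
            refine mul_le_mul (one_le_pow7 k) ?_ (by positivity) (by positivity)
            gcongr
        _ = (7 ^ 7 * 2 * (N + 1)) / D := by ring
        _ ≤ 1 := by rw [div_le_one hD0']; nlinarith)
    (by nlinarith) (by nlinarith)
    (fun k hk A' h15 hF ht => by
      refine ⟨⟨⟨⟨trivial, trivial⟩, trivial⟩, ⟨trivial, trivial⟩, by simp [NatExpr.eval]⟩, ?_⟩
      have h4 : A'.cpx 4 = θ := by rw [hF.cpx 4 rfl]; simp [hθd]
      have e1 : CpxExpr.eval A' (.divNat (.mul (.mul (.reg 1) (.reg 4)) .I)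
          (.add (.reg 15) (.lit 1))) - (θ * Complex.I) ^ (k + 1) / (k + 1).factorial =
          (A'.cpx 1 - (θ * Complex.I) ^ k / k.factorial) * (θ * Complex.I / ((k + 1 : ℕ) : ℂ)) := by
        simp only [CpxExpr.eval, NatExpr.eval, h15, h4]
        rw [Nat.factorial_succ]; push_cast; field_simp; ring
      have e2 : ‖θ * Complex.I / ((k + 1 : ℕ) : ℂ)‖ ≤ 7 / (k + 1) := by
        rw [norm_div, norm_mul, Complex.norm_I, mul_one, Complex.norm_natCast]
        push_cast
        gcongr
      rw [e1, norm_mul]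
      calc _ ≤ (7 ^ min k 7 * ((k + 1) * (2 / D))) * (7 / (k + 1)) + 2 / (D : ℝ) := by gcongr
        _ = (7 ^ min k 7 * (7 / (k + 1))) * ((k + 1) * (2 / D)) + 2 / D := by ring
        _ ≤ 7 ^ min (k + 1) 7 * ((k + 1) * (2 / D)) + 1 * (2 / D) := by
          gcongr
          · exact exp_series_step k
          · norm_num
        _ ≤ 7 ^ min (k + 1) 7 * ((k + 1) * (2 / D)) + 7 ^ min (k + 1) 7 * (2 / D) := by
          gcongr; exact one_le_pow₀ (by norm_num)
        _ = _ := by push_cast; ring)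
    (by simpa using norm_gridRound_sub_le hD0 1) (by simp)
  refine hmain.mono le_rfl fun A' _ h => ?_
  have hsum : ∑ k ∈ Finset.range N, ((7 : ℝ) ^ min k 7 * ((k + 1) * (2 / D)) + 2 / D) ≤
      N * (7 ^ 7 * (N * (2 / D)) + 2 / D) := by
    refine (Finset.sum_le_card_nsmul _ _ (7 ^ 7 * ((N : ℝ) * (2 / D)) + 2 / D) fun k hk => ?_).trans ?_
    · have hk' : (k : ℝ) + 1 ≤ N := by exact_mod_cast Finset.mem_range.1 hk
      refine add_le_add (mul_le_mul (one_le_pow7 k) ?_ (by positivity) (by positivity)) le_rfl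
      gcongr
    · rw [Finset.card_range, nsmul_eq_mul]
  have htail := exp_tail (θ := θ * Complex.I) (by simpa using hθ) hN hD0 hDN
  calc ‖A'.cpx 2 - Complex.exp (θ * Complex.I)‖
      = ‖(A'.cpx 2 - ∑ k ∈ Finset.range N, (θ * Complex.I) ^ k / k.factorial) -
        (Complex.exp (θ * Complex.I) -
          ∑ k ∈ Finset.range N, (θ * Complex.I) ^ k / k.factorial)‖ := by congr 1; ring
    _ ≤ N * (7 ^ 7 * (N * (2 / D)) + 2 / D) + 2 * 3 ^ 14 / D :=
      (norm_sub_le _ _).trans (add_le_add (h.trans hsum) htail)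
    _ = (2 * 7 ^ 7 * N ^ 2 + 2 * N + 2 * 3 ^ 14) / D := by ring
    -- Both 2·7^7 and 2·3^14 are below 2^24, and N ≥ 13 makes the lower order terms fit under the
    -- quadratic one.
    _ ≤ _ := by
      gcongr
      nlinarith

/-- Computes `π` in the complex register `3`. -/
def computePi : CpxProgram :=
  .seq (.setCpx 1 (.divNat (.add (.ofNat (.lit 1)) .I) (.lit 2)))
    (.seq (.setCpx 2 (.ofNat (.lit 0)))
      (.seq (series (.divNat (.mul (.mul (.reg 1) (.add (.ofNat (.lit 1)) .I))
        (.ofNat (.add (.reg 15) (.lit 1)))) (.mul (.lit 2) (.add (.reg 15) (.lit 2)))))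
        (.setCpx 3 (.mul (.ofNat (.lit 4)) (.im (.reg 2))))))

/-- 1 - (1+i)/2 = (1-i)/2 lies in direction -π/4; this is how π is obtained from a logarithm series.
-/
theorem log_one_sub_im : (Complex.log (1 - (1 + Complex.I) / 2)).im = -(Real.pi / 4) := by
  rw [Complex.log_im]
  have h : (1 - (1 + Complex.I) / 2) = ((√2 / 2 : ℝ) : ℂ) *
      (Complex.cos ((-(Real.pi / 4) : ℝ) : ℂ) + Complex.sin ((-(Real.pi / 4) : ℝ) : ℂ) * Complex.I) := by
    rw [← Complex.ofReal_cos, ← Complex.ofReal_sin, Real.cos_neg, Real.sin_neg,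
      Real.cos_pi_div_four, Real.sin_pi_div_four]
    have : ((√2 : ℝ) : ℂ) * (√2 : ℝ) = 2 := by
      rw [← Complex.ofReal_mul, Real.mul_self_sqrt (by norm_num)]; norm_num
    push_cast
    linear_combination (-1 / 4 + Complex.I / 4) * this
  rw [h]
  exact Complex.arg_mul_cos_add_sin_mul_I (by positivity)
    ⟨by linarith [Real.pi_pos], by linarith [Real.pi_pos]⟩

theorem norm_one_add_I_div_two_sq : ‖(1 + Complex.I) / 2‖ ^ 2 = 1 / 2 := by
  rw [← Complex.normSq_eq_norm_sq, Complex.normSq_apply]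
  norm_num

/-- Since |z|² = 1/2, two terms of the logarithm series gain one bit. This is why the number of
terms is twice the logarithm of D. -/
theorem log_tail {M : ℕ} (hD : 0 < D) (hDM : D ≤ 2 ^ M) :
    ‖-Complex.log (1 - (1 + Complex.I) / 2) -
      ∑ k ∈ Finset.range (2 * M), ((1 + Complex.I) / 2) ^ (k + 1) / ((k + 1 : ℕ) : ℂ)‖ ≤ 4 / D := by
  set z := (1 + Complex.I) / 2 with hz
  have hz2 := norm_one_add_I_div_two_sq
  rw [← hz] at hz2
  have hD0 : (0 : ℝ) < D := by exact_mod_cast hD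
  have hDM' : (D : ℝ) ≤ 2 ^ M := by exact_mod_cast hDM
  have hz3 : ‖z‖ ≤ 3 / 4 := by nlinarith [norm_nonneg z]
  have h1 := Complex.norm_log_sub_logTaylor_le (2 * M) (z := -z) (by rw [norm_neg]; linarith)
  have h2 : Complex.logTaylor (2 * M + 1) (-z) =
      -∑ k ∈ Finset.range (2 * M), z ^ (k + 1) / ((k + 1 : ℕ) : ℂ) := by
    rw [Complex.logTaylor, Finset.sum_range_succ', ← Finset.sum_neg_distrib]
    simp only [CharP.cast_eq_zero, div_zero, add_zero]
    refine Finset.sum_congr rfl fun k _ => ?_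
    have h3 : (-1 : ℂ) ^ (k + 1 + 1) * (-z) ^ (k + 1) = -z ^ (k + 1) := by
      rw [neg_pow z, ← mul_assoc, ← pow_add, show k + 1 + 1 + (k + 1) = 2 * (k + 1) + 1 by ring,
        pow_succ, pow_mul]
      simp
    rw [h3, neg_div]
  rw [h2, norm_neg, ← sub_eq_add_neg, sub_neg_eq_add] at h1
  calc _ = ‖Complex.log (1 - z) + ∑ k ∈ Finset.range (2 * M), z ^ (k + 1) / ((k + 1 : ℕ) : ℂ)‖ := by
        rw [← norm_neg]; congr 1; ring
    _ ≤ _ := h1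
    _ ≤ (1 / 2) ^ M * 4 / 1 := by
      have h4 : ‖z‖ ^ (2 * M + 1) ≤ (1 / 2) ^ M := by
        rw [pow_succ, pow_mul, hz2]
        exact mul_le_of_le_one_right (by positivity) (by linarith)
      have h5 : (1 - ‖z‖)⁻¹ ≤ 4 := by
        rw [inv_le_comm₀ (by linarith) (by norm_num)]; linarith
      gcongr
      · exact inv_nonneg.2 (by linarith)
      · have : (0 : ℝ) ≤ ((2 * M : ℕ) : ℝ) := by positivity
        linarith
    _ = 4 / 2 ^ M := by rw [one_div, inv_pow]; ring
    _ ≤ 4 / D := by gcongr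

theorem computePi_spec {M : ℕ} (h1 : A.nat 1 = D) (h5 : A.nat 5 = N) (hNM : N = 2 * M)
    (hD : 2 ^ 30 * (N + 1) ^ 2 ≤ D) (hDN : D ≤ 2 ^ M) :
    Runs B D computePi A (N * 4 + 5) fun A' =>
      ‖A'.cpx 3 - Real.pi‖ ≤ 2 ^ 24 * N ^ 2 / D := by
  have hD0 : 0 < D := lt_of_lt_of_le (by positivity) hD
  have hN : 1 ≤ N := by
    by_contra h
    have h3 : M = 0 := by omega
    subst h3
    have : 0 ≤ (N + 1) ^ 2 := Nat.zero_le _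
    nlinarith [Nat.zero_le N]
  have hDr : (2 : ℝ) ^ 30 * (N + 1) ^ 2 ≤ D := by exact_mod_cast hD
  have hD0' : (0 : ℝ) < D := by exact_mod_cast hD0
  have hN' : (1 : ℝ) ≤ N := by exact_mod_cast hN
  set z := (1 + Complex.I) / 2 with hz
  have hz2 := norm_one_add_I_div_two_sq
  rw [← hz] at hz2
  have hz1 : ‖z‖ ≤ 1 := by nlinarith [norm_nonneg z]
  clear_value z
  refine Runs.seq (T₁ := 1) (T₂ := N * 4 + 4) (R := fun A' => A' = A.setCpx 1 (gridRound D z)) ?_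
    (by omega) ?_
  · refine Runs.setCpx h1 ⟨⟨trivial, trivial⟩, trivial, by simp [NatExpr.eval]⟩ ?_
      (by simp [CpxExpr.eval, NatExpr.eval, hz])
    simp only [CpxExpr.eval, NatExpr.eval, Nat.cast_one, Nat.cast_ofNat]
    rw [← hz]
    nlinarith
  rintro _ - rfl
  refine Runs.seq (T₁ := 1) (T₂ := N * 4 + 3)
    (R := fun A' => A' = (A.setCpx 1 (gridRound D z)).setCpx 2 0) ?_ (by omega) ?_
  · refine Runs.setCpx h1 trivial ?_ (by simp [CpxExpr.eval, NatExpr.eval, gridRound_zero])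
    simp only [CpxExpr.eval, NatExpr.eval]
    norm_num
    nlinarith
  rintro _ - rfl
  -- Consecutive terms have the quotient z(k+1)/(k+2) of modulus at most 1, so errors are not
  -- amplified: k+1 rounding errors simply add up.
  have hmain := series_spec (B := B) (D := D) (N := N)
    (A := (A.setCpx 1 (gridRound D z)).setCpx 2 0)
    (x := .divNat (.mul (.mul (.reg 1) (.add (.ofNat (.lit 1)) .I))
        (.ofNat (.add (.reg 15) (.lit 1)))) (.mul (.lit 2) (.add (.reg 15) (.lit 2))))
    (fun k => z ^ (k + 1) / ((k + 1 : ℕ) : ℂ)) (fun k => (k + 1) * (2 / D)) 1 hD0 h1 h5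
    (fun k _ => by
      rw [norm_div, norm_pow, Complex.norm_natCast]
      exact div_le_one_of_le₀ ((pow_le_one₀ (norm_nonneg _) hz1).trans (by simp)) (by positivity))
    (fun k hk => by
      have hk' : (k : ℝ) ≤ N := by exact_mod_cast hk
      calc ((k : ℝ) + 1) * (2 / D) ≤ (N + 1) * (2 / D) := by gcongr
        _ = (2 * (N + 1)) / D := by ring
        _ ≤ 1 := by rw [div_le_one hD0']; nlinarith)
    (by nlinarith) (by nlinarith)
    (fun k hk A' h15 hF ht => by
      refine ⟨⟨⟨⟨trivial, trivial, trivial⟩, trivial, trivial⟩, ⟨trivial, trivial, trivial⟩,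
        by simp [NatExpr.eval]⟩, ?_⟩
      have e1 : CpxExpr.eval A' (.divNat (.mul (.mul (.reg 1) (.add (.ofNat (.lit 1)) .I))
          (.ofNat (.add (.reg 15) (.lit 1)))) (.mul (.lit 2) (.add (.reg 15) (.lit 2)))) -
          z ^ (k + 1 + 1) / ((k + 1 + 1 : ℕ) : ℂ) =
          (A'.cpx 1 - z ^ (k + 1) / ((k + 1 : ℕ) : ℂ)) *
            (z * (((k + 1 : ℕ) : ℂ) / ((k + 2 : ℕ) : ℂ))) := by
        have h1 : ((k : ℂ) + 1) ≠ 0 := Nat.cast_add_one_ne_zero k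
        have h2 : ((k : ℂ) + 2) ≠ 0 := by
          have := Nat.cast_add_one_ne_zero (R := ℂ) (k + 1)
          push_cast at this; rwa [add_assoc, one_add_one_eq_two] at this
        simp only [CpxExpr.eval, NatExpr.eval, h15]
        push_cast
        rw [show ((1 : ℂ) + Complex.I) = 2 * z by rw [hz]; ring,
          show (k : ℂ) + 1 + 1 = k + 2 by ring]
        field_simp
        ring
      have e2 : ‖z * (((k + 1 : ℕ) : ℂ) / ((k + 2 : ℕ) : ℂ))‖ ≤ 1 := by
        rw [norm_mul, norm_div, Complex.norm_natCast, Complex.norm_natCast]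
        refine mul_le_one₀ hz1 (by positivity) (div_le_one_of_le₀ ?_ (by positivity))
        push_cast; linarith
      rw [e1, norm_mul]
      calc _ ≤ (k + 1) * (2 / D) * 1 + 2 / (D : ℝ) := by gcongr
        _ = _ := by push_cast; ring)
    (by simpa using norm_gridRound_sub_le hD0 z) (by simp)
  refine Runs.seq hmain (T₂ := 1) (by omega) fun A' hF h => ?_
  have hsum : ∑ k ∈ Finset.range N, (((k : ℝ) + 1) * (2 / D) + 2 / D) ≤
      N * (N * (2 / D) + 2 / D) := by
    refine (Finset.sum_le_card_nsmul _ _ ((N : ℝ) * (2 / D) + 2 / D) fun k hk => ?_).trans ?_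
    · have hk' : (k : ℝ) + 1 ≤ N := by exact_mod_cast Finset.mem_range.1 hk
      gcongr
    · rw [Finset.card_range, nsmul_eq_mul]
  have htail := log_tail (M := M) hD0 hDN
  rw [← hNM, ← hz] at htail
  have hS : ‖A'.cpx 2 - -Complex.log (1 - z)‖ ≤ (2 * N ^ 2 + 2 * N + 4) / D :=
    calc ‖A'.cpx 2 - -Complex.log (1 - z)‖
        = ‖(A'.cpx 2 - ∑ k ∈ Finset.range N, z ^ (k + 1) / ((k + 1 : ℕ) : ℂ)) -
          (-Complex.log (1 - z) - ∑ k ∈ Finset.range N, z ^ (k + 1) / ((k + 1 : ℕ) : ℂ))‖ := by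
          congr 1; ring
      _ ≤ N * (N * (2 / D) + 2 / D) + 4 / D :=
        (norm_sub_le _ _).trans (add_le_add (h.trans hsum) htail)
      _ = _ := by ring
  have him : ‖(4 : ℂ) * ((A'.cpx 2).im : ℂ) - Real.pi‖ ≤ 4 * ((2 * N ^ 2 + 2 * N + 4) / D) := by
    have h6 := (Complex.abs_im_le_norm _).trans hS
    rw [Complex.sub_im, Complex.neg_im, hz, log_one_sub_im, neg_neg] at h6
    have h7 : (4 : ℂ) * ((A'.cpx 2).im : ℂ) - Real.pi =
        ((4 * ((A'.cpx 2).im - Real.pi / 4) : ℝ) : ℂ) := by push_cast; ring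
    rw [h7, Complex.norm_real, Real.norm_eq_abs, abs_mul, abs_of_pos (by norm_num : (0 : ℝ) < 4)]
    gcongr
  have hb : 4 * ((2 * (N : ℝ) ^ 2 + 2 * N + 4) / D) ≤ 1 := by
    rw [← mul_div_assoc, div_le_one hD0']; nlinarith
  have hA1 : A'.nat 1 = D := by rw [hF.nat 1 rfl]; exact h1
  refine Runs.setCpx hA1 ⟨trivial, trivial⟩ ?_ ?_
  · simp only [CpxExpr.eval, NatExpr.eval, Nat.cast_ofNat]
    have h8 : ‖(4 : ℂ) * ((A'.cpx 2).im : ℂ)‖ ≤ 1 + Real.pi := by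
      calc _ = ‖((4 : ℂ) * ((A'.cpx 2).im : ℂ) - Real.pi) + Real.pi‖ := by congr 1; ring
        _ ≤ 1 + Real.pi := by
          refine (norm_add_le _ _).trans (add_le_add (him.trans hb) ?_)
          rw [Complex.norm_real, Real.norm_of_nonneg Real.pi_pos.le]
    nlinarith [Real.pi_le_four]
  · simp only [CpxExpr.eval, NatExpr.eval, Nat.cast_ofNat, CpxState.setCpx_cpx, if_true]
    refine (norm_gridRound_sub_le_add hD0 him).trans ?_
    calc 4 * ((2 * (N : ℝ) ^ 2 + 2 * N + 4) / D) + 2 / D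
        = (8 * N ^ 2 + 8 * N + 18) / D := by ring
      _ ≤ _ := by gcongr; nlinarith

/-- Computes `exp (i π a / b)` in the complex register `2`. -/
def expPiI (a b : NatExpr) : CpxProgram :=
  .seq (.setCpx 4 (.divNat (.mul (.reg 3) (.ofNat a)) b)) expI

/-- Let μ be the error of π. Multiplication by α/β ≤ 2 gives 2μ, rounding makes it at most 3μ, the
exponential at most doubles it to 6μ, and the series adds μ; this is less than 8μ = 2^27 N²/D. Since
2π is below 7 with some room, the computed argument stays in the range that `expI_spec` requires. -/
theorem expPiI_spec {a b : NatExpr} {α β : ℕ} (h1 : A.nat 1 = D) (h5 : A.nat 5 = N)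
    (hD : 2 ^ 30 * (N + 1) ^ 2 ≤ D) (hDN : D ≤ 2 ^ N)
    (hpi : ‖A.cpx 3 - Real.pi‖ ≤ 2 ^ 24 * N ^ 2 / D) (ha : a.Ok A.nat) (hb : b.Ok A.nat)
    (hα : a.eval A.nat = α) (hβ : b.eval A.nat = β) (hβ0 : 0 < β) (hαβ : α ≤ 2 * β) :
    Runs B D (expPiI a b) A (N * 4 + 5) fun A' =>
      ‖A'.cpx 2 - Complex.exp (Real.pi * (α / β) * Complex.I)‖ ≤ 2 ^ 27 * N ^ 2 / D := by
  have hD0 : 0 < D := lt_of_lt_of_le (by positivity) hD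
  have hN : 1 ≤ N := by
    by_contra h
    have h3 : N = 0 := by omega
    subst h3
    have : D ≤ 1 := by simpa using hDN
    omega
  have hDr : (2 : ℝ) ^ 30 * (N + 1) ^ 2 ≤ D := by exact_mod_cast hD
  have hD0' : (0 : ℝ) < D := by exact_mod_cast hD0
  have hN' : (1 : ℝ) ≤ N := by exact_mod_cast hN
  have hβ0' : (0 : ℝ) < β := by exact_mod_cast hβ0
  set μ : ℝ := 2 ^ 24 * N ^ 2 / D with hμ
  have hμ1 : μ ≤ 1 / 64 := by
    rw [hμ, div_le_iff₀ hD0']; nlinarith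
  have hμ2 : 2 / D ≤ μ := by rw [hμ]; gcongr; nlinarith
  have hq : ‖(α : ℂ) / β‖ ≤ 2 := by
    rw [norm_div, Complex.norm_natCast, Complex.norm_natCast, div_le_iff₀ hβ0']
    exact_mod_cast hαβ
  set θ : ℂ := Real.pi * (α / β) with hθ
  set v : ℂ := A.cpx 3 * α / β with hv
  have hvθ : ‖v - θ‖ ≤ 2 * μ := by
    have : v - θ = (A.cpx 3 - Real.pi) * ((α : ℂ) / β) := by rw [hv, hθ]; ring
    rw [this, norm_mul, mul_comm 2 μ]
    gcongr
  have hθn : ‖θ‖ ≤ 2 * Real.pi := by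
    rw [hθ, norm_mul, Complex.norm_real, Real.norm_of_nonneg Real.pi_pos.le, mul_comm]
    gcongr
  have hpi4 := Real.pi_lt_d2
  have hrθ : ‖gridRound D v - θ‖ ≤ 3 * μ := (norm_gridRound_sub_le_add hD0 hvθ).trans (by linarith)
  have hvn : ‖v‖ ≤ 7 := by
    calc ‖v‖ = ‖(v - θ) + θ‖ := by congr 1; ring
      _ ≤ _ := norm_add_le _ _
      _ ≤ 7 := by linarith
  have hrn : ‖gridRound D v‖ ≤ 7 := by
    calc ‖gridRound D v‖ = ‖(gridRound D v - θ) + θ‖ := by congr 1; ring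
      _ ≤ _ := norm_add_le _ _
      _ ≤ 7 := by linarith
  refine Runs.seq (T₁ := 1) (T₂ := N * 4 + 4) (R := fun A' => A' = A.setCpx 4 (gridRound D v)) ?_
    (by omega) ?_
  · refine Runs.setCpx h1 ⟨⟨trivial, ha⟩, hb, by omega⟩ ?_ (by simp [CpxExpr.eval, hα, hβ, hv])
    simp only [CpxExpr.eval, hα, hβ]
    rw [← hv]
    nlinarith
  rintro _ - rfl
  refine (expI_spec (B := B) (A := A.setCpx 4 (gridRound D v)) h1 h5 hD hDN
    (by simpa using hrn)).mono le_rfl fun A' _ h => ?_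
  simp only [CpxState.setCpx_cpx, if_true] at h
  have h7 : ‖Complex.exp (gridRound D v * Complex.I) - Complex.exp (θ * Complex.I)‖ ≤ 6 * μ := by
    have e1 : Complex.exp (gridRound D v * Complex.I) - Complex.exp (θ * Complex.I) =
        Complex.exp (θ * Complex.I) * (Complex.exp ((gridRound D v - θ) * Complex.I) - 1) := by
      rw [mul_sub, ← Complex.exp_add]; ring_nf
    have e2 : ‖Complex.exp (θ * Complex.I)‖ = 1 := by
      have : θ = ((Real.pi * (α / β) : ℝ) : ℂ) := by rw [hθ]; push_cast; rfl
      rw [this]; exact Complex.norm_exp_ofReal_mul_I _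
    have e3 : ‖(gridRound D v - θ) * Complex.I‖ ≤ 3 * μ := by simpa using hrθ
    rw [e1, norm_mul, e2, one_mul]
    refine (Complex.norm_exp_sub_one_le (e3.trans (by linarith))).trans ?_
    linarith
  calc ‖A'.cpx 2 - Complex.exp (θ * Complex.I)‖
      = ‖(A'.cpx 2 - Complex.exp (gridRound D v * Complex.I)) +
        (Complex.exp (gridRound D v * Complex.I) - Complex.exp (θ * Complex.I))‖ := by congr 1; ring
    _ ≤ μ + 6 * μ := (norm_add_le _ _).trans (add_le_add h h7)
    _ ≤ 8 * μ := by have : 0 ≤ μ := by positivity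
                    linarith
    _ = _ := by rw [hμ]; ring

end CpxProgram

/-! ### The fast Fourier transform for powers of two -/

/-- Intermediate results of the fast Fourier transform: transforms of length `2 ^ t` of
subsequences with step `H`. -/
noncomputable def fftStage (ω : ℂ) (x : ℕ → ℂ) (t H i : ℕ) : ℂ :=
  ∑ q ∈ Finset.range (2 ^ t), x (i % H + H * q) * ω ^ (H * q * (i / H))

theorem sum_range_two_mul {M : Type*} [AddCommMonoid M] (f : ℕ → M) (n : ℕ) :
    ∑ q ∈ Finset.range (2 * n), f q = ∑ q ∈ Finset.range n, (f (2 * q) + f (2 * q + 1)) := by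
  induction n with
  | zero => simp
  | succ n ih =>
    rw [Finset.sum_range_succ, ← ih, show 2 * (n + 1) = 2 * n + 1 + 1 by ring,
      Finset.sum_range_succ, Finset.sum_range_succ, add_assoc]

section fftStage

variable {ω : ℂ} {x : ℕ → ℂ} {t H M i : ℕ}

theorem fftStage_zero (hi : i < M) : fftStage ω x 0 M i = x i := by
  simp [fftStage, Nat.mod_eq_of_lt hi]

theorem fftStage_last (r : ℕ) :
    fftStage ω x r 1 i = ∑ q ∈ Finset.range (2 ^ r), x q * ω ^ (q * i) := by
  simp [fftStage, Nat.mod_one]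

/-- Position i encodes the offset i % H and the frequency i / H. In the preceding stage the step is
2H and the frequency counts modulo 2^t only; one reduction modulo M performs this reduction of the
frequency. -/
theorem fft_index (hM : M = 2 * H * 2 ^ t) :
    2 * (i - i % H) % M = 2 * H * (i / H % 2 ^ t) := by
  have h1 : i - i % H = H * (i / H) := by have := Nat.div_add_mod i H; omega
  rw [h1, hM, ← mul_assoc, Nat.mul_mod_mul_left]

theorem fft_index_lt (hH : 0 < H) (hM : M = 2 * H * 2 ^ t) :
    2 * (i - i % H) % M + i % H + H < M := by
  rw [fft_index hM, hM]
  have h1 : i / H % 2 ^ t + 1 ≤ 2 ^ t := Nat.mod_lt _ (by positivity)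
  have h2 := Nat.mod_lt i hH
  have h3 : 2 * H * (i / H % 2 ^ t + 1) ≤ 2 * H * 2 ^ t := Nat.mul_le_mul_left _ h1
  rw [mul_add] at h3
  omega

/-- ω^(2H) has order dividing 2^t, so the reduced frequency can be replaced by i / H. -/
theorem fftStage_aux (hH : 0 < H) (hM : M = 2 * H * 2 ^ t) (hω : ω ^ M = 1) {c : ℕ}
    (hc : c < 2 * H) :
    fftStage ω x t (2 * H) (2 * (i - i % H) % M + c) =
      ∑ q ∈ Finset.range (2 ^ t), x (c + 2 * H * q) * ω ^ (2 * H * q * (i / H)) := by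
  rw [fft_index hM]
  unfold fftStage
  refine Finset.sum_congr rfl fun q _ => ?_
  rw [Nat.mul_add_mod, Nat.mod_eq_of_lt hc, Nat.mul_add_div (by omega), Nat.div_eq_of_lt hc,
    add_zero]
  congr 1
  conv_rhs => rw [← Nat.div_add_mod (i / H) (2 ^ t), mul_add, pow_add,
    show 2 * H * q * (2 ^ t * (i / H / 2 ^ t)) = M * (q * (i / H / 2 ^ t)) by rw [hM]; ring,
    pow_mul ω M, hω, one_pow, one_mul]

/-- Decimation in time: even q form the transform at offset i % H with step 2H, odd q the one at
offset i % H + H. Because results are indexed by offset and frequency, the last stage ends in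
natural order without bit reversal. -/
theorem fftStage_succ (hH : 0 < H) (hM : M = 2 * H * 2 ^ t) (hω : ω ^ M = 1) :
    fftStage ω x (t + 1) H i = fftStage ω x t (2 * H) (2 * (i - i % H) % M + i % H) +
      ω ^ (i - i % H) * fftStage ω x t (2 * H) (2 * (i - i % H) % M + i % H + H) := by
  have h2 := Nat.mod_lt i hH
  rw [fftStage_aux hH hM hω (by omega), add_assoc, fftStage_aux hH hM hω (by omega)]
  have h1 : i - i % H = H * (i / H) := by have := Nat.div_add_mod i H; omega
  rw [h1, fftStage, pow_succ, mul_comm (2 ^ t) 2, sum_range_two_mul, Finset.sum_add_distrib,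
    Finset.mul_sum]
  congr 1
  · refine Finset.sum_congr rfl fun q _ => ?_
    rw [show H * (2 * q) = 2 * H * q by ring]
  · refine Finset.sum_congr rfl fun q _ => ?_
    rw [show i % H + H * (2 * q + 1) = i % H + H + 2 * H * q by ring,
      show H * (2 * q + 1) * (i / H) = H * (i / H) + 2 * H * q * (i / H) by ring, pow_add]
    ring

theorem norm_fftStage_le {Y : ℝ} (hH : 0 < H) (hM : M = H * 2 ^ t) (hω : ‖ω‖ = 1)
    (hx : ∀ i < M, ‖x i‖ ≤ Y) : ‖fftStage ω x t H i‖ ≤ 2 ^ t * Y := by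
  unfold fftStage
  refine (norm_sum_le _ _).trans ((Finset.sum_le_card_nsmul _ _ Y fun q hq => ?_).trans ?_)
  · rw [norm_mul, norm_pow, hω, one_pow, mul_one]
    apply hx
    have h1 : q + 1 ≤ 2 ^ t := Finset.mem_range.1 hq
    have h2 := Nat.mod_lt i hH
    have h3 : H * (q + 1) ≤ H * 2 ^ t := Nat.mul_le_mul_left _ h1
    rw [hM]
    rw [mul_add] at h3
    omega
  · simp

end fftStage

theorem norm_mul_sub_mul_le {a b c d : ℂ} {e f g h : ℝ} (hb : ‖b‖ ≤ g) (hc : ‖c‖ ≤ h)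
    (h1 : ‖a - c‖ ≤ e) (h2 : ‖b - d‖ ≤ f) : ‖a * b - c * d‖ ≤ e * g + h * f := by
  have he := (norm_nonneg _).trans h1
  have hh := (norm_nonneg _).trans hc
  calc ‖a * b - c * d‖ = ‖(a - c) * b + c * (b - d)‖ := by congr 1; ring
    _ ≤ ‖a - c‖ * ‖b‖ + ‖c‖ * ‖b - d‖ := (norm_add_le _ _).trans (by rw [norm_mul, norm_mul])
    _ ≤ _ := by gcongr

theorem norm_le_of_norm_sub_le {a b : ℂ} {e f : ℝ} (h : ‖a - b‖ ≤ e) (hb : ‖b‖ ≤ f) :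
    ‖a‖ ≤ f + e := by
  calc ‖a‖ = ‖b + (a - b)‖ := by congr 1; ring
    _ ≤ _ := (norm_add_le _ _).trans (add_le_add hb h)

/-! ### Copying arrays, and error and running time of the fast Fourier transform -/

namespace CpxProgram

variable {B D : ℕ} {A : CpxState}

/-- Copies the array `k` to the array `l`; the length is in the natural register `b`. -/
def copyArr (k l b : ℕ) : CpxProgram :=
  forLoop 14 b (.seq (.load 0 k (.reg 14)) (.store l (.reg 14) 0))

theorem copyArr_spec {k l b n : ℕ} (hk : k < 8) (hl : l < 8) (hkl : k ≠ l) (hb : b ≠ 14)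
    (h0 : A.nat 0 = B) (hn : A.nat b = n) (hnD : n ≤ D ^ 2) :
    Runs B D (copyArr k l b) A (n * 4 + 2) fun A' => ∀ i < n, A'.arr l i = A.arr k i := by
  refine (Runs.forLoop (fun j A' => A'.arr k = A.arr k ∧ ∀ i < j, A'.arr l i = A.arr k i) 2 hn hnD
    hb rfl rfl ⟨rfl, by simp⟩ ?_).mono le_rfl fun A' _ h => h.2
  rintro i hi A' hF h14 ⟨hI1, hI2⟩
  have hA0 : A'.nat 0 = B := (hF.nat 0 rfl).trans h0
  refine Runs.seq (T₁ := 1) (T₂ := 1) (Runs.load i (by simp [NatExpr.eval, h14]) hk trivial hA0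
    (Q := fun A'' => A'' = A'.setCpx 0 (A'.arr k i)) rfl) le_rfl ?_
  rintro _ - rfl
  refine Runs.store i (by simp [NatExpr.eval, h14]) hl trivial hA0 ⟨?_, ?_⟩
  · simp only [CpxState.setNat_arr]
    rw [CpxState.setArr_arr_of_ne _ _ _ _ hkl]
    exact hI1
  · intro j hj
    simp only [CpxState.setNat_arr, CpxState.setArr_arr_same]
    split_ifs with h
    · simp [h, hI1]
    · exact hI2 j (by omega)

/-- One stage of the fast Fourier transform of the array `a`, with result in the array `5`. -/
def fftStep (a : ℕ) : CpxProgram :=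
  forLoop 14 8 (.seq (.setNat 16 (.mod (.reg 14) (.reg 12)))
    (.seq (.setNat 17 (.mod (.mul (.lit 2) (.sub (.reg 14) (.reg 16))) (.reg 8)))
      (.seq (.setCpx 0 (.add (.load a (.add (.reg 17) (.reg 16)))
        (.mul (.load 6 (.sub (.reg 14) (.reg 16)))
          (.load a (.add (.add (.reg 17) (.reg 16)) (.reg 12))))))
        (.store 5 (.reg 14) 0))))

/-- In a₁ + b a₂ with |b| ≤ 2 the data errors contribute f + 2f. The error of the table entry b
contributes at most MYμ ≤ e ≤ f, and rounding at most another f. -/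
theorem fftStep_spec {a H M t : ℕ} {ω : ℂ} {x : ℕ → ℂ} {Y e f μ : ℝ} (ha : a < 8) (ha5 : a ≠ 5)
    (h0 : A.nat 0 = B) (h1 : A.nat 1 = D) (h8 : A.nat 8 = M) (h12 : A.nat 12 = H) (hH : 0 < H)
    (hM : M = 2 * H * 2 ^ t) (hω : ω ^ M = 1) (hω1 : ‖ω‖ = 1) (hD : 0 < D)
    (hx : ∀ i < M, ‖x i‖ ≤ Y) (hY : 0 ≤ Y)
    (harr : ∀ i < M, ‖A.arr a i - fftStage ω x t (2 * H) i‖ ≤ f)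
    (hW : ∀ i < M, ‖A.arr 6 i - ω ^ i‖ ≤ μ) (hμ : μ ≤ 1) (hμe : M * Y * μ ≤ e)
    (hDe : 2 / D ≤ e) (hef : e ≤ f) (hbig : 3 * (M * Y + f) + 1 ≤ D) (hMD : 2 * M ≤ D ^ 2) :
    Runs B D (fftStep a) A (M * 6 + 2) fun A' =>
      ∀ i < M, ‖A'.arr 5 i - fftStage ω x (t + 1) H i‖ ≤ 5 * f := by
  refine Runs.forLoop (fun j A' => ∀ i < j, ‖A'.arr 5 i - fftStage ω x (t + 1) H i‖ ≤ 5 * f) 4 h8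
    (by omega) (by norm_num) rfl rfl (by simp) ?_
  intro i hi A' hF h14 hI
  have hA0 : A'.nat 0 = B := (hF.nat 0 rfl).trans h0
  have hA1 : A'.nat 1 = D := (hF.nat 1 rfl).trans h1
  have hA8 : A'.nat 8 = M := (hF.nat 8 rfl).trans h8
  have hA12 : A'.nat 12 = H := (hF.nat 12 rfl).trans h12
  have hAa : A'.arr a = A.arr a := hF.arr a (by simp [forLoop, keepsArr]; omega)
  have hA6 : A'.arr 6 = A.arr 6 := hF.arr 6 rfl
  have hp := Nat.mod_lt i hH
  have hpi := Nat.mod_le i H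
  have hv := Nat.mod_lt (2 * (i - i % H)) (show 0 < M by omega)
  have hidx := fft_index_lt (i := i) hH hM
  set p := i % H with hpd
  set v := 2 * (i - p) % M with hvd
  refine Runs.seq (T₁ := 1) (T₂ := 3) (Runs.setNat p (by simp [NatExpr.eval, h14, hA12, hpd])
    ⟨trivial, trivial, by simp [NatExpr.eval, hA12]; omega⟩ (by omega)
    (Q := fun A'' => A'' = A'.setNat 16 p) rfl) le_rfl ?_
  rintro _ - rfl
  refine Runs.seq (T₁ := 1) (T₂ := 2) (Runs.setNat v (by simp [NatExpr.eval, h14, hA8, hvd])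
    ⟨⟨trivial, trivial, trivial, by simp [NatExpr.eval, h14, hpi]⟩, trivial, by
      simp [NatExpr.eval, hA8]; omega⟩ (by omega)
    (Q := fun A'' => A'' = (A'.setNat 16 p).setNat 17 v) rfl) le_rfl ?_
  rintro _ - rfl
  have hM0 : 1 ≤ M := by omega
  have hst : ∀ j, ‖fftStage ω x t (2 * H) j‖ ≤ M * Y := by
    intro j
    refine (norm_fftStage_le (by omega) hM hω1 hx).trans ?_
    have h2 : (2 : ℝ) ^ t ≤ M := by
      have : 2 ^ t ≤ M := by rw [hM]; exact Nat.le_mul_of_pos_left _ (by omega)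
      exact_mod_cast this
    gcongr
  have hf0 : 0 ≤ f := (norm_nonneg _).trans (harr 0 (by omega))
  set a1 := A.arr a (v + p) with ha1
  set a2 := A.arr a (v + p + H) with ha2
  set b := A.arr 6 (i - p) with hb
  set s1 := fftStage ω x t (2 * H) (v + p) with hs1
  set s2 := fftStage ω x t (2 * H) (v + p + H) with hs2
  have e1 : ‖a1 - s1‖ ≤ f := harr _ (by omega)
  have e2 : ‖a2 - s2‖ ≤ f := harr _ (by omega)
  have e3 : ‖b - ω ^ (i - p)‖ ≤ μ := hW _ (by omega)
  have e4 : ‖ω ^ (i - p)‖ = 1 := by rw [norm_pow, hω1, one_pow]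
  have e5 : ‖b‖ ≤ 2 := (norm_le_of_norm_sub_le e3 e4.le).trans (by linarith)
  have e6 : ‖b * a2 - ω ^ (i - p) * s2‖ ≤ 2 * f + M * Y * μ := by
    have := norm_mul_sub_mul_le e5 (hst _) e2 e3
    rw [mul_comm b, mul_comm (ω ^ (i - p))]
    linarith
  have e7 : ‖(a1 + b * a2) - (s1 + ω ^ (i - p) * s2)‖ ≤ 4 * f := by
    calc _ = ‖(a1 - s1) + (b * a2 - ω ^ (i - p) * s2)‖ := by congr 1; ring
      _ ≤ f + (2 * f + M * Y * μ) := (norm_add_le _ _).trans (add_le_add e1 e6)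
      _ ≤ _ := by linarith
  have e8 : ‖a1 + b * a2‖ + 1 ≤ D := by
    have n1 : ‖a1‖ ≤ M * Y + f := norm_le_of_norm_sub_le e1 (hst _)
    have n2 : ‖b * a2‖ ≤ 2 * (M * Y + f) := by
      rw [norm_mul]
      have : ‖a2‖ ≤ M * Y + f := norm_le_of_norm_sub_le e2 (hst _)
      gcongr
    linarith [norm_add_le a1 (b * a2)]
  set A2 := (A'.setNat 16 p).setNat 17 v with hA2
  have hval : CpxExpr.eval A2 (.add (.load a (.add (.reg 17) (.reg 16)))
        (.mul (.load 6 (.sub (.reg 14) (.reg 16)))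
          (.load a (.add (.add (.reg 17) (.reg 16)) (.reg 12))))) = a1 + b * a2 := by
    simp [CpxExpr.eval, NatExpr.eval, hA2, hAa, hA6, h14, hA12, ha1, ha2, hb]
  refine Runs.seq (T₁ := 1) (T₂ := 1) (Runs.setCpx (by simp [hA2, hA1])
    ⟨⟨ha, ⟨trivial, trivial⟩, by simp [hA2, hA0]⟩,
      ⟨by norm_num, ⟨trivial, trivial, by simp [NatExpr.eval, hA2, h14, hpi]⟩, by simp [hA2, hA0]⟩,
      ⟨ha, ⟨⟨trivial, trivial⟩, trivial⟩, by simp [hA2, hA0]⟩⟩ (by rw [hval]; exact e8)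
    (Q := fun A'' => A'' = A2.setCpx 0 (gridRound D (a1 + b * a2))) (by rw [hval])) le_rfl ?_
  rintro _ - rfl
  refine Runs.store i (by simp [NatExpr.eval, hA2, h14]) (by norm_num) trivial
    (by simp [hA2, hA0]) ?_
  intro j hj
  simp only [CpxState.setNat_arr, CpxState.setArr_arr_same]
  split_ifs with h
  · subst h
    rw [fftStage_succ hH hM hω]
    simp only [CpxState.setCpx_cpx, if_true]
    exact (norm_gridRound_sub_le_add hD e7).trans (by linarith)
  · exact hI j (by omega)

/-- The fast Fourier transform of the array `a`. The length `2 ^ r` and `r` are in the natural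
registers `8` and `9`, and the roots of unity in the array `6`. -/
def fft (a : ℕ) : CpxProgram :=
  .seq (.setNat 12 (.reg 8))
    (forLoop 13 9 (.seq (.setNat 12 (.div (.reg 12) (.lit 2))) (.seq (fftStep a) (copyArr 5 a 8))))

/-- The factor 5 of each of the r stages gives 5^r ≤ 8^r = M³. -/
theorem fft_spec {a M r : ℕ} {ω : ℂ} {x : ℕ → ℂ} {Y e μ : ℝ} (ha : a < 8) (ha5 : a ≠ 5)
    (ha6 : a ≠ 6) (h0 : A.nat 0 = B) (h1 : A.nat 1 = D) (h8 : A.nat 8 = M) (h9 : A.nat 9 = r)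
    (hM : M = 2 ^ r) (hω : ω ^ M = 1) (hω1 : ‖ω‖ = 1) (hD : 0 < D)
    (hx : ∀ i < M, ‖x i‖ ≤ Y) (hY : 0 ≤ Y) (harr : ∀ i < M, ‖A.arr a i - x i‖ ≤ e)
    (hW : ∀ i < M, ‖A.arr 6 i - ω ^ i‖ ≤ μ) (hμ : μ ≤ 1) (hμe : M * Y * μ ≤ e)
    (hDe : 2 / D ≤ e) (hbig : 3 * (M * Y + M ^ 3 * e) + 1 ≤ D) (hMD : 2 * M ≤ D ^ 2) :
    Runs B D (fft a) A (r * (10 * M + 7) + 3) fun A' =>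
      ∀ i < M, ‖A'.arr a i - ∑ q ∈ Finset.range M, x q * ω ^ (q * i)‖ ≤ M ^ 3 * e := by
  have he : 0 ≤ e := le_trans (by positivity) hDe
  have h5 : ∀ t ≤ r, (5 : ℝ) ^ t ≤ M ^ 3 := by
    intro t ht
    calc (5 : ℝ) ^ t ≤ 5 ^ r := pow_le_pow_right₀ (by norm_num) ht
      _ ≤ 8 ^ r := pow_le_pow_left₀ (by norm_num) (by norm_num) _
      _ = _ := by rw [hM]; push_cast; rw [← pow_mul, mul_comm, pow_mul]; norm_num
  have hM0 : 0 < M := by rw [hM]; positivity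
  have hrM : r ≤ M := by rw [hM]; exact Nat.lt_two_pow_self.le
  refine Runs.seq (T₁ := 1) (T₂ := r * (10 * M + 7) + 2)
    (Runs.setNat M (by simp [NatExpr.eval, h8]) trivial (by omega)
    (Q := fun A'' => A'' = A.setNat 12 M) rfl) (by omega) ?_
  rintro _ - rfl
  have hloop := Runs.forLoop (B := B) (D := D) (A := A.setNat 12 M) (r := 13) (b := 9) (N := r)
    (p := .seq (.setNat 12 (.div (.reg 12) (.lit 2))) (.seq (fftStep a) (copyArr 5 a 8)))
    (fun t A' => A'.nat 12 * 2 ^ t = M ∧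
      ∀ i < M, ‖A'.arr a i - fftStage ω x t (A'.nat 12) i‖ ≤ 5 ^ t * e) (10 * M + 5)
    (by simp [h9]) (by omega) (by norm_num) rfl rfl
    ⟨by simp, fun i hi => by simpa [fftStage_zero hi] using harr i hi⟩ ?_
  · refine hloop.mono (by ring_nf; omega) fun A' _ h i hi => ?_
    have h12 : A'.nat 12 = 1 := by
      have := h.1
      rw [hM] at this
      exact Nat.eq_of_mul_eq_mul_right (show 0 < 2 ^ r by positivity) (by rw [this, one_mul])
    have := h.2 i hi
    rw [h12, fftStage_last, ← hM] at this
    exact this.trans (by gcongr; exact h5 r le_rfl)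
  intro t ht A' hF h13 ⟨hI1, hI2⟩
  have hA0 : A'.nat 0 = B := (hF.nat 0 rfl).trans (by simp [h0])
  have hA1 : A'.nat 1 = D := (hF.nat 1 rfl).trans (by simp [h1])
  have hA8 : A'.nat 8 = M := (hF.nat 8 rfl).trans (by simp [h8])
  have hA6 : A'.arr 6 = A.arr 6 := hF.arr 6 (by
    simp [fftStep, copyArr, forLoop, keepsArr, ha6])
  -- After t < r stages the step is 2^(r-t), which is even.
  obtain ⟨H, hH⟩ : ∃ H, A'.nat 12 = 2 * H := by
    have h2 : A'.nat 12 = 2 ^ (r - t) := by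
      apply Nat.eq_of_mul_eq_mul_right (show 0 < 2 ^ t by positivity)
      rw [hI1, hM, ← pow_add]; congr 1; omega
    exact ⟨2 ^ (r - t - 1), by rw [h2, ← pow_succ']; congr 1; omega⟩
  rw [hH] at hI1
  have hH0 : 0 < H := by
    rcases Nat.eq_zero_or_pos H with h | h
    · subst h; simp at hI1; omega
    · exact h
  have hHM : 2 * H ≤ M := by rw [← hI1]; exact Nat.le_mul_of_pos_right _ (by positivity)
  refine Runs.seq (T₁ := 1) (T₂ := 10 * M + 4) (Runs.setNat H
    (by simp [NatExpr.eval, hH]) ⟨trivial, trivial, by simp [NatExpr.eval]⟩ (by omega)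
    (Q := fun A'' => A'' = A'.setNat 12 H) rfl) (by omega) ?_
  rintro _ - rfl
  refine Runs.seq (T₁ := M * 6 + 2) (T₂ := M * 4 + 2)
    (fftStep_spec (A := A'.setNat 12 H) (e := e) (f := 5 ^ t * e) (μ := μ) (Y := Y) (t := t)
      (x := x) ha ha5 (by simp [hA0])
      (by simp [hA1]) (by simp [hA8]) (by simp) hH0 hI1.symm hω hω1 hD hx hY
      (fun i hi => by rw [← hH]; exact hI2 i hi)
      (fun i hi => by simpa [hA6] using hW i hi) hμ hμe hDe
      (le_mul_of_one_le_left he (one_le_pow₀ (by norm_num)))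
      (le_trans (by gcongr; exact h5 t ht.le) hbig) hMD) (by omega) ?_
  intro A2 hF2 hst
  have hB0 : A2.nat 0 = B := (hF2.nat 0 rfl).trans (by simp [hA0])
  have hB8 : A2.nat 8 = M := (hF2.nat 8 rfl).trans (by simp [hA8])
  have hB12 : A2.nat 12 = H := (hF2.nat 12 rfl).trans (by simp)
  refine (copyArr_spec (by norm_num) ha ha5.symm (by norm_num) hB0 hB8 (by omega)).mono le_rfl ?_
  intro A3 hF3 hcp
  have hC12 : A3.nat 12 = H := (hF3.nat 12 rfl).trans hB12
  refine ⟨?_, fun i hi => ?_⟩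
  · simp only [CpxState.setNat_nat]
    norm_num
    rw [hC12, pow_succ, ← hI1]; ring
  · simp only [CpxState.setNat_nat, CpxState.setNat_arr]
    norm_num
    rw [hC12, hcp i hi, pow_succ]
    exact (hst i hi).trans (by linarith)

end CpxProgram

/-! ### Transforms of arbitrary length as convolutions -/

open Complex in
/-- `exp (i π d² / m)`. -/
noncomputable def chirp (m d : ℕ) : ℂ :=
  exp (Real.pi * ((d * d % (2 * m) : ℕ) / m) * I)

open Complex in
/-- The discrete Fourier transform of length `m`. -/
noncomputable def cyclicDft (m : ℕ) (a : ℕ → ℂ) (k : ℕ) : ℂ :=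
  ∑ i ∈ Finset.range m, a i * exp (-(2 * Real.pi * ((i * k : ℕ) / m) * I))

section chirp

open Complex

variable {m : ℕ}

/-- d² matters only modulo 2m. The reduced form is the one that is computed, since `expPiI_spec`
needs an angle of at most 2π. -/
theorem chirp_eq (hm : 0 < m) (d : ℕ) : chirp m d = exp (Real.pi * ((d * d : ℕ) / m) * I) := by
  have hm' : (m : ℂ) ≠ 0 := by exact_mod_cast hm.ne'
  have h : ((d * d : ℕ) : ℂ) = ((2 * m * (d * d / (2 * m)) + d * d % (2 * m) : ℕ) : ℂ) := by
    rw [Nat.div_add_mod]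
  have h2 : (Real.pi * (((d * d : ℕ) : ℂ) / m) * I) =
      Real.pi * ((d * d % (2 * m) : ℕ) / m) * I + ((d * d / (2 * m) : ℕ) : ℂ) * (2 * Real.pi * I) := by
    rw [h]; push_cast; field_simp; ring
  rw [h2, exp_add, exp_nat_mul_two_pi_mul_I, mul_one, chirp]

theorem norm_chirp (d : ℕ) : ‖chirp m d‖ = 1 := by
  have : (Real.pi * (((d * d % (2 * m) : ℕ) : ℂ) / m) * I) =
    ((Real.pi * ((d * d % (2 * m) : ℕ) / m) : ℝ) : ℂ) * I := by push_cast; rfl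
  rw [chirp, this, norm_exp_ofReal_mul_I]

theorem conj_chirp (hm : 0 < m) (d : ℕ) :
    (starRingEnd ℂ) (chirp m d) = exp (-(Real.pi * ((d * d : ℕ) / m) * I)) := by
  rw [chirp_eq hm, ← exp_conj]
  simp

/-- Bluestein's identity -2ik = (k-i)² - i² - k², with d = |k-i|. -/
theorem chirp_mul {i k d : ℕ} (hm : 0 < m) (h : d + i = k ∨ d + k = i) :
    (starRingEnd ℂ) (chirp m k) * ((starRingEnd ℂ) (chirp m i) * chirp m d) =
      exp (-(2 * Real.pi * ((i * k : ℕ) / m) * I)) := by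
  rw [conj_chirp hm, conj_chirp hm, chirp_eq hm, ← exp_add, ← exp_add]
  congr 1
  have hm' : (m : ℂ) ≠ 0 := by exact_mod_cast hm.ne'
  rcases h with rfl | rfl
  · push_cast; field_simp; ring
  · push_cast; field_simp; ring

end chirp

/-- Orthogonality: the summands are powers of ζ = ω^(i+j-k), and the geometric sum vanishes unless ζ
= 1. With it a product of transforms becomes a cyclic convolution. -/
theorem sum_root_pow {M : ℕ} {ω : ℂ} (hM : 0 < M) (hω : IsPrimitiveRoot ω M) (hω1 : ‖ω‖ = 1) {i j k : ℕ} :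
    ∑ l ∈ Finset.range M, ω ^ (i * l) * ω ^ (j * l) * (starRingEnd ℂ) (ω ^ (l * k)) =
      if i + j ≡ k [MOD M] then (M : ℂ) else 0 := by
  have hc : (starRingEnd ℂ) ω * ω = 1 := by
    rw [mul_comm, Complex.mul_conj, Complex.normSq_eq_norm_sq, hω1]; simp
  set ζ := ω ^ (i + j) * (starRingEnd ℂ) ω ^ k with hζ
  have h1 : ∀ l, ω ^ (i * l) * ω ^ (j * l) * (starRingEnd ℂ) (ω ^ (l * k)) = ζ ^ l := by
    intro l
    rw [map_pow, hζ, mul_pow, ← pow_mul, ← pow_mul, add_mul, pow_add, mul_comm l k]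
  simp only [h1]
  have h2 : ζ = 1 ↔ i + j ≡ k [MOD M] := by
    have hmod : ω ^ (i + j) = ω ^ k ↔ i + j ≡ k [MOD M] := by
      rw [← pow_mod_orderOf ω (i + j), ← pow_mod_orderOf ω k, ← hω.eq_orderOf]
      exact ⟨fun h => hω.pow_inj (Nat.mod_lt _ hM) (Nat.mod_lt _ hM) h, fun h => by rw [h]⟩
    rw [← hmod]
    constructor
    · intro h
      calc ω ^ (i + j) = ω ^ (i + j) * (((starRingEnd ℂ) ω * ω) ^ k) := by rw [hc]; simp
        _ = ζ * ω ^ k := by rw [hζ, mul_pow]; ring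
        _ = ω ^ k := by rw [h, one_mul]
    · intro h
      rw [hζ, h, ← mul_pow, mul_comm ω, hc, one_pow]
  split_ifs with h
  · rw [h2.2 h]; simp
  · have h3 : ζ ≠ 1 := fun h' => h (h2.1 h')
    rw [geom_sum_eq h3]
    have h4 : ζ ^ M = 1 := by
      rw [hζ, mul_pow, ← pow_mul, ← pow_mul, mul_comm (i + j), pow_mul, hω.pow_eq_one, mul_comm k,
        pow_mul, ← map_pow, hω.pow_eq_one]
      simp
    rw [h4]; simp

/-- The chirp as a sequence of period `M`. -/
noncomputable def chirpSeq (m M i : ℕ) : ℂ := chirp m (if i < m then i else M - i)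

theorem norm_chirpSeq (m M i : ℕ) : ‖chirpSeq m M i‖ = 1 := norm_chirp _

theorem chirpSeq_of_lt {m M i : ℕ} (h : i < m) : chirpSeq m M i = chirp m i := by
  simp [chirpSeq, h]

/-- The factor of the convolution that depends on the data. -/
noncomputable def chirpData (m : ℕ) (a : ℕ → ℂ) (i : ℕ) : ℂ :=
  if i < m then a i * (starRingEnd ℂ) (chirp m i) else 0

/-- The inverse transform is a forward transform between two conjugations, up to the factor M. For
i, k < m and M ≥ 2m the differences k-i modulo M are distinct and fall into the first or last m
places of a period, where `chirpSeq` is the chirp of |k-i|; so the cyclic convolution does not mix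
anything up, and `chirp_mul` finishes the proof. -/
theorem cyclicDft_eq_convolution {m M : ℕ} {ω : ℂ} (hω : IsPrimitiveRoot ω M) (hω1 : ‖ω‖ = 1)
    (hm : 0 < m) (hM : 2 * m ≤ M) (a : ℕ → ℂ) {U V Z : ℕ → ℂ}
    (hU : ∀ l, U l = ∑ q ∈ Finset.range M, chirpData m a q * ω ^ (q * l))
    (hV : ∀ l, V l = ∑ q ∈ Finset.range M, chirpSeq m M q * ω ^ (q * l))
    (hZ : ∀ k, Z k = ∑ l ∈ Finset.range M, (starRingEnd ℂ) (U l * V l) * ω ^ (l * k))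
    {k : ℕ} (hk : k < m) :
    (starRingEnd ℂ) (chirp m k * Z k) / M = cyclicDft m a k := by
  have hM0 : (M : ℂ) ≠ 0 := by
    have : M ≠ 0 := by omega
    exact_mod_cast this
  have h1 : (starRingEnd ℂ) (Z k) = ∑ i ∈ Finset.range M, ∑ j ∈ Finset.range M,
      chirpData m a i * chirpSeq m M j * if i + j ≡ k [MOD M] then (M : ℂ) else 0 := by
    simp only [← sum_root_pow (show 0 < M by omega) hω hω1, Finset.mul_sum]
    rw [hZ, map_sum]
    have h2 : ∀ l, (starRingEnd ℂ) ((starRingEnd ℂ) (U l * V l) * ω ^ (l * k)) =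
        ∑ i ∈ Finset.range M, ∑ j ∈ Finset.range M, chirpData m a i * chirpSeq m M j *
          (ω ^ (i * l) * ω ^ (j * l) * (starRingEnd ℂ) (ω ^ (l * k))) := by
      intro l
      rw [map_mul, Complex.conj_conj, hU, hV, Finset.sum_mul_sum, Finset.sum_mul]
      refine Finset.sum_congr rfl fun i _ => ?_
      rw [Finset.sum_mul]
      refine Finset.sum_congr rfl fun j _ => ?_
      ring
    simp only [h2]
    rw [Finset.sum_comm]
    refine Finset.sum_congr rfl fun i _ => ?_
    rw [Finset.sum_comm]
  have h3 : ∀ i < M, ∑ j ∈ Finset.range M, (chirpData m a i * chirpSeq m M j *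
      if i + j ≡ k [MOD M] then (M : ℂ) else 0) =
      chirpData m a i * chirpSeq m M ((k + (M - i)) % M) * M := by
    intro i hi
    -- The only j < M with i + j ≡ k modulo M.
    rw [Finset.sum_eq_single ((k + (M - i)) % M)]
    · rw [if_pos]
      have : i + (k + (M - i)) = k + M := by omega
      calc i + (k + (M - i)) % M ≡ i + (k + (M - i)) [MOD M] :=
            Nat.ModEq.add_left _ (Nat.mod_modEq _ _)
        _ = k + M := this
        _ ≡ k [MOD M] := by simp [Nat.ModEq]
    · intro j hj hne
      rw [if_neg, mul_zero]
      intro h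
      apply hne
      have hj' := Finset.mem_range.1 hj
      have h4 : j + M ≡ k + (M - i) [MOD M] := by
        have := h.add_right (M - i)
        rwa [show i + j + (M - i) = j + M by omega] at this
      have h5 : j ≡ k + (M - i) [MOD M] := by
        refine Nat.ModEq.trans ?_ h4
        simp [Nat.ModEq]
      rw [Nat.ModEq, Nat.mod_eq_of_lt hj'] at h5
      exact h5
    · intro h
      exact absurd (Finset.mem_range.2 (Nat.mod_lt _ (by omega))) h
  rw [map_mul, h1, Finset.sum_congr rfl fun i hi => h3 i (Finset.mem_range.1 hi),
    ← Finset.sum_subset (Finset.range_subset_range.2 (show m ≤ M by omega)) (fun i _ hi => by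
      simp at hi; simp [chirpData, hi]), cyclicDft, Finset.mul_sum, Finset.sum_div]
  refine Finset.sum_congr rfl fun i hi => ?_
  have hi' := Finset.mem_range.1 hi
  -- If i ≤ k the index is k - i < m; otherwise it is M - (i-k), which is at least m because M ≥ 2m,
  -- and `chirpSeq` reflects it to i - k.
  have key : chirpSeq m M ((k + (M - i)) % M) = chirp m (if i ≤ k then k - i else i - k) := by
    unfold chirpSeq
    split_ifs with h4 h5 h5
    · rw [show k + (M - i) = (k - i) + M by omega, Nat.add_mod_right, Nat.mod_eq_of_lt (by omega)]
    · rw [Nat.mod_eq_of_lt (by omega)] at h4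
      omega
    · rw [show k + (M - i) = (k - i) + M by omega, Nat.add_mod_right,
        Nat.mod_eq_of_lt (by omega)] at h4
      omega
    · rw [Nat.mod_eq_of_lt (by omega)]
      congr 1; omega
  rw [← chirp_mul hm (d := if i ≤ k then k - i else i - k) (by split_ifs <;> omega), key, chirpData,
    if_pos hi']
  field_simp

/-! ### Bluestein's algorithm as a program -/

namespace CpxProgram

variable {B D : ℕ} {A : CpxState}

/-- Assigns values to entries of the array `k`; the number of entries is in the natural register
`b`. -/
def fillArr (k b : ℕ) (i : NatExpr) (x : CpxExpr) : CpxProgram :=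
  forLoop 14 b (.seq (.setCpx 0 x) (.store k i 0))

/-- Injectivity of f protects entries that are already written. In `hx` the entries not yet reached
still have their old values, so x may read the array that is being filled; the pointwise product in
`bluestein` does so. -/
theorem fillArr_spec {k b n : ℕ} {i : NatExpr} {x : CpxExpr} (f : ℕ → ℕ) (g : ℕ → ℂ) {e G : ℝ}
    (hk : k < 8) (hb : b ≠ 14) (h0 : A.nat 0 = B) (h1 : A.nat 1 = D) (hD : 0 < D)
    (hn : A.nat b = n) (hnD : n ≤ D ^ 2) (hf : ∀ j < n, ∀ l < n, f j = f l → j = l)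
    (hg : ∀ j < n, ‖g j‖ ≤ G) (hGD : G + e + 1 ≤ D)
    (hx : ∀ j < n, ∀ A' : CpxState, (fillArr k b i x).Frame A A' → A'.nat 14 = j →
      (∀ l, (∀ j' < j, f j' ≠ l) → A'.arr k l = A.arr k l) →
      x.Ok B A' ∧ i.Ok A'.nat ∧ i.eval A'.nat = f j ∧ ‖x.eval A' - g j‖ ≤ e) :
    Runs B D (fillArr k b i x) A (n * 4 + 2) fun A' =>
      (∀ j < n, ‖A'.arr k (f j) - g j‖ ≤ e + 2 / D) ∧
      ∀ l, (∀ j < n, f j ≠ l) → A'.arr k l = A.arr k l := by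
  refine Runs.forLoop (fun c A' => (∀ j < c, ‖A'.arr k (f j) - g j‖ ≤ e + 2 / D) ∧
      ∀ l, (∀ j < c, f j ≠ l) → A'.arr k l = A.arr k l) 2 hn hnD hb rfl rfl ⟨by simp, by simp⟩ ?_
  rintro j hj A' hF h14 ⟨hI1, hI2⟩
  have hA0 : A'.nat 0 = B := (hF.nat 0 rfl).trans h0
  have hA1 : A'.nat 1 = D := (hF.nat 1 rfl).trans h1
  obtain ⟨o1, o2, o3, o4⟩ := hx j hj A' hF h14 hI2
  refine Runs.seq (T₁ := 1) (T₂ := 1) (Runs.setCpx hA1 o1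
    (by linarith [norm_le_of_norm_sub_le o4 (hg j hj)])
    (Q := fun A'' => A'' = A'.setCpx 0 (gridRound D (x.eval A'))) rfl) le_rfl ?_
  rintro _ - rfl
  refine Runs.store (f j) o3 hk o2 hA0 ⟨fun l hl => ?_, fun l hl => ?_⟩
  · simp only [CpxState.setNat_arr, CpxState.setArr_arr_same]
    split_ifs with h
    · have : l = j := hf l (by omega) j hj h
      subst this
      simpa using norm_gridRound_sub_le_add hD o4
    · refine hI1 l ?_
      rcases Nat.lt_succ_iff_lt_or_eq.1 hl with h' | h'
      · exact h'
      · subst h'; exact absurd rfl h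
  · simp only [CpxState.setNat_arr, CpxState.setArr_arr_same]
    rw [if_neg (fun h => hl j (by omega) h.symm)]
    exact hI2 l fun j' hj' => hl j' (by omega)

end CpxProgram

namespace CpxProgram

variable {B D : ℕ} {A : CpxState}

theorem norm_sum_mul_pow_le {M : ℕ} {ω : ℂ} (hω1 : ‖ω‖ = 1) {f : ℕ → ℂ} {Y : ℝ}
    (hf : ∀ i < M, ‖f i‖ ≤ Y) (l : ℕ) : ‖∑ q ∈ Finset.range M, f q * ω ^ (q * l)‖ ≤ M * Y := by
  refine (norm_sum_le _ _).trans ((Finset.sum_le_card_nsmul _ _ Y fun q hq => ?_).trans ?_)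
  · rw [norm_mul, norm_pow, hω1, one_pow, mul_one]
    exact hf q (Finset.mem_range.1 hq)
  · simp

theorem norm_cyclicDft_le {m : ℕ} {a : ℕ → ℂ} {Y : ℝ} (ha : ∀ i < m, ‖a i‖ ≤ Y) (k : ℕ) :
    ‖cyclicDft m a k‖ ≤ m * Y := by
  refine (norm_sum_le _ _).trans ((Finset.sum_le_card_nsmul _ _ Y fun q hq => ?_).trans ?_)
  · rw [norm_mul]
    have : (-(2 * Real.pi * (((q * k : ℕ) : ℂ) / m) * Complex.I)) =
      ((-(2 * Real.pi * ((q * k : ℕ) / m)) : ℝ) : ℂ) * Complex.I := by push_cast; ring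
    rw [this, Complex.norm_exp_ofReal_mul_I, mul_one]
    exact ha q (Finset.mem_range.1 hq)
  · simp

theorem norm_chirpData_le {m : ℕ} {a : ℕ → ℂ} {Y : ℝ} (hY : 0 ≤ Y) (ha : ∀ i < m, ‖a i‖ ≤ Y)
    (i : ℕ) : ‖chirpData m a i‖ ≤ Y := by
  unfold chirpData
  split_ifs with h
  · rw [norm_mul, RCLike.norm_conj, norm_chirp, mul_one]
    exact ha i h
  · simpa using hY

/-- The cyclic Fourier transform of a part of the array `2`, with results in the array `0`. -/
def bluestein : CpxProgram :=
  .seq (fillArr 3 8 (.reg 14) (.ofNat (.lit 0)))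
    (.seq (fillArr 3 7 (.reg 14) (.mul (.load 2 (.add (.reg 14) (.mul (.reg 7) (.reg 11))))
      (.conj (.load 7 (.reg 14)))))
    (.seq (fft 3)
    (.seq (fillArr 3 8 (.reg 14) (.conj (.mul (.load 3 (.reg 14)) (.load 4 (.reg 14)))))
    (.seq (fft 3)
    (fillArr 0 7 (.add (.reg 11) (.mul (.reg 10) (.reg 14)))
      (.divNat (.conj (.mul (.load 7 (.reg 14)) (.load 3 (.reg 14)))) (.reg 8)))))))

/-- Bounds for the errors in order: 4e for the data times the chirp, 4M⁴e after the first transform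
(M³ times the enlarged 4Me), 10M⁵e after the multiplication by the transformed chirp, 10M⁸e after
the second transform, and 21M⁸e for the final product, before rounding. Since M ≥ 4, the rounded
result is within M^11 e. `hbig` keeps all intermediate values, which are multiples of at most
M⁸(Y+e), below D. -/
theorem bluestein_spec {m M r c l : ℕ} {ω : ℂ} {a : ℕ → ℂ} {Y e μ : ℝ} (h0 : A.nat 0 = B)
    (h1 : A.nat 1 = D) (h7 : A.nat 7 = m) (h8 : A.nat 8 = M) (h9 : A.nat 9 = r)
    (h10 : A.nat 10 = l) (h11 : A.nat 11 = c) (hl : 0 < l) (hm : 2 ≤ m) (hmM : 2 * m ≤ M)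
    (hM : M = 2 ^ r) (hω : IsPrimitiveRoot ω M) (hω1 : ‖ω‖ = 1)
    (ha : ∀ j < m, ‖a j‖ ≤ Y) (hY : 1 ≤ Y) (hμD : 2 / D ≤ μ) (hμe : Y * μ ≤ e)
    (hμM : M ^ 4 * μ ≤ 1) (hbig : 100 * (M ^ 8 * (Y + e)) ≤ D)
    (h2 : ∀ j < m, ‖A.arr 2 (j + m * c) - a j‖ ≤ e)
    (harr7 : ∀ j < m, ‖A.arr 7 j - chirp m j‖ ≤ μ)
    (h4 : ∀ j < M, ‖A.arr 4 j - ∑ q ∈ Finset.range M, chirpSeq m M q * ω ^ (q * j)‖ ≤ M ^ 4 * μ)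
    (h6 : ∀ j < M, ‖A.arr 6 j - ω ^ j‖ ≤ μ) :
    Runs B D bluestein A (8 * M + 8 * m + 2 * (r * (10 * M + 7)) + 14) fun A' =>
      (∀ k < m, ‖A'.arr 0 (c + l * k) - cyclicDft m a k‖ ≤ M ^ 11 * e) ∧
      ∀ j, (∀ k < m, c + l * k ≠ j) → A'.arr 0 j = A.arr 0 j := by
  have hM4 : (4 : ℝ) ≤ M := by
    have : 4 ≤ M := by omega
    exact_mod_cast this
  have hmMr : (m : ℝ) ≤ M := by
    have : m ≤ M := by omega
    exact_mod_cast this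
  have hM1 : (1 : ℝ) ≤ M := by linarith
  have pw : ∀ {k j : ℕ} {y : ℝ}, k ≤ j → 0 ≤ y → (M : ℝ) ^ k * y ≤ M ^ j * y := fun hkj hy =>
    mul_le_mul_of_nonneg_right (pow_le_pow_right₀ hM1 hkj) hy
  have hY0 : 0 ≤ Y := by linarith
  have hμ0 : 0 ≤ μ := le_trans (by positivity) hμD
  have hμe' : μ ≤ e := (le_mul_of_one_le_left hμ0 hY).trans hμe
  have he : 0 ≤ e := hμ0.trans hμe'
  have hμ1 : μ ≤ 1 := (le_mul_of_one_le_left hμ0 (one_le_pow₀ hM1)).trans hμM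
  have q1 : 1 ≤ (M : ℝ) ^ 8 * Y := one_le_mul_of_one_le_of_one_le (one_le_pow₀ hM1) hY
  rw [mul_add] at hbig
  have qY : ∀ k ≤ 8, (M : ℝ) ^ k * Y ≤ M ^ 8 * Y := fun k hk => pw hk hY0
  have qe : ∀ k ≤ 8, (M : ℝ) ^ k * e ≤ M ^ 8 * e := fun k hk => pw hk he
  have e0 : 0 ≤ (M : ℝ) ^ 8 * e := by positivity
  have hY8 : Y ≤ M ^ 8 * Y := by simpa using qY 0 (by norm_num)
  have he8 : e ≤ M ^ 8 * e := by simpa using qe 0 (by norm_num)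
  have hMD' : (M : ℝ) ≤ M ^ 8 * Y := by
    have := qY 1 (by norm_num)
    rw [pow_one] at this
    exact (le_mul_of_one_le_right (by linarith) hY).trans this
  have hMD : 2 * M ≤ D := by
    have : 2 * (M : ℝ) ≤ D := by linarith
    exact_mod_cast this
  have hD : 0 < D := by omega
  have hDD : D ≤ D ^ 2 := Nat.le_self_pow (by norm_num) D
  have hD0 : (0 : ℝ) < D := by exact_mod_cast hD
  have h2D : (2 : ℝ) / D ≤ e := hμD.trans hμe'
  -- clearing
  refine Runs.seq (fillArr_spec (B := B) (D := D) (A := A) (n := M) id (fun _ => 0) (e := 0)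
    (G := 0) (by norm_num) (by norm_num) h0 h1 hD h8 (by omega) (fun _ _ _ _ h => h) (by simp)
    (by linarith) (fun j _ A' _ h14 _ => ⟨trivial, trivial, by simp [NatExpr.eval, h14],
      by simp [CpxExpr.eval, NatExpr.eval]⟩))
    (T₂ := 4 * M + 8 * m + 2 * (r * (10 * M + 7)) + 12) (by omega) ?_
  rintro A₁ hF₁ ⟨hz, -⟩
  -- data
  have hd := fillArr_spec (B := B) (D := D) (A := A₁) (k := 3) (b := 7) (i := .reg 14)
    (x := .mul (.load 2 (.add (.reg 14) (.mul (.reg 7) (.reg 11)))) (.conj (.load 7 (.reg 14))))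
    (n := m) id (chirpData m a) (e := 3 * e)
    (G := Y) (by norm_num) (by norm_num) ((hF₁.nat 0 rfl).trans h0) ((hF₁.nat 1 rfl).trans h1) hD
    ((hF₁.nat 7 rfl).trans h7) (by omega) (fun _ _ _ _ h => h)
    (fun j _ => norm_chirpData_le hY0 ha j) (by linarith) (fun j hj A' hF' h14 _ => by
      have b0 : A'.nat 0 = B := (hF'.nat 0 rfl).trans ((hF₁.nat 0 rfl).trans h0)
      have b7 : A'.nat 7 = m := (hF'.nat 7 rfl).trans ((hF₁.nat 7 rfl).trans h7)
      have b11 : A'.nat 11 = c := (hF'.nat 11 rfl).trans ((hF₁.nat 11 rfl).trans h11)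
      have c2 : A'.arr 2 = A.arr 2 := (hF'.arr 2 rfl).trans (hF₁.arr 2 rfl)
      have c7 : A'.arr 7 = A.arr 7 := (hF'.arr 7 rfl).trans (hF₁.arr 7 rfl)
      refine ⟨⟨⟨by norm_num, ⟨trivial, trivial, trivial⟩, b0⟩, ⟨by norm_num, trivial, b0⟩⟩, trivial,
        by simp [NatExpr.eval, h14], ?_⟩
      simp only [CpxExpr.eval, NatExpr.eval, h14, b7, b11, c2, c7, chirpData, if_pos hj]
      have n1 : ‖(starRingEnd ℂ) (A.arr 7 j)‖ ≤ 2 := by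
        rw [RCLike.norm_conj]
        exact (norm_le_of_norm_sub_le (harr7 j hj) (norm_chirp j).le).trans (by linarith)
      have n2 : ‖(starRingEnd ℂ) (A.arr 7 j) - (starRingEnd ℂ) (chirp m j)‖ ≤ μ := by
        rw [← map_sub, RCLike.norm_conj]; exact harr7 j hj
      have := norm_mul_sub_mul_le n1 (ha j hj) (h2 j hj) n2
      linarith)
  refine Runs.seq hd (T₂ := 4 * M + 4 * m + 2 * (r * (10 * M + 7)) + 10) (by omega) ?_
  rintro A₂ hF₂ ⟨hu, hu'⟩
  -- The error is really at most 4e; the additional factor M serves the condition M·Y·μ ≤ e of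
  -- `fft_spec`.
  have harr : ∀ i < M, ‖A₂.arr 3 i - chirpData m a i‖ ≤ 4 * M * e := by
    intro i hi
    have hMe : e ≤ M * e := le_mul_of_one_le_left he hM1
    by_cases him : i < m
    · have := hu i him
      simp only [id] at this
      linarith
    · rw [hu' i (fun j hj => by simp only [id]; omega)]
      have := hz i hi
      simp only [id] at this
      rw [chirpData, if_neg him]
      linarith
  -- transform
  have hμMY : M * Y * μ ≤ 4 * M * e := by
    have : (M : ℝ) * (Y * μ) ≤ M * e := by gcongr
    have : 0 ≤ (M : ℝ) * e := by positivity
    nlinarith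
  have c6 : A₂.arr 6 = A.arr 6 := (hF₂.arr 6 rfl).trans (hF₁.arr 6 rfl)
  have hfft₁ := fft_spec (B := B) (D := D) (A := A₂) (a := 3) (M := M) (r := r) (ω := ω)
    (x := chirpData m a) (Y := Y) (e := 4 * M * e) (μ := μ) (by norm_num) (by norm_num)
    (by norm_num) ((hF₂.nat 0 rfl).trans ((hF₁.nat 0 rfl).trans h0))
    ((hF₂.nat 1 rfl).trans ((hF₁.nat 1 rfl).trans h1))
    ((hF₂.nat 8 rfl).trans ((hF₁.nat 8 rfl).trans h8))
    ((hF₂.nat 9 rfl).trans ((hF₁.nat 9 rfl).trans h9)) hM hω.pow_eq_one hω1 hD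
    (fun i _ => norm_chirpData_le hY0 ha i) hY0 harr (by rw [c6]; exact h6) hμ1 hμMY
    (by have : e ≤ M * e := le_mul_of_one_le_left he hM1
        linarith)
    (by have t1 := qY 1 (by norm_num)
        have t2 := qe 4 (by norm_num)
        have t3 : (M : ℝ) ^ 3 * (4 * M * e) = 4 * (M ^ 4 * e) := by ring
        rw [t3]; rw [pow_one] at t1; linarith) (by omega)
  refine Runs.seq hfft₁ (T₂ := 4 * M + 4 * m + r * (10 * M + 7) + 7) (by omega) ?_
  rintro A₃ hF₃ hU
  have d0 : A₃.nat 0 = B := (hF₃.nat 0 rfl).trans ((hF₂.nat 0 rfl).trans ((hF₁.nat 0 rfl).trans h0))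
  have d1 : A₃.nat 1 = D := (hF₃.nat 1 rfl).trans ((hF₂.nat 1 rfl).trans ((hF₁.nat 1 rfl).trans h1))
  have d7 : A₃.nat 7 = m := (hF₃.nat 7 rfl).trans ((hF₂.nat 7 rfl).trans ((hF₁.nat 7 rfl).trans h7))
  have d8 : A₃.nat 8 = M := (hF₃.nat 8 rfl).trans ((hF₂.nat 8 rfl).trans ((hF₁.nat 8 rfl).trans h8))
  have d9 : A₃.nat 9 = r := (hF₃.nat 9 rfl).trans ((hF₂.nat 9 rfl).trans ((hF₁.nat 9 rfl).trans h9))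
  have d10 : A₃.nat 10 = l :=
    (hF₃.nat 10 rfl).trans ((hF₂.nat 10 rfl).trans ((hF₁.nat 10 rfl).trans h10))
  have d11 : A₃.nat 11 = c :=
    (hF₃.nat 11 rfl).trans ((hF₂.nat 11 rfl).trans ((hF₁.nat 11 rfl).trans h11))
  have c4 : A₃.arr 4 = A.arr 4 := (hF₃.arr 4 rfl).trans ((hF₂.arr 4 rfl).trans (hF₁.arr 4 rfl))
  have c6' : A₃.arr 6 = A.arr 6 := (hF₃.arr 6 rfl).trans c6
  have c7 : A₃.arr 7 = A.arr 7 := (hF₃.arr 7 rfl).trans ((hF₂.arr 7 rfl).trans (hF₁.arr 7 rfl))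
  have c0 : A₃.arr 0 = A.arr 0 := (hF₃.arr 0 rfl).trans ((hF₂.arr 0 rfl).trans (hF₁.arr 0 rfl))
  clear hF₁ hF₂ hF₃ hz hu hu' harr hd hfft₁ c6
  set U : ℕ → ℂ := fun k => ∑ q ∈ Finset.range M, chirpData m a q * ω ^ (q * k) with hUd
  set V : ℕ → ℂ := fun k => ∑ q ∈ Finset.range M, chirpSeq m M q * ω ^ (q * k) with hVd
  have hUn : ∀ k, ‖U k‖ ≤ M * Y := norm_sum_mul_pow_le hω1 fun i _ => norm_chirpData_le hY0 ha i
  have hVn : ∀ k, ‖V k‖ ≤ M := fun k => by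
    simpa using norm_sum_mul_pow_le (Y := 1) hω1 (fun i _ => (norm_chirpSeq m M i).le) k
  have hPn : ∀ k, ‖(starRingEnd ℂ) (U k * V k)‖ ≤ M ^ 2 * Y := fun k => by
    rw [RCLike.norm_conj, norm_mul]
    calc ‖U k‖ * ‖V k‖ ≤ (M * Y) * M := by gcongr; exacts [hUn k, hVn k]
      _ = _ := by ring
  -- product
  have hp := fillArr_spec (B := B) (D := D) (A := A₃) (k := 3) (b := 8) (i := .reg 14)
    (x := .conj (.mul (.load 3 (.reg 14)) (.load 4 (.reg 14))))
    (n := M) id (fun k => (starRingEnd ℂ) (U k * V k)) (e := 9 * M ^ 5 * e)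
    (G := M ^ 2 * Y) (by norm_num) (by norm_num) d0 d1 hD
    d8 (by omega) (fun _ _ _ _ h => h)
    (fun j _ => hPn j) (by
      have t1 := qY 2 (by norm_num)
      have t2 := qe 5 (by norm_num)
      rw [mul_assoc]; linarith) (fun j hj A' hF' h14 hun => by
      have b0 : A'.nat 0 = B := (hF'.nat 0 rfl).trans d0
      have c4 : A'.arr 4 = A.arr 4 := (hF'.arr 4 rfl).trans c4
      refine ⟨⟨⟨by norm_num, trivial, b0⟩, ⟨by norm_num, trivial, b0⟩⟩, trivial,
        by simp [NatExpr.eval, h14], ?_⟩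
      simp only [CpxExpr.eval, NatExpr.eval, h14, c4,
        hun j (fun j' hj' => by simp only [id]; omega)]
      rw [← map_sub, RCLike.norm_conj]
      have n1 : ‖A.arr 4 j‖ ≤ 2 * M := (norm_le_of_norm_sub_le (h4 j hj) (hVn j)).trans (by linarith)
      have := norm_mul_sub_mul_le n1 (hUn j) (hU j hj) (h4 j hj)
      refine this.trans ?_
      have t1 : (M : ℝ) ^ 3 * (4 * M * e) * (2 * M) + M * Y * (M ^ 4 * μ) =
        8 * (M ^ 5 * e) + M ^ 5 * (Y * μ) := by ring
      rw [t1]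
      have t2 : (M : ℝ) ^ 5 * (Y * μ) ≤ M ^ 5 * e := by gcongr
      linarith)
  refine Runs.seq hp (T₂ := 4 * m + r * (10 * M + 7) + 5) (by omega) ?_
  rintro A₄ hF₄ ⟨hP, -⟩
  have m5 : e ≤ M ^ 5 * e := le_mul_of_one_le_left he (one_le_pow₀ hM1)
  have harr : ∀ i < M, ‖A₄.arr 3 i - (starRingEnd ℂ) (U i * V i)‖ ≤ 10 * M ^ 5 * e := by
    intro i hi
    have := hP i hi
    simp only [id] at this
    rw [mul_assoc] at this ⊢
    linarith
  have hfft₂ := fft_spec (B := B) (D := D) (A := A₄) (a := 3) (M := M) (r := r) (ω := ω)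
    (x := fun k => (starRingEnd ℂ) (U k * V k)) (Y := M ^ 2 * Y) (e := 10 * M ^ 5 * e) (μ := μ)
    (by norm_num) (by norm_num)
    (by norm_num) ((hF₄.nat 0 rfl).trans d0) ((hF₄.nat 1 rfl).trans d1)
    ((hF₄.nat 8 rfl).trans d8) ((hF₄.nat 9 rfl).trans d9) hM hω.pow_eq_one hω1 hD
    (fun i _ => hPn i) (by positivity) harr (by rw [hF₄.arr 6 rfl, c6']; exact h6) hμ1
    (by have t1 : (M : ℝ) * (M ^ 2 * Y) * μ = M ^ 3 * (Y * μ) := by ring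
        have t2 : (M : ℝ) ^ 3 * (Y * μ) ≤ M ^ 3 * e := by gcongr
        have t3 : (M : ℝ) ^ 3 * e ≤ M ^ 5 * e := pw (by norm_num) he
        rw [t1, mul_assoc]; linarith)
    (by rw [mul_assoc]; linarith)
    (by have t1 := qY 3 (by norm_num)
        have t3 : (M : ℝ) ^ 3 * (10 * M ^ 5 * e) = 10 * (M ^ 8 * e) := by ring
        have t4 : (M : ℝ) * (M ^ 2 * Y) = M ^ 3 * Y := by ring
        rw [t3, t4]; linarith) (by omega)
  refine Runs.seq hfft₂ (T₂ := 4 * m + 2) (by omega) ?_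
  rintro A₅ hF₅ hZ
  set Z : ℕ → ℂ := fun k => ∑ q ∈ Finset.range M, (starRingEnd ℂ) (U q * V q) * ω ^ (q * k) with hZd
  have hZn : ∀ k, ‖Z k‖ ≤ M ^ 3 * Y := fun k => by
    refine (norm_sum_mul_pow_le hω1 (fun i _ => hPn i) k).trans (le_of_eq (by ring))
  have hout := fillArr_spec (B := B) (D := D) (A := A₅) (k := 0) (b := 7)
    (i := .add (.reg 11) (.mul (.reg 10) (.reg 14)))
    (x := .divNat (.conj (.mul (.load 7 (.reg 14)) (.load 3 (.reg 14)))) (.reg 8))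
    (n := m) (fun k => c + l * k) (cyclicDft m a) (e := 21 * M ^ 8 * e)
    (G := M * Y) (by norm_num) (by norm_num) ((hF₅.nat 0 rfl).trans ((hF₄.nat 0 rfl).trans d0))
    ((hF₅.nat 1 rfl).trans ((hF₄.nat 1 rfl).trans d1)) hD
    ((hF₅.nat 7 rfl).trans ((hF₄.nat 7 rfl).trans d7)) (by omega)
    (fun i _ j _ h => by
      have : l * i = l * j := by omega
      exact Nat.eq_of_mul_eq_mul_left hl this)
    (fun j _ => (norm_cyclicDft_le ha j).trans (by gcongr))
    (by have t1 := qY 1 (by norm_num)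
        rw [pow_one] at t1
        rw [mul_assoc 21]; linarith) (fun j hj A' hF' h14 _ => by
      have b0 : A'.nat 0 = B :=
        (hF'.nat 0 rfl).trans ((hF₅.nat 0 rfl).trans ((hF₄.nat 0 rfl).trans d0))
      have b8 : A'.nat 8 = M :=
        (hF'.nat 8 rfl).trans ((hF₅.nat 8 rfl).trans ((hF₄.nat 8 rfl).trans d8))
      have b10 : A'.nat 10 = l :=
        (hF'.nat 10 rfl).trans ((hF₅.nat 10 rfl).trans ((hF₄.nat 10 rfl).trans d10))
      have b11 : A'.nat 11 = c :=
        (hF'.nat 11 rfl).trans ((hF₅.nat 11 rfl).trans ((hF₄.nat 11 rfl).trans d11))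
      have c3 : A'.arr 3 = A₅.arr 3 := hF'.arr 3 rfl
      have c7 : A'.arr 7 = A.arr 7 :=
        (hF'.arr 7 rfl).trans ((hF₅.arr 7 rfl).trans ((hF₄.arr 7 rfl).trans c7))
      refine ⟨⟨⟨⟨by norm_num, trivial, b0⟩, ⟨by norm_num, trivial, b0⟩⟩, trivial,
        by simp [NatExpr.eval, b8]; omega⟩, ⟨trivial, trivial, trivial⟩,
        by simp [NatExpr.eval, h14, b10, b11], ?_⟩
      simp only [CpxExpr.eval, NatExpr.eval, h14, c3, c7, b8]
      rw [← cyclicDft_eq_convolution hω hω1 (by omega) hmM a (U := U) (V := V) (Z := Z)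
        (fun _ => rfl) (fun _ => rfl) (fun _ => rfl) hj, ← sub_div, ← map_sub, norm_div,
        RCLike.norm_conj, Complex.norm_natCast]
      -- The division by M would reduce the error, but the estimate does not need that.
      refine (div_le_self (norm_nonneg _) hM1).trans ?_
      have hZj := hZ j (by omega)
      have n1 : ‖A₅.arr 3 j‖ ≤ M ^ 3 * Y + M ^ 3 * (10 * M ^ 5 * e) :=
        norm_le_of_norm_sub_le hZj (hZn j)
      refine (norm_mul_sub_mul_le n1 (norm_chirp j).le (harr7 j hj) hZj).trans ?_
      have t1 : μ * ((M : ℝ) ^ 3 * Y + M ^ 3 * (10 * M ^ 5 * e)) + 1 * (M ^ 3 * (10 * M ^ 5 * e)) =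
        M ^ 3 * (Y * μ) + 10 * (μ * (M ^ 8 * e)) + 10 * (M ^ 8 * e) := by ring
      have t2 : (M : ℝ) ^ 3 * (Y * μ) ≤ M ^ 3 * e := by gcongr
      have t3 := qe 3 (by norm_num)
      have t4 : μ * ((M : ℝ) ^ 8 * e) ≤ M ^ 8 * e := mul_le_of_le_one_left e0 hμ1
      rw [t1, mul_assoc]
      linarith)
  refine hout.mono (by omega) ?_
  rintro A₆ _ ⟨hr1, hr2⟩
  refine ⟨fun k hk => (hr1 k hk).trans ?_, fun j hj => ?_⟩
  · have t1 : (M : ℝ) ^ 11 * e = M ^ 3 * (M ^ 8 * e) := by ring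
    have t2 : (64 : ℝ) ≤ M ^ 3 := by
      calc (64 : ℝ) = 4 ^ 3 := by norm_num
        _ ≤ M ^ 3 := by gcongr
    rw [t1, mul_assoc]
    nlinarith
  · rw [hr2 j hj, hF₅.arr 0 rfl, hF₄.arr 0 rfl, c0]

end CpxProgram

/-! ### Tables of roots of unity and chirps, and the pass for one coordinate -/

namespace CpxProgram

variable {B D N : ℕ} {A : CpxState}

/-- The least power of two that is at least twice the natural register `7`, and its exponent. -/
def transformLength : CpxProgram :=
  .seq (.setNat 8 (.lit 1)) (.seq (.setNat 9 (.lit 0))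
    (.loop (.reg 8) (.mul (.lit 2) (.reg 7))
      (.seq (.setNat 8 (.mul (.lit 2) (.reg 8))) (.setNat 9 (.add (.reg 9) (.lit 1))))))

theorem transformLength_spec {m : ℕ} (h7 : A.nat 7 = m) (hD : 0 < D) (hm : 4 * m ≤ D) :
    Runs B D transformLength A (3 * Nat.clog 2 (2 * m) + 3) fun A' =>
      A'.nat 8 = 2 ^ Nat.clog 2 (2 * m) ∧ A'.nat 9 = Nat.clog 2 (2 * m) := by
  set r := Nat.clog 2 (2 * m) with hr
  have hD2 : D ≤ D ^ 2 := Nat.le_self_pow (by norm_num) D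
  refine Runs.seq (T₁ := 1) (T₂ := 3 * r + 2) (Runs.setNat 1 rfl trivial (by omega)
    (Q := fun A'' => A'' = A.setNat 8 1) rfl) (by omega) ?_
  rintro _ - rfl
  refine Runs.seq (T₁ := 1) (T₂ := 3 * r + 1) (Runs.setNat 0 rfl trivial (by omega)
    (Q := fun A'' => A'' = (A.setNat 8 1).setNat 9 0) rfl) (by omega) ?_
  rintro _ - rfl
  refine (Runs.loop (fun k A' => A'.nat 8 = 2 ^ k ∧ A'.nat 9 = k) r (fun _ => 2) (by simp)
    ?_ ?_).mono (by simp; omega) fun A' _ h => h.2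
  · rintro k hk A' hF ⟨h8, h9⟩
    have h7' : A'.nat 7 = m := (hF.nat 7 rfl).trans (by simp [h7])
    have hlt : 2 ^ k < 2 * m := (Nat.lt_clog_iff_pow_lt (by norm_num)).1 hk
    refine ⟨trivial, ⟨trivial, trivial⟩, by simpa [NatExpr.eval, h8, h7'] using hlt, ?_⟩
    refine Runs.seq (T₁ := 1) (T₂ := 1) (Runs.setNat (2 ^ (k + 1))
      (by simp [NatExpr.eval, h8, pow_succ']) ⟨trivial, trivial⟩ (by rw [pow_succ]; omega)
      (Q := fun A'' => A'' = A'.setNat 8 (2 ^ (k + 1))) rfl) le_rfl ?_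
    rintro _ - rfl
    refine Runs.setNat (k + 1) (by simp [NatExpr.eval, h9]) ⟨trivial, trivial⟩ ?_ (by simp)
    have := (k + 1).lt_two_pow_self
    rw [pow_succ] at this
    omega
  · rintro A' hF ⟨h8, h9⟩
    have h7' : A'.nat 7 = m := (hF.nat 7 rfl).trans (by simp [h7])
    refine ⟨trivial, ⟨trivial, trivial⟩, ?_⟩
    simpa [NatExpr.eval, h8, h7'] using Nat.le_pow_clog (by norm_num) (2 * m)

/-- Powers of a root of unity of order equal to the natural register `8`, in the array `6`. -/
def rootTable : CpxProgram :=
  forLoop 14 8 (.seq (expPiI (.mul (.lit 2) (.reg 14)) (.reg 8)) (.store 6 (.reg 14) 2))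

/-- Each power is evaluated on its own as exp(iπ·2j/M), so that errors do not accumulate along the
table. The O(N) operations per entry are affordable because the table is built once for a
coordinate, not once for each transform. -/
theorem rootTable_spec {M : ℕ} (h0 : A.nat 0 = B) (h1 : A.nat 1 = D) (h5 : A.nat 5 = N)
    (h8 : A.nat 8 = M) (hM : 0 < M) (hMD : M ≤ D ^ 2) (hD : 2 ^ 30 * (N + 1) ^ 2 ≤ D)
    (hDN : D ≤ 2 ^ N) (hpi : ‖A.cpx 3 - Real.pi‖ ≤ 2 ^ 24 * N ^ 2 / D) :
    Runs B D rootTable A (M * (N * 4 + 8) + 2) fun A' => ∀ j < M,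
      ‖A'.arr 6 j - Complex.exp (2 * Real.pi * Complex.I / M) ^ j‖ ≤ 2 ^ 27 * N ^ 2 / D := by
  refine Runs.forLoop (fun c A' => ∀ j < c,
    ‖A'.arr 6 j - Complex.exp (2 * Real.pi * Complex.I / M) ^ j‖ ≤ 2 ^ 27 * N ^ 2 / D)
    (N * 4 + 6) h8 hMD (by norm_num) rfl rfl (by simp) ?_
  intro j hj A' hF h14 hI
  have b0 : A'.nat 0 = B := (hF.nat 0 rfl).trans h0
  have b1 : A'.nat 1 = D := (hF.nat 1 rfl).trans h1
  have b5 : A'.nat 5 = N := (hF.nat 5 rfl).trans h5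
  have b8 : A'.nat 8 = M := (hF.nat 8 rfl).trans h8
  have c3 : A'.cpx 3 = A.cpx 3 := hF.cpx 3 rfl
  refine Runs.seq (T₁ := N * 4 + 5) (T₂ := 1) (expPiI_spec (α := 2 * j) (β := M) b1 b5 hD hDN
    (by rw [c3]; exact hpi) ⟨trivial, trivial⟩ trivial (by simp [NatExpr.eval, h14])
    (by simp [NatExpr.eval, b8]) hM (by omega)) (by omega) ?_
  intro A₂ hF₂ h2
  refine Runs.store j (by simp [NatExpr.eval, (hF₂.nat 14 rfl).trans h14]) (by norm_num) trivial
    ((hF₂.nat 0 rfl).trans b0) ?_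
  intro i hi
  simp only [CpxState.setNat_arr, CpxState.setArr_arr_same]
  split_ifs with h
  · subst h
    convert h2 using 3
    rw [← Complex.exp_nat_mul]
    congr 1
    push_cast
    ring
  · rw [hF₂.arr 6 rfl]
    exact hI i (by omega)

/-- Chirps of order equal to the natural register `7`, in the arrays `4` and `7`. -/
def chirpTable : CpxProgram :=
  forLoop 14 8 (.seq (.branch (.reg 14) (.reg 7) (.setNat 16 (.reg 14))
      (.setNat 16 (.sub (.reg 8) (.reg 14))))
    (.seq (expPiI (.mod (.mul (.reg 16) (.reg 16)) (.mul (.lit 2) (.reg 7))) (.reg 7))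
      (.seq (.store 7 (.reg 14) 2) (.store 4 (.reg 14) 2))))

theorem chirpTable_spec {m M : ℕ} (h0 : A.nat 0 = B) (h1 : A.nat 1 = D) (h5 : A.nat 5 = N)
    (h7 : A.nat 7 = m) (h8 : A.nat 8 = M) (hm : 0 < m) (hmM : m ≤ M) (hMD : M ≤ D ^ 2)
    (hD : 2 ^ 30 * (N + 1) ^ 2 ≤ D) (hDN : D ≤ 2 ^ N)
    (hpi : ‖A.cpx 3 - Real.pi‖ ≤ 2 ^ 24 * N ^ 2 / D) :
    Runs B D chirpTable A (M * (N * 4 + 11) + 2) fun A' =>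
      (∀ j < m, ‖A'.arr 7 j - chirp m j‖ ≤ 2 ^ 27 * N ^ 2 / D) ∧
      ∀ j < M, ‖A'.arr 4 j - chirpSeq m M j‖ ≤ 2 ^ 27 * N ^ 2 / D := by
  refine (Runs.forLoop (fun c A' =>
    (∀ j < c, ‖A'.arr 7 j - chirpSeq m M j‖ ≤ 2 ^ 27 * N ^ 2 / D) ∧
      ∀ j < c, ‖A'.arr 4 j - chirpSeq m M j‖ ≤ 2 ^ 27 * N ^ 2 / D)
    (N * 4 + 9) h8 hMD (by norm_num) rfl rfl (by simp) ?_).mono le_rfl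
    fun A' _ h => ⟨fun j hj => by
      simpa [chirpSeq_of_lt hj] using h.1 j (lt_of_lt_of_le hj hmM), h.2⟩
  intro j hj A' hF h14 hI
  have b0 : A'.nat 0 = B := (hF.nat 0 rfl).trans h0
  have b1 : A'.nat 1 = D := (hF.nat 1 rfl).trans h1
  have b5 : A'.nat 5 = N := (hF.nat 5 rfl).trans h5
  have b7 : A'.nat 7 = m := (hF.nat 7 rfl).trans h7
  have b8 : A'.nat 8 = M := (hF.nat 8 rfl).trans h8
  have c3 : A'.cpx 3 = A.cpx 3 := hF.cpx 3 rfl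
  set d := if j < m then j else M - j with hd
  refine Runs.seq (T₁ := 2) (T₂ := N * 4 + 7) (R := fun A'' => A'' = A'.setNat 16 d)
    (Runs.branch (T₁ := 1) trivial trivial
      (fun h => ?_) (fun h => ?_) le_rfl) (by omega) ?_
  · simp only [NatExpr.eval, h14, b7] at h
    exact Runs.setNat d (by simp [NatExpr.eval, h14, hd, h]) trivial (by rw [hd, if_pos h]; omega) rfl
  · simp only [NatExpr.eval, h14, b7] at h
    exact Runs.setNat d (by simp [NatExpr.eval, h14, b8, hd, h])
      ⟨trivial, trivial, by simp [NatExpr.eval, h14, b8]; omega⟩ (by rw [hd, if_neg h]; omega) rfl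
  rintro _ - rfl
  refine Runs.seq (T₁ := N * 4 + 5) (T₂ := 2) (expPiI_spec (α := d * d % (2 * m)) (β := m)
    (by simp [b1]) (by simp [b5]) hD hDN (by simpa [c3] using hpi)
    ⟨⟨trivial, trivial⟩, ⟨trivial, trivial⟩, by simp [NatExpr.eval, b7]; omega⟩ trivial
    (by simp [NatExpr.eval, b7])
    (by simp [NatExpr.eval, b7]) hm (Nat.mod_lt _ (by omega)).le) (by omega) ?_
  intro A₂ hF₂ h2
  have d0 : A₂.nat 0 = B := (hF₂.nat 0 rfl).trans (by simp [b0])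
  have d14 : A₂.nat 14 = j := (hF₂.nat 14 rfl).trans (by simp [h14])
  refine Runs.seq (T₁ := 1) (T₂ := 1) (Runs.store j (by simp [NatExpr.eval, d14])
    (by norm_num) trivial d0 (Q := fun A'' => A'' = A₂.setArr 7 j (A₂.cpx 2)) rfl) le_rfl ?_
  rintro _ - rfl
  refine Runs.store j (by simp [NatExpr.eval, d14]) (by norm_num) trivial (by simp [d0])
    ⟨fun i hi => ?_, fun i hi => ?_⟩
  · simp only [CpxState.setNat_arr]
    rw [CpxState.setArr_arr_of_ne _ _ _ _ (by norm_num), CpxState.setArr_arr_same]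
    split_ifs with h
    · subst h; exact h2
    · rw [hF₂.arr 7 rfl]
      exact hI.1 i (by omega)
  · simp only [CpxState.setNat_arr, CpxState.setArr_arr_same, CpxState.setArr_cpx]
    rw [CpxState.setArr_arr_of_ne _ _ _ _ (by norm_num)]
    split_ifs with h
    · subst h; exact h2
    · rw [hF₂.arr 4 rfl]
      exact hI.2 i (by omega)

/-- Transform of length `m` of the least significant digit, which becomes the most significant
one; the remaining digits have `l` values. -/
noncomputable def rotateDft (l m : ℕ) (x : ℕ → ℂ) (i : ℕ) : ℂ :=
  cyclicDft m (fun a => x (a + m * (i % l))) (i / l)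

theorem add_mul_lt_mul {a m c l : ℕ} (ha : a < m) (hc : c < l) : a + m * c < l * m :=
  calc a + m * c < m + m * c := by omega
    _ = m * (c + 1) := by ring
    _ ≤ m * l := Nat.mul_le_mul_left _ hc
    _ = l * m := mul_comm _ _

theorem norm_rotateDft_le {l m : ℕ} {x : ℕ → ℂ} {Y : ℝ} (hx : ∀ i < l * m, ‖x i‖ ≤ Y) {i : ℕ}
    (hi : i < l * m) : ‖rotateDft l m x i‖ ≤ m * Y := by
  refine norm_cyclicDft_le (fun a ha => hx _ ?_) _
  have hl : 0 < l := Nat.pos_of_ne_zero fun h => by simp [h] at hi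
  have := Nat.mod_lt i hl
  exact add_mul_lt_mul ha this

/-- `rotateDft` for the array `0`; its length is in the natural register `3`, and the order of the
transform in the natural register `7`. -/
def rotatePass : CpxProgram :=
  .seq (.setNat 10 (.div (.reg 3) (.reg 7))) (.seq transformLength (.seq rootTable
    (.seq chirpTable (.seq (fft 4) (.seq (copyArr 0 2 3) (forLoop 11 10 bluestein))))))

set_option maxHeartbeats 400000 in
-- Tables and the transform of the chirp are made once, followed by l applications of `bluestein`.
-- With M ≤ 4m the tables cost O(mN) and the transforms O(l·m·r), and the error factor M^11 becomes
-- (4m)^11.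
theorem rotatePass_spec {l m : ℕ} {x : ℕ → ℂ} {Y e : ℝ} (h0 : A.nat 0 = B) (h1 : A.nat 1 = D)
    (h3 : A.nat 3 = l * m) (h5 : A.nat 5 = N) (h7 : A.nat 7 = m) (hl : 0 < l) (hm : 2 ≤ m)
    (hD : 2 ^ 30 * (N + 1) ^ 2 ≤ D) (hDN : D ≤ 2 ^ N)
    (hpi : ‖A.cpx 3 - Real.pi‖ ≤ 2 ^ 24 * N ^ 2 / D) (hnD : l * m ≤ D)
    (hx : ∀ i < l * m, ‖x i‖ ≤ Y) (hY : 1 ≤ Y) (hA : ∀ i < l * m, ‖A.arr 0 i - x i‖ ≤ e)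
    (hμe : Y * (2 ^ 27 * N ^ 2 / D) ≤ e) (hμM : (4 * m) ^ 4 * (2 ^ 27 * N ^ 2 / D : ℝ) ≤ 1)
    (hbig : 100 * ((4 * m) ^ 8 * (Y + e)) ≤ D) :
    Runs B D rotatePass A (300 * (l * m * Nat.clog 2 (2 * m) + m * N)) fun A' =>
      ∀ i < l * m, ‖A'.arr 0 i - rotateDft l m x i‖ ≤ (4 * m) ^ 11 * e := by
  set r := Nat.clog 2 (2 * m) with hr
  set M := 2 ^ r with hM
  set μ : ℝ := 2 ^ 27 * N ^ 2 / D with hμ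
  have hD1 : 2 ^ 30 ≤ D := le_trans (Nat.le_mul_of_pos_right _ (by positivity)) hD
  have hD0 : 0 < D := by omega
  have hD0' : (0 : ℝ) < D := by exact_mod_cast hD0
  have hN : 1 ≤ N := by
    by_contra h
    have h3 : N = 0 := by omega
    subst h3
    have : D ≤ 1 := by simpa using hDN
    omega
  have hN' : (1 : ℝ) ≤ N := by exact_mod_cast hN
  have hr1 : 1 ≤ r := Nat.clog_pos (by norm_num) (by omega)
  have hmM : 2 * m ≤ M := Nat.le_pow_clog (by norm_num) _
  -- By minimality of r, 2^(r-1) < 2m.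
  have hM4 : M ≤ 4 * m := by
    have h := (Nat.lt_clog_iff_pow_lt (b := 2) (x := 2 * m) (y := r - 1) (by norm_num)).1 (by omega)
    have : M = 2 * 2 ^ (r - 1) := by rw [hM, ← pow_succ']; congr 1; omega
    omega
  have hm' : (2 : ℝ) ≤ m := by exact_mod_cast hm
  have hM4' : (M : ℝ) ≤ 4 * m := by exact_mod_cast hM4
  have hM1 : (1 : ℝ) ≤ M := by
    have : 1 ≤ M := by omega
    exact_mod_cast this
  have hμ0 : 0 ≤ μ := by positivity
  have hμD : 2 / D ≤ μ := by rw [hμ]; gcongr; nlinarith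
  have he : 0 ≤ e := le_trans (by positivity) hμe
  have hμM' : (M : ℝ) ^ 4 * μ ≤ 1 := le_trans (by gcongr) hμM
  have hbig' : 100 * ((M : ℝ) ^ 8 * (Y + e)) ≤ D := le_trans (by gcongr) hbig
  have hmD : 16 * m ≤ D := by
    have : (16 : ℝ) * m ≤ D := by
      refine le_trans ?_ hbig
      have h1 : (4 * m : ℝ) ≤ (4 * m) ^ 8 := le_self_pow₀ (by linarith) (by norm_num)
      have h2 : ((4 * m : ℝ)) ^ 8 ≤ (4 * m) ^ 8 * (Y + e) :=
        le_mul_of_one_le_right (by positivity) (by linarith)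
      linarith
    exact_mod_cast this
  have hDD : D ≤ D ^ 2 := Nat.le_self_pow (by norm_num) D
  have hω : IsPrimitiveRoot (Complex.exp (2 * Real.pi * Complex.I / M)) M :=
    Complex.isPrimitiveRoot_exp M (by omega)
  have hω1 : ‖Complex.exp (2 * Real.pi * Complex.I / M)‖ = 1 :=
    hω.norm'_eq_one (by omega)
  set ω := Complex.exp (2 * Real.pi * Complex.I / M) with hωdef
  have ln : l ≤ l * m := Nat.le_mul_of_pos_right _ (by omega)
  have mn : m ≤ l * m := Nat.le_mul_of_pos_left _ hl
  have hnr : l * m ≤ l * m * r := Nat.le_mul_of_pos_right _ hr1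
  have hlr : l * r ≤ l * m * r := Nat.mul_le_mul_right _ ln
  have hmr : m * r ≤ l * m * r := Nat.mul_le_mul_right _ mn
  have hrr : r ≤ m * r := Nat.le_mul_of_pos_left _ (by omega)
  have hMN : M * N ≤ 4 * (m * N) := by
    calc M * N ≤ 4 * m * N := Nat.mul_le_mul_right _ hM4
      _ = _ := by ring
  have hrM : r * M ≤ 4 * (m * r) := by
    calc r * M ≤ r * (4 * m) := Nat.mul_le_mul_left _ hM4
      _ = _ := by ring
  have hlM : l * M ≤ 4 * (l * m) := by
    calc l * M ≤ l * (4 * m) := Nat.mul_le_mul_left _ hM4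
      _ = _ := by ring
  have hlrM : l * (r * M) ≤ 4 * (l * m * r) := by
    calc l * (r * M) ≤ l * (4 * (m * r)) := Nat.mul_le_mul_left _ hrM
      _ = _ := by ring
  -- The times of the seven consecutive parts. Expanded, all terms are multiples of M·N, l·M, r·M,
  -- l·r·M and smaller quantities, which the preceding inequalities bound by l·m·r and m·N.
  have hT : 1 + ((3 * r + 3) + ((M * (N * 4 + 8) + 2) + ((M * (N * 4 + 11) + 2) +
      ((r * (10 * M + 7) + 3) + ((l * m * 4 + 2) +
        (l * ((8 * M + 8 * m + 2 * (r * (10 * M + 7)) + 14) + 2) + 2)))))) ≤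
      300 * (l * m * r + m * N) := by
    have e1 : l * ((8 * M + 8 * m + 2 * (r * (10 * M + 7)) + 14) + 2) =
      8 * (l * M) + 8 * (l * m) + 20 * (l * (r * M)) + 14 * (l * r) + 16 * l := by ring
    have e2 : M * (N * 4 + 8) = 4 * (M * N) + 8 * M := by ring
    have e3 : M * (N * 4 + 11) = 4 * (M * N) + 11 * M := by ring
    have e4 : r * (10 * M + 7) = 10 * (r * M) + 7 * r := by ring
    rw [e1, e2, e3, e4]
    omega
  refine Runs.seq (T₁ := 1) (Runs.setNat l
    (by simpa [NatExpr.eval, h3, h7] using Nat.mul_div_cancel l (by omega))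
    ⟨trivial, trivial, by simp [NatExpr.eval, h7]; omega⟩ (by omega)
    (Q := fun A'' => A'' = A.setNat 10 l) rfl) hT ?_
  rintro _ - rfl
  refine Runs.seq (transformLength_spec (m := m) (by simp [h7]) hD0 (by omega)) le_rfl ?_
  intro A₁ F₁ hA₁
  rw [← hr, ← hM] at hA₁
  have a0 : A₁.nat 0 = B := (F₁.nat 0 rfl).trans (by simp [h0])
  have a1 : A₁.nat 1 = D := (F₁.nat 1 rfl).trans (by simp [h1])
  have a3 : A₁.nat 3 = l * m := (F₁.nat 3 rfl).trans (by simp [h3])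
  have a5 : A₁.nat 5 = N := (F₁.nat 5 rfl).trans (by simp [h5])
  have a7 : A₁.nat 7 = m := (F₁.nat 7 rfl).trans (by simp [h7])
  have a10 : A₁.nat 10 = l := (F₁.nat 10 rfl).trans (by simp)
  have aX : A₁.arr 0 = A.arr 0 := F₁.arr 0 rfl
  have aπ : ‖A₁.cpx 3 - Real.pi‖ ≤ 2 ^ 24 * N ^ 2 / D := by rw [F₁.cpx 3 rfl]; exact hpi
  refine Runs.seq (rootTable_spec a0 a1 a5 hA₁.1 (by omega) (by omega) hD hDN aπ) le_rfl ?_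
  intro A₂ F₂ hA₂
  have b0 : A₂.nat 0 = B := (F₂.nat 0 rfl).trans a0
  have b1 : A₂.nat 1 = D := (F₂.nat 1 rfl).trans a1
  have b3 : A₂.nat 3 = l * m := (F₂.nat 3 rfl).trans a3
  have b5 : A₂.nat 5 = N := (F₂.nat 5 rfl).trans a5
  have b7 : A₂.nat 7 = m := (F₂.nat 7 rfl).trans a7
  have b8 : A₂.nat 8 = M := (F₂.nat 8 rfl).trans hA₁.1
  have b9 : A₂.nat 9 = r := (F₂.nat 9 rfl).trans hA₁.2
  have b10 : A₂.nat 10 = l := (F₂.nat 10 rfl).trans a10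
  refine Runs.seq (chirpTable_spec b0 b1 b5 b7 b8 (by omega) (by omega) (by omega) hD hDN
    (by rw [F₂.cpx 3 rfl]; exact aπ)) le_rfl ?_
  rintro A₃ F₃ ⟨hA₃, hA₃'⟩
  have c6 : A₃.arr 6 = A₂.arr 6 := F₃.arr 6 rfl
  have c0 : A₃.nat 0 = B := (F₃.nat 0 rfl).trans b0
  have c1 : A₃.nat 1 = D := (F₃.nat 1 rfl).trans b1
  have c8 : A₃.nat 8 = M := (F₃.nat 8 rfl).trans b8
  have c9 : A₃.nat 9 = r := (F₃.nat 9 rfl).trans b9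
  have t1 : (M : ℝ) ^ 8 * 1 ≤ M ^ 8 * (Y + e) := by gcongr; linarith
  have t2 : (M : ℝ) ≤ M ^ 8 := le_self_pow₀ hM1 (by norm_num)
  -- The chirp has modulus 1, so e = Mμ meets the condition M·Y·μ ≤ e with Y = 1. The result is the
  -- error M⁴μ that `bluestein_spec` presupposes.
  refine Runs.seq (fft_spec (a := 4) (x := chirpSeq m M) (Y := 1) (e := M * μ) (μ := μ)
    (by norm_num) (by norm_num) (by norm_num) c0 c1 c8 c9 hM hω.pow_eq_one hω1 hD0
    (fun i _ => (norm_chirpSeq m M i).le) (by norm_num)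
    (fun i hi => (hA₃' i hi).trans (le_mul_of_one_le_left hμ0 hM1))
    (fun i hi => by rw [c6]; exact hA₂ i hi)
    ((le_mul_of_one_le_left hμ0 (one_le_pow₀ hM1)).trans hμM') (by simp)
    (hμD.trans (le_mul_of_one_le_left hμ0 hM1))
    (by
      have : (M : ℝ) ^ 3 * (M * μ) = M ^ 4 * μ := by ring
      rw [this]; linarith) (by omega)) le_rfl ?_
  intro A₄ F₄ hA₄
  -- The results of one transform land on inputs of others, hence all inputs are first saved in
  -- array 2.
  refine Runs.seq (copyArr_spec (k := 0) (l := 2) (b := 3) (n := l * m) (by norm_num) (by norm_num)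
    (by norm_num) (by norm_num) ((F₄.nat 0 rfl).trans c0)
    ((F₄.nat 3 rfl).trans ((F₃.nat 3 rfl).trans b3)) (by omega)) le_rfl ?_
  intro A₅ F₅ hA₅
  have hX : A₄.arr 0 = A.arr 0 :=
    (F₄.arr 0 rfl).trans ((F₃.arr 0 rfl).trans ((F₂.arr 0 rfl).trans aX))
  refine (Runs.forLoop (fun c A' => ∀ c' < c, ∀ k < m,
    ‖A'.arr 0 (c' + l * k) - cyclicDft m (fun a => x (a + m * c')) k‖ ≤ M ^ 11 * e)
    (8 * M + 8 * m + 2 * (r * (10 * M + 7)) + 14) (N := l)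
    ((F₅.nat 10 rfl).trans ((F₄.nat 10 rfl).trans ((F₃.nat 10 rfl).trans b10))) (by omega)
    (by norm_num) rfl rfl (by simp) ?_).mono le_rfl ?_
  · intro c hc A₆ F₆ d11 hI
    refine (bluestein_spec (A := A₆) (m := m) (M := M) (r := r) (c := c) (l := l) (ω := ω)
      (a := fun a => x (a + m * c)) (Y := Y) (e := e) (μ := μ)
      ((F₆.nat 0 rfl).trans ((F₅.nat 0 rfl).trans ((F₄.nat 0 rfl).trans c0)))
      ((F₆.nat 1 rfl).trans ((F₅.nat 1 rfl).trans ((F₄.nat 1 rfl).trans c1)))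
      ((F₆.nat 7 rfl).trans ((F₅.nat 7 rfl).trans ((F₄.nat 7 rfl).trans
        ((F₃.nat 7 rfl).trans b7))))
      ((F₆.nat 8 rfl).trans ((F₅.nat 8 rfl).trans ((F₄.nat 8 rfl).trans c8)))
      ((F₆.nat 9 rfl).trans ((F₅.nat 9 rfl).trans ((F₄.nat 9 rfl).trans c9)))
      ((F₆.nat 10 rfl).trans ((F₅.nat 10 rfl).trans ((F₄.nat 10 rfl).trans
        ((F₃.nat 10 rfl).trans b10)))) d11 hl hm hmM hM hω hω1 ?_ hY hμD hμe hμM' hbig' ?_ ?_ ?_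
      ?_).mono le_rfl ?_
    · intro j hj
      exact hx _ (add_mul_lt_mul hj hc)
    · intro j hj
      have hlt : j + m * c < l * m := add_mul_lt_mul hj hc
      rw [F₆.arr 2 rfl, hA₅ _ hlt, hX]
      exact hA _ hlt
    · intro j hj
      rw [F₆.arr 7 rfl, F₅.arr 7 rfl, F₄.arr 7 rfl]
      exact hA₃ j hj
    · intro j hj
      rw [F₆.arr 4 rfl, F₅.arr 4 rfl]
      refine (hA₄ j hj).trans (le_of_eq (by ring))
    · intro j hj
      rw [F₆.arr 6 rfl, F₅.arr 6 rfl, F₄.arr 6 rfl, c6]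
      exact hA₂ j hj
    · rintro A₇ - ⟨h, h'⟩ c' hc' k hk
      simp only [CpxState.setNat_arr]
      rcases Nat.lt_succ_iff_lt_or_eq.1 hc' with hlt | rfl
      -- The results for c are exactly at positions congruent to c modulo l, so different values of
      -- c do not interfere.
      · rw [h' _ fun k' _ heq => ?_]
        · exact hI c' hlt k hk
        · have h1 := congrArg (· % l) heq
          simp [Nat.mod_eq_of_lt hc, Nat.mod_eq_of_lt (hlt.trans hc)] at h1
          omega
      · exact h k hk
  · intro A₆ _ hI i hi
    have hk : i / l < m := Nat.div_lt_of_lt_mul hi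
    have := hI (i % l) (Nat.mod_lt _ hl) (i / l) hk
    rw [Nat.mod_add_div] at this
    exact this.trans (by gcongr)

end CpxProgram

/-! ### The transform of a product of cyclic groups -/

/-- Digit number `j` of `p` in the mixed radix system with radices `m 0, m 1, …`. -/
def radixDigit (m : ℕ → ℕ) (p j : ℕ) : ℕ := p / (∏ i ∈ Finset.range j, m i) % m j

/-- The result of transforming the first `j` digits. -/
noncomputable def iterRotateDft (m : ℕ → ℕ) (n : ℕ) (x : ℕ → ℂ) : ℕ → ℕ → ℂ
  | 0 => x
  | j + 1 => CpxProgram.rotateDft (n / m j) (m j) (iterRotateDft m n x j)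

theorem Finset.sum_range_mul_eq {M : Type*} [AddCommMonoid M] (f : ℕ → M) (a b : ℕ) :
    ∑ i ∈ Finset.range (a * b), f i =
      ∑ k ∈ Finset.range b, ∑ i ∈ Finset.range a, f (i + a * k) := by
  induction b with
  | zero => simp
  | succ b ih =>
    rw [mul_add, mul_one, Finset.sum_range_add, ih, Finset.sum_range_succ]
    congr 1
    exact Finset.sum_congr rfl fun i _ => by rw [add_comm]

theorem radixDigit_add_mul {m : ℕ → ℕ} {j l : ℕ} (hl : l < j) (p a : ℕ) (hm : ∀ i < j, 0 < m i) :
    radixDigit m (p + (∏ i ∈ Finset.range j, m i) * a) l = radixDigit m p l := by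
  have h : ∏ i ∈ Finset.range j, m i =
      (∏ i ∈ Finset.range l, m i) * (m l * ∏ i ∈ Finset.Ico (l + 1) j, m i) := by
    rw [← Finset.prod_range_mul_prod_Ico _ (show l + 1 ≤ j from hl), Finset.prod_range_succ,
      mul_assoc]
  have h0 : 0 < ∏ i ∈ Finset.range l, m i :=
    Finset.prod_pos fun i hi => hm i ((Finset.mem_range.1 hi).trans hl)
  unfold radixDigit
  rw [h, mul_assoc, mul_assoc, Nat.add_mul_div_left _ _ h0, Nat.add_mul_mod_self_left]

theorem radixDigit_add_mul_self {m : ℕ → ℕ} {j p a : ℕ} (hp : p < ∏ i ∈ Finset.range j, m i)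
    (ha : a < m j) : radixDigit m (p + (∏ i ∈ Finset.range j, m i) * a) j = a := by
  unfold radixDigit
  rw [Nat.add_mul_div_left _ _ (by omega), Nat.div_eq_of_lt hp, zero_add, Nat.mod_eq_of_lt ha]

/-- After j passes the j frequencies stand above the remaining digits, in their original order: κ
collects the frequencies, c < Q the untouched digits, and Q·P = n with P the product of the first j
radices. The induction needs Q arbitrary, since the state one pass earlier has Q·m_j in place of Q.
For j = s we have Q = 1 and the natural order is restored. -/
theorem iterRotateDft_eq {m : ℕ → ℕ} {n : ℕ} {x : ℕ → ℂ} (j : ℕ) (hm : ∀ i < j, 0 < m i) (Q : ℕ)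
    (hn : n = Q * ∏ i ∈ Finset.range j, m i) {c κ : ℕ} (hc : c < Q)
    (hκ : κ < ∏ i ∈ Finset.range j, m i) :
    iterRotateDft m n x j (c + Q * κ) = ∑ p ∈ Finset.range (∏ i ∈ Finset.range j, m i),
      x (p + (∏ i ∈ Finset.range j, m i) * c) * ∏ l ∈ Finset.range j,
        Complex.exp (-(2 * Real.pi * ((radixDigit m p l * radixDigit m κ l : ℕ) / m l) *
          Complex.I)) := by
  induction j generalizing Q c κ with
  | zero =>
    simp only [Finset.range_zero, Finset.prod_empty, Nat.lt_one_iff] at hκ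
    simp [iterRotateDft, hκ]
  | succ j ih =>
    set P := ∏ i ∈ Finset.range j, m i with hP
    have hP0 : 0 < P := Finset.prod_pos fun i hi => hm i ((Finset.mem_range.1 hi).trans j.lt_succ_self)
    have hmj : 0 < m j := hm j j.lt_succ_self
    rw [Finset.prod_range_succ, ← hP] at hn hκ ⊢
    have hQP : n / m j = Q * P := by
      rw [hn, ← mul_assoc, Nat.mul_div_cancel _ hmj]
    have hdm : P * (κ / P) + κ % P = κ := Nat.div_add_mod κ P
    have hmodlt : κ % P < P := Nat.mod_lt _ hP0
    have hlt : c + Q * (κ % P) < Q * P := by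
      rw [mul_comm Q P]; exact CpxProgram.add_mul_lt_mul hc hmodlt
    have hk : κ / P < m j := Nat.div_lt_of_lt_mul hκ
    -- The top digit κ / P is the frequency of the last pass; the rest is the position left by the
    -- earlier passes once a digit is removed.
    have hi : c + Q * κ = (c + Q * (κ % P)) + Q * P * (κ / P) := by
      conv_lhs => rw [← hdm]
      ring
    have hmod : (c + Q * κ) % (Q * P) = c + Q * (κ % P) := by
      rw [hi, Nat.add_mul_mod_self_left, Nat.mod_eq_of_lt hlt]
    have hdiv : (c + Q * κ) / (Q * P) = κ / P := by
      rw [hi, Nat.add_mul_div_left _ _ (by omega), Nat.div_eq_of_lt hlt, zero_add]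
    rw [iterRotateDft, hQP, CpxProgram.rotateDft, hmod, hdiv, cyclicDft,
      Finset.sum_range_mul_eq]
    refine Finset.sum_congr rfl fun a ha => ?_
    rw [Finset.mem_range] at ha
    -- The digit a that is transformed was the lowest of the untouched digits, so the earlier state
    -- has a + m_j c below and κ % P above.
    have hidx : a + m j * (c + Q * (κ % P)) = (a + m j * c) + (Q * m j) * (κ % P) := by ring
    rw [hidx, ih (fun i hi => hm i (hi.trans j.lt_succ_self)) (Q * m j) (by rw [hn]; ring)
      (CpxProgram.add_mul_lt_mul ha hc) hmodlt, Finset.sum_mul]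
    refine Finset.sum_congr rfl fun p hp => ?_
    rw [Finset.mem_range] at hp
    rw [Finset.prod_range_succ, mul_assoc]
    congr 1
    · congr 1; ring
    congr 1
    · refine Finset.prod_congr rfl fun l hl => ?_
      rw [Finset.mem_range] at hl
      have hm' : ∀ i < j, 0 < m i := fun i hi => hm i (hi.trans j.lt_succ_self)
      rw [radixDigit_add_mul hl p a hm']
      have : radixDigit m κ l = radixDigit m (κ % P) l := by
        conv_lhs => rw [← hdm, add_comm]
        exact radixDigit_add_mul hl _ _ hm'
      rw [this]
    · rw [radixDigit_add_mul_self hp ha]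
      have : radixDigit m κ j = κ / P := Nat.mod_eq_of_lt hk
      rw [this]

theorem iterRotateDft_eq_sum {m : ℕ → ℕ} {n s : ℕ} {x : ℕ → ℂ} (hm : ∀ i < s, 0 < m i)
    (hn : n = ∏ i ∈ Finset.range s, m i) {κ : ℕ} (hκ : κ < n) :
    iterRotateDft m n x s κ = ∑ p ∈ Finset.range n, x p * ∏ l ∈ Finset.range s,
      Complex.exp (-(2 * Real.pi * ((radixDigit m p l * radixDigit m κ l : ℕ) / m l) *
        Complex.I)) := by
  have := iterRotateDft_eq (x := x) s hm 1 (n := n) (by rw [one_mul]; exact hn) zero_lt_one (κ := κ) (by rwa [← hn])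
  simpa [← hn] using this

/-! ### Positions of group elements and characters -/

section Group

variable {G : Type*} [AddCommGroup G] {s : ℕ}

/-- The orders of the basis elements, as a sequence. -/
noncomputable def basisOrders (b : Fin s → G) (j : ℕ) : ℕ :=
  if h : j < s then addOrderOf (b ⟨j, h⟩) else 1

theorem basisOrders_val (b : Fin s → G) (j : Fin s) : basisOrders b j = addOrderOf (b j) := by
  simp [basisOrders]

theorem prod_basisOrders_below (b : Fin s → G) {j : ℕ} (hj : j ≤ s) :
    ∏ i ∈ Finset.univ.filter (fun i : Fin s => (i : ℕ) < j), addOrderOf (b i) =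
      ∏ i ∈ Finset.range j, basisOrders b i := by
  refine Finset.prod_bij (fun i _ => (i : ℕ)) (by simp) (fun i _ i' _ h => Fin.ext h) ?_ ?_
  · intro l hl
    rw [Finset.mem_range] at hl
    exact ⟨⟨l, hl.trans_le hj⟩, by simpa using hl, rfl⟩
  · intro i _
    rw [basisOrders_val]

theorem digit_eq_radixDigit (b : Fin s → G) (p : ℕ) (j : Fin s) :
    digit b p j = radixDigit (basisOrders b) p j := by
  rw [digit, radixDigit, basisOrders_val, ← prod_basisOrders_below b j.2.le]
  rfl

theorem basisOrders_pos [Finite G] (b : Fin s → G) (j : ℕ) : 0 < basisOrders b j := by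
  unfold basisOrders
  split_ifs
  · exact addOrderOf_pos _
  · exact one_pos

theorem exists_digits [Finite G] (b : Fin s → G) (i : Fin s → ℕ)
    (hi : ∀ j, i j < addOrderOf (b j)) :
    ∃ p < ∏ j ∈ Finset.range s, basisOrders b j, ∀ j, digit b p j = i j := by
  have key : ∀ t ≤ s, ∃ p < ∏ j ∈ Finset.range t, basisOrders b j,
      ∀ j : Fin s, (j : ℕ) < t → radixDigit (basisOrders b) p j = i j := by
    intro t ht
    induction t with
    | zero => exact ⟨0, by simp, by simp⟩
    | succ t ih =>
      obtain ⟨p, hp, h⟩ := ih (by omega)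
      have ht' : t < s := ht
      have hit := hi ⟨t, ht'⟩
      rw [← basisOrders_val] at hit
      refine ⟨p + (∏ j ∈ Finset.range t, basisOrders b j) * i ⟨t, ht'⟩, ?_, ?_⟩
      · rw [Finset.prod_range_succ, mul_comm _ (basisOrders b t)]
        exact CpxProgram.add_mul_lt_mul hp hit
      · intro j hj
        rcases Nat.lt_succ_iff_lt_or_eq.1 hj with h' | h'
        · rw [radixDigit_add_mul h' _ _ fun i _ => basisOrders_pos b i, h j h']
        · obtain rfl : j = ⟨t, ht'⟩ := Fin.ext h'
          exact radixDigit_add_mul_self hp hit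
  obtain ⟨p, hp, h⟩ := key s le_rfl
  exact ⟨p, hp, fun j => by rw [digit_eq_radixDigit]; exact h j j.2⟩

theorem IsGroupBasis.card_eq [Fintype G] {b : Fin s → G} (hb : IsGroupBasis b) :
    Fintype.card G = ∏ j ∈ Finset.range s, basisOrders b j := by
  classical
  have hbij : Function.Bijective
      (fun i : (j : Fin s) → Fin (addOrderOf (b j)) => ∑ j, (i j : ℕ) • b j) := by
    constructor
    · intro i i' h
      obtain ⟨_, _, h2⟩ := hb (∑ j, (i j : ℕ) • b j)
      have h3 := h2 (fun j => i j) ⟨fun j => (i j).2, rfl⟩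
      have h4 := h2 (fun j => i' j) ⟨fun j => (i' j).2, h⟩
      funext j
      exact Fin.ext (congrFun (h3.trans h4.symm) j)
    · intro g
      obtain ⟨i, ⟨h1, h2⟩, _⟩ := hb g
      exact ⟨fun j => ⟨i j, h1 j⟩, h2.symm⟩
  rw [← Fintype.card_of_bijective hbij, Fintype.card_pi]
  simp only [Fintype.card_fin]
  rw [← prod_basisOrders_below b le_rfl]
  simp

theorem IsGroupBasis.sum_eltAt [Fintype G] {M : Type*} [AddCommMonoid M] {b : Fin s → G}
    (hb : IsGroupBasis b) (f : G → M) :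
    ∑ p ∈ Finset.range (Fintype.card G), f (eltAt b p) = ∑ g, f g := by
  rw [← Fin.sum_univ_eq_sum_range (fun p => f (eltAt b p))]
  have hsurj : Function.Surjective (fun p : Fin (Fintype.card G) => eltAt b p) := by
    intro g
    obtain ⟨i, ⟨h1, h2⟩, _⟩ := hb g
    obtain ⟨p, hp, h⟩ := exists_digits b i h1
    refine ⟨⟨p, by rwa [hb.card_eq]⟩, ?_⟩
    simp only [eltAt, h, h2]
  have hbij : Function.Bijective (fun p : Fin (Fintype.card G) => eltAt b p) :=
    (Fintype.bijective_iff_surjective_and_card _).2 ⟨hsurj, by simp⟩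
  exact hbij.sum_comp f

/-- χ(b j) is a root of unity of order dividing that of b j, hence a power of the standard primitive
root; the exponents are the digits of a position. -/
theorem exists_isCharAt [Fintype G] {b : Fin s → G} (hb : IsGroupBasis b) (χ : AddChar G Circle) :
    ∃ p < Fintype.card G, IsCharAt b p χ := by
  have key : ∀ j, ∃ k < addOrderOf (b j),
      χ (b j) = Circle.exp (2 * Real.pi * (k : ℝ) / (addOrderOf (b j) : ℝ)) := by
    intro j
    have hpos : 0 < addOrderOf (b j) := addOrderOf_pos _
    have h1 : ((χ (b j) : Circle) : ℂ) ^ addOrderOf (b j) = 1 := by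
      rw [← Circle.coe_pow, ← AddChar.map_nsmul_eq_pow, addOrderOf_nsmul_eq_zero]
      simp
    have : NeZero (addOrderOf (b j)) := ⟨hpos.ne'⟩
    obtain ⟨k, hk, h⟩ := (Complex.isPrimitiveRoot_exp _ hpos.ne').eq_pow_of_pow_eq_one h1
    refine ⟨k, hk, ?_⟩
    ext
    rw [← h, Circle.coe_exp, ← Complex.exp_nat_mul]
    congr 1
    push_cast
    ring
  choose k hk h using key
  obtain ⟨p, hp, hd⟩ := exists_digits b k hk
  exact ⟨p, by rwa [hb.card_eq], fun j => by rw [h, hd]⟩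

/-- By multiplicativity, the conjugate of χ at the element with digits d_j is the product of
exp(-2πi d_j k_j/m_j), which is the kernel produced by the passes; `sum_eltAt` turns positions into
group elements. -/
theorem IsCharAt.dft_eq [Fintype G] {b : Fin s → G} (hb : IsGroupBasis b) {κ : ℕ}
    {χ : AddChar G Circle} (hχ : IsCharAt b κ χ) (hκ : κ < Fintype.card G) (α : G → ℂ) :
    iterRotateDft (basisOrders b) (Fintype.card G) (fun p => α (eltAt b p)) s κ = dft α χ := by
  rw [iterRotateDft_eq_sum (fun i _ => basisOrders_pos b i) hb.card_eq hκ, dft, ← hb.sum_eltAt]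
  refine Finset.sum_congr rfl fun p _ => ?_
  congr 1
  have h1 : χ (eltAt b p) = ∏ j, χ (b j) ^ digit b p j := by
    rw [eltAt]
    have : ∀ (S : Finset (Fin s)), χ (∑ j ∈ S, digit b p j • b j) =
        ∏ j ∈ S, χ (b j) ^ digit b p j := by
      intro S
      classical
      induction S using Finset.induction_on with
      | empty => simp
      | insert a S ha ih =>
        rw [Finset.sum_insert ha, Finset.prod_insert ha, AddChar.map_add_eq_mul, ih,
          AddChar.map_nsmul_eq_pow]
    exact this _
  have h2 : ((∏ j, χ (b j) ^ digit b p j : Circle) : ℂ) =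
      ∏ j, ((χ (b j) : Circle) : ℂ) ^ digit b p j := by
    have := map_prod Circle.coeHom (fun j => χ (b j) ^ digit b p j) Finset.univ
    simp only [map_pow] at this
    exact this
  rw [h1, h2, map_prod, ← Fin.prod_univ_eq_prod_range (fun l => Complex.exp (-(2 * Real.pi *
    ((radixDigit (basisOrders b) p l * radixDigit (basisOrders b) κ l : ℕ) / basisOrders b l) *
      Complex.I)))]
  refine Finset.prod_congr rfl fun j _ => ?_
  rw [hχ j, ← digit_eq_radixDigit, ← digit_eq_radixDigit, basisOrders_val, map_pow,
    Circle.coe_exp, ← Complex.exp_conj, ← Complex.exp_nat_mul]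
  congr 1
  simp only [map_mul, Complex.conj_ofReal, Complex.conj_I]
  push_cast
  ring

end Group

/-! ### The complete program -/

/-- A number that dominates all quantities of the input. -/
def inputScale (n E X : ℕ) : ℕ := 2 ^ 40 * n * (E + 1) * (X + 1)

theorem le_inputScale {n : ℕ} (hn : 0 < n) (E X : ℕ) :
    2 ^ 40 ≤ inputScale n E X ∧ 2 ^ 40 * n ≤ inputScale n E X ∧ E + 1 ≤ inputScale n E X ∧
      X + 1 ≤ inputScale n E X := by
  have h1 : 2 ^ 40 * n ≤ inputScale n E X := by
    unfold inputScale
    rw [mul_assoc]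
    exact Nat.le_mul_of_pos_right _ (by positivity)
  refine ⟨(Nat.le_mul_of_pos_right _ hn).trans h1, h1, ?_, ?_⟩
  · unfold inputScale
    calc E + 1 ≤ 2 ^ 40 * n * (E + 1) := Nat.le_mul_of_pos_left _ (by positivity)
      _ ≤ _ := Nat.le_mul_of_pos_right _ (by positivity)
  · exact Nat.le_mul_of_pos_left _ (by positivity)

theorem clog_pow_le (a k : ℕ) : Nat.clog 2 (a ^ k) ≤ k * Nat.clog 2 a := by
  apply Nat.clog_le_of_le_pow
  rw [mul_comm, pow_mul]
  exact Nat.pow_le_pow_left (Nat.le_pow_clog (by norm_num) a) k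

theorem series_length_le {S D N : ℕ} (hD : D = S ^ 64) (hN : N = 2 * Nat.clog 2 D) :
    N ≤ 128 * Nat.clog 2 S := by
  have h1 : Nat.clog 2 D ≤ 64 * Nat.clog 2 S := hD ▸ clog_pow_le S 64
  omega

theorem series_length_le_mul {S D N : ℕ} (hD : D = S ^ 64) (hN : N = 2 * Nat.clog 2 D) :
    N ≤ 128 * S := by
  have h2 : Nat.clog 2 S ≤ S := Nat.clog_le_of_le_pow S.lt_two_pow_self.le
  exact (series_length_le hD hN).trans (by omega)

/-- N is at most 128·S, so 2^30 (N+1)² is at most S⁴, the factor 2^46 being absorbed by S² ≥ 2^80.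
With D = S^64 there remains a factor S^60 for all later losses of accuracy. -/
theorem accuracy_le {S D N : ℕ} (hS : 2 ^ 40 ≤ S) (hD : D = S ^ 64)
    (hN : N = 2 * Nat.clog 2 D) :
    2 ^ 30 * (N + 1) ^ 2 ≤ D ∧ (S : ℝ) ^ 60 * (2 ^ 27 * N ^ 2 / D) ≤ 1 := by
  have h := series_length_le_mul hD hN
  have h1 : (N + 1) ^ 2 ≤ (2 ^ 8 * S) ^ 2 := Nat.pow_le_pow_left (by omega) 2
  have hS2 : 2 ^ 46 * S ^ 2 ≤ S ^ 4 := by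
    calc 2 ^ 46 * S ^ 2 ≤ (2 ^ 40) ^ 2 * S ^ 2 := Nat.mul_le_mul_right _ (by norm_num)
      _ ≤ S ^ 2 * S ^ 2 := by gcongr
      _ = S ^ 4 := by ring
  have h2 : 2 ^ 30 * (N + 1) ^ 2 ≤ S ^ 4 :=
    calc 2 ^ 30 * (N + 1) ^ 2 ≤ 2 ^ 30 * (2 ^ 8 * S) ^ 2 := by gcongr
      _ = 2 ^ 46 * S ^ 2 := by ring
      _ ≤ S ^ 4 := hS2
  refine ⟨h2.trans (hD ▸ Nat.pow_le_pow_right (by omega) (by norm_num)), ?_⟩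
  have h3 : (2 : ℝ) ^ 30 * (N + 1) ^ 2 ≤ S ^ 4 := by exact_mod_cast h2
  have hS0 : (0 : ℝ) < S := by
    have : 0 < S := by omega
    exact_mod_cast this
  have h4 : (2 : ℝ) ^ 27 * N ^ 2 ≤ S ^ 4 := by
    refine le_trans ?_ h3
    gcongr <;> norm_num
  rw [mul_div_assoc', div_le_one (by rw [hD]; positivity), hD]
  push_cast
  calc (S : ℝ) ^ 60 * (2 ^ 27 * (N : ℝ) ^ 2) ≤ (S : ℝ) ^ 60 * (S : ℝ) ^ 4 := by gcongr
    _ = (S : ℝ) ^ 64 := by ring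

namespace CpxProgram

variable {B D N : ℕ} {A : CpxState}

/-- The product of the orders of the basis elements. -/
def readOrders : CpxProgram :=
  .seq (.setNat 3 (.lit 1)) (forLoop 6 2 (.seq (.readNat 7 (.add (.lit 2) (.reg 6)))
    (.setNat 3 (.mul (.reg 3) (.reg 7)))))

theorem readOrders_spec {s : ℕ} {m : ℕ → ℕ} (h2 : A.nat 2 = s) (hm : ∀ j < s, 0 < m j)
    (hlow : ∀ j < s, A.low (2 + j) = m j) (hsB : s + 2 ≤ B) (hsD : s ≤ D ^ 2)
    (hnD : ∏ i ∈ Finset.range s, m i ≤ D ^ 2) :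
    Runs B D readOrders A (s * 4 + 3) fun A' => A'.nat 3 = ∏ i ∈ Finset.range s, m i := by
  have hpos : ∀ j ≤ s, 0 < ∏ i ∈ Finset.range j, m i := fun j hj =>
    Finset.prod_pos fun i hi => hm i ((Finset.mem_range.1 hi).trans_le hj)
  have hle : ∀ j ≤ s, ∏ i ∈ Finset.range j, m i ≤ ∏ i ∈ Finset.range s, m i := fun j hj =>
    Finset.prod_le_prod_of_subset_of_one_le' (Finset.range_mono hj)
      fun i hi _ => hm i (Finset.mem_range.1 hi)
  refine Runs.seq (T₁ := 1) (T₂ := s * 4 + 2) (Runs.setNat 1 rfl trivial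
    ((hpos s le_rfl).trans_le hnD) (Q := fun A'' => A'' = A.setNat 3 1) rfl) (by omega) ?_
  rintro _ - rfl
  refine Runs.forLoop (fun j A' => A'.nat 3 = ∏ i ∈ Finset.range j, m i) 2 (by simp [h2]) hsD
    (by norm_num) rfl rfl (by simp) ?_
  intro j hj A' hF h6 hI
  refine Runs.seq (T₁ := 1) (T₂ := 1) (Runs.readNat (2 + j) (m j) (by simp [NatExpr.eval, h6])
    ⟨trivial, trivial⟩ (by omega) (by rw [hF.low rfl]; exact hlow j hj)
    (Q := fun A'' => A'' = A'.setNat 7 (m j)) rfl) le_rfl ?_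
  rintro _ - rfl
  refine Runs.setNat (∏ i ∈ Finset.range (j + 1), m i)
    (by simp [NatExpr.eval, hI, Finset.prod_range_succ]) ⟨trivial, trivial⟩
    ((hle (j + 1) hj).trans hnD) (by simp)

/-- Copies the values of the function to the array `0`, and adds up their squares in the natural
register `18`. -/
def readValues : CpxProgram :=
  .seq (.setNat 18 (.lit 0)) (forLoop 14 3
    (.seq (.readCpx 0 (.add (.add (.lit 2) (.reg 2)) (.mul (.lit 2) (.reg 14))))
      (.seq (.store 0 (.reg 14) 0) (.seq (.normSq 19 0)
        (.setNat 18 (.add (.add (.reg 18) (.reg 19)) (.lit 1)))))))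

/-- Squared moduli avoid square roots, and the summand 1 makes up for the integer part, so the sum
bounds every squared modulus. Values are copied without rounding, which matters for the trivial
group. -/
theorem readValues_spec {s n : ℕ} {a : ℕ → ℂ} (h0 : A.nat 0 = B) (h2 : A.nat 2 = s)
    (h3 : A.nat 3 = n) (hre : ∀ i < n, A.low (2 + s + 2 * i) = (a i).re)
    (him : ∀ i < n, A.low (2 + s + 2 * i + 1) = (a i).im) (hB : 2 * n + s + 2 ≤ B)
    (hnD : n ≤ D ^ 2) (hX : ∑ i ∈ Finset.range n, (⌊Complex.normSq (a i)⌋₊ + 1) ≤ D ^ 2) :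
    Runs B D readValues A (n * 6 + 3) fun A' =>
      A'.nat 18 = ∑ i ∈ Finset.range n, (⌊Complex.normSq (a i)⌋₊ + 1) ∧
      ∀ i < n, A'.arr 0 i = a i := by
  have hle : ∀ j ≤ n, ∑ i ∈ Finset.range j, (⌊Complex.normSq (a i)⌋₊ + 1) ≤
      ∑ i ∈ Finset.range n, (⌊Complex.normSq (a i)⌋₊ + 1) := fun j hj =>
    Finset.sum_le_sum_of_subset (Finset.range_mono hj)
  refine Runs.seq (T₁ := 1) (T₂ := n * 6 + 2) (Runs.setNat 0 rfl trivial (Nat.zero_le _)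
    (Q := fun A'' => A'' = A.setNat 18 0) rfl) (by omega) ?_
  rintro _ - rfl
  refine Runs.forLoop (fun j A' =>
    A'.nat 18 = ∑ i ∈ Finset.range j, (⌊Complex.normSq (a i)⌋₊ + 1) ∧
      ∀ i < j, A'.arr 0 i = a i) 4 (by simp [h3]) hnD (by norm_num) rfl rfl (by simp) ?_
  rintro j hj A' hF h14 ⟨hI1, hI2⟩
  have a0 : A'.nat 0 = B := (hF.nat 0 rfl).trans (by simp [h0])
  have a2 : A'.nat 2 = s := (hF.nat 2 rfl).trans (by simp [h2])
  have hlow : A'.low = A.low := hF.low rfl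
  refine Runs.seq (T₁ := 1) (T₂ := 3) (Runs.readCpx (2 + s + 2 * j)
    (by simp [NatExpr.eval, h14, a2]) ⟨⟨trivial, trivial⟩, trivial, trivial⟩ (by omega)
    (Q := fun A'' => A'' = A'.setCpx 0 (a j)) (by rw [hlow, hre j hj, him j hj])) le_rfl ?_
  rintro _ - rfl
  refine Runs.seq (T₁ := 1) (T₂ := 2) (Runs.store j (by simp [NatExpr.eval, h14]) (by norm_num)
    trivial (by simp [a0]) (Q := fun A'' => A'' = (A'.setCpx 0 (a j)).setArr 0 j (a j))
    (by simp)) le_rfl ?_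
  rintro _ - rfl
  have hle' := (hle (j + 1) hj).trans hX
  rw [Finset.sum_range_succ] at hle'
  refine Runs.seq (T₁ := 1) (T₂ := 1) (Runs.normSq (by simp; omega)
    (Q := fun A'' => A'' = ((A'.setCpx 0 (a j)).setArr 0 j (a j)).setNat 19
      ⌊Complex.normSq (a j)⌋₊) (by simp)) le_rfl ?_
  rintro _ - rfl
  refine Runs.setNat (∑ i ∈ Finset.range (j + 1), (⌊Complex.normSq (a i)⌋₊ + 1))
    (by simp [NatExpr.eval, hI1, Finset.sum_range_succ, add_assoc])
    ⟨⟨trivial, trivial⟩, trivial⟩ ((hle (j + 1) hj).trans hX) ⟨by simp, ?_⟩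
  intro i hi
  simp only [CpxState.setNat_arr, CpxState.setArr_arr_same]
  split_ifs with h
  · rw [h]
  · exact hI2 i (by omega)

/-- Squares the natural register `1`. -/
def square : CpxProgram := .setNat 1 (.mul (.reg 1) (.reg 1))

theorem square_spec {v u : ℕ} (h1 : A.nat 1 = v) (hu : v ^ 2 = u) (hD : u ≤ D ^ 2) :
    Runs B D square A 1 fun A' => A'.nat 1 = u :=
  Runs.setNat u (by simp [NatExpr.eval, h1, ← hu, sq]) ⟨trivial, trivial⟩ hD (by simp)

/-- The accuracy, in the natural register `1`. -/
def computeAccuracy : CpxProgram :=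
  .seq (.setNat 1 (.mul (.mul (.mul (.lit (2 ^ 40)) (.reg 3)) (.add (.reg 4) (.lit 1)))
      (.add (.reg 18) (.lit 1))))
    (.seq square (.seq square (.seq square (.seq square (.seq square square)))))

theorem computeAccuracy_spec {n E X : ℕ} (h3 : A.nat 3 = n) (h4 : A.nat 4 = E)
    (h18 : A.nat 18 = X) (hn : 0 < n) (hD : D = inputScale n E X ^ 64) :
    Runs B D computeAccuracy A 7 fun A' => A'.nat 1 = D := by
  set S := inputScale n E X with hS
  have hS1 : 1 ≤ S := le_trans (by norm_num) (le_inputScale hn E X).1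
  have hle : ∀ k ≤ 64, S ^ k ≤ D ^ 2 := fun k hk =>
    calc S ^ k ≤ S ^ 64 := Nat.pow_le_pow_right hS1 hk
      _ = D := hD.symm
      _ ≤ D ^ 2 := Nat.le_self_pow (by norm_num) D
  refine Runs.seq (T₁ := 1) (T₂ := 6) (Runs.setNat S
    (by simp [NatExpr.eval, h3, h4, h18, hS, inputScale])
    ⟨⟨⟨trivial, trivial⟩, trivial, trivial⟩, trivial, trivial⟩ (by simpa using hle 1 (by norm_num))
    (Q := fun A'' => A''.nat 1 = S) (by simp)) le_rfl fun A₁ _ k₁ => ?_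
  refine Runs.seq (T₁ := 1) (T₂ := 5) (square_spec k₁ (u := S ^ 2) rfl (hle 2 (by norm_num)))
    le_rfl fun A₂ _ k₂ => ?_
  refine Runs.seq (T₁ := 1) (T₂ := 4) (square_spec k₂ (u := S ^ 4) (by ring) (hle 4 (by norm_num)))
    le_rfl fun A₃ _ k₃ => ?_
  refine Runs.seq (T₁ := 1) (T₂ := 3) (square_spec k₃ (u := S ^ 8) (by ring) (hle 8 (by norm_num)))
    le_rfl fun A₄ _ k₄ => ?_
  refine Runs.seq (T₁ := 1) (T₂ := 2) (square_spec k₄ (u := S ^ 16) (by ring)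
    (hle 16 (by norm_num))) le_rfl fun A₅ _ k₅ => ?_
  refine Runs.seq (T₁ := 1) (T₂ := 1) (square_spec k₅ (u := S ^ 32) (by ring)
    (hle 32 (by norm_num))) le_rfl fun A₆ _ k₆ => ?_
  exact square_spec k₆ (by rw [hD]; ring) (Nat.le_self_pow (by norm_num) D)

/-- The number of terms of the series, in the natural register `5`. -/
def seriesLength : CpxProgram :=
  .seq (.setNat 5 (.lit 0)) (.seq (.setNat 20 (.lit 1)) (.loop (.reg 20) (.reg 1)
    (.seq (.setNat 20 (.mul (.lit 2) (.reg 20))) (.setNat 5 (.add (.reg 5) (.lit 2))))))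

theorem seriesLength_spec (h1 : A.nat 1 = D) (hD : 2 ≤ D) :
    Runs B D seriesLength A (3 * Nat.clog 2 D + 3) fun A' => A'.nat 5 = 2 * Nat.clog 2 D := by
  have hD2 : 2 * D ≤ D ^ 2 := by rw [sq]; exact Nat.mul_le_mul_right _ hD
  refine Runs.seq (T₁ := 1) (T₂ := 3 * Nat.clog 2 D + 2) (Runs.setNat 0 rfl trivial (by omega)
    (Q := fun A'' => A'' = A.setNat 5 0) rfl) (by omega) ?_
  rintro _ - rfl
  refine Runs.seq (T₁ := 1) (T₂ := 3 * Nat.clog 2 D + 1) (Runs.setNat 1 rfl trivial (by omega)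
    (Q := fun A'' => A'' = (A.setNat 5 0).setNat 20 1) rfl) (by omega) ?_
  rintro _ - rfl
  refine (Runs.loop (fun k A' => A'.nat 20 = 2 ^ k ∧ A'.nat 5 = 2 * k) (Nat.clog 2 D) (fun _ => 2)
    (by simp) ?_ ?_).mono (by simp; omega) fun A' _ h => h.2.2
  · rintro k hk A' hF ⟨h8, h9⟩
    have h7' : A'.nat 1 = D := (hF.nat 1 rfl).trans (by simp [h1])
    have hlt : 2 ^ k < D := (Nat.lt_clog_iff_pow_lt (by norm_num)).1 hk
    refine ⟨trivial, trivial, by simpa [NatExpr.eval, h8, h7'] using hlt, ?_⟩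
    refine Runs.seq (T₁ := 1) (T₂ := 1) (Runs.setNat (2 ^ (k + 1))
      (by simp [NatExpr.eval, h8, pow_succ']) ⟨trivial, trivial⟩ (by rw [pow_succ]; omega)
      (Q := fun A'' => A'' = A'.setNat 20 (2 ^ (k + 1))) rfl) le_rfl ?_
    rintro _ - rfl
    refine Runs.setNat (2 * (k + 1)) (by simp [NatExpr.eval, h9]; ring) ⟨trivial, trivial⟩ ?_
      (by simp)
    have := k.lt_two_pow_self
    omega
  · rintro A' hF ⟨h8, h9⟩
    have h7' : A'.nat 1 = D := (hF.nat 1 rfl).trans (by simp [h1])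
    refine ⟨trivial, trivial, ?_⟩
    simpa [NatExpr.eval, h8, h7'] using Nat.le_pow_clog (by norm_num) D

/-- The program up to the transforms: reading the input, the accuracy, and `π`. -/
def setup : CpxProgram :=
  .seq (.readNat 2 (.lit 0)) (.seq (.recip 4 (.lit 1)) (.seq readOrders
    (.seq (.setNat 0 (.add (.add (.mul (.lit 2) (.reg 3)) (.reg 2)) (.lit 2)))
      (.seq readValues (.seq computeAccuracy (.seq seriesLength computePi))))))

/-- The low memory cells hold the input with `s` radices `m j`, accuracy `ε`, and values `a i`. -/
structure HoldsInput (A : CpxState) (s n : ℕ) (ε : ℝ) (m : ℕ → ℕ) (a : ℕ → ℂ) : Prop where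
  count : A.low 0 = s
  accuracy : A.low 1 = ε
  order : ∀ j < s, A.low (2 + j) = m j
  re : ∀ i < n, A.low (2 + s + 2 * i) = (a i).re
  im : ∀ i < n, A.low (2 + s + 2 * i + 1) = (a i).im

theorem two_pow_le_prod {m : ℕ → ℕ} {s : ℕ} (hm : ∀ j < s, 2 ≤ m j) :
    2 ^ s ≤ ∏ i ∈ Finset.range s, m i := by
  calc 2 ^ s = ∏ _i ∈ Finset.range s, 2 := by simp
    _ ≤ _ := Finset.prod_le_prod' fun i hi => hm i (Finset.mem_range.1 hi)

/-- Rounding presupposes that D is in register 1. Before `computePi` no rounded assignment occurs,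
and the natural numbers that are computed are at most D² because S ≤ D. -/
theorem setup_spec {s n : ℕ} {ε : ℝ} {m : ℕ → ℕ} {a : ℕ → ℂ} (hA : HoldsInput A s n ε m a)
    (hε : 0 < ε) (hm : ∀ j < s, 2 ≤ m j) (hn : n = ∏ i ∈ Finset.range s, m i)
    (hB : B = 2 * n + s + 2)
    (hD : D = inputScale n ⌊1 / ε⌋₊ (∑ i ∈ Finset.range n, (⌊Complex.normSq (a i)⌋₊ + 1)) ^ 64)
    (hN : N = 2 * Nat.clog 2 D) :
    Runs B D setup A (4 * s + 6 * n + 6 * N + 25) fun A' => A'.nat 0 = B ∧ A'.nat 1 = D ∧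
      A'.nat 2 = s ∧ A'.nat 3 = n ∧ A'.nat 5 = N ∧ (∀ i < n, A'.arr 0 i = a i) ∧
      ‖A'.cpx 3 - Real.pi‖ ≤ 2 ^ 24 * N ^ 2 / D := by
  set E := ⌊1 / ε⌋₊ with hE
  set X := ∑ i ∈ Finset.range n, (⌊Complex.normSq (a i)⌋₊ + 1) with hX
  set S := inputScale n E X with hS
  have hn0 : 0 < n := by
    rw [hn]; exact lt_of_lt_of_le (by positivity) (two_pow_le_prod hm)
  have hsn : s < n := by
    rw [hn]; exact lt_of_lt_of_le s.lt_two_pow_self (two_pow_le_prod hm)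
  obtain ⟨S1, S2, S3, S4⟩ := le_inputScale hn0 E X
  rw [← hS] at S1 S2 S3 S4
  have hSD : S ≤ D := hD ▸ Nat.le_self_pow (by norm_num) S
  have hDD : D ≤ D ^ 2 := Nat.le_self_pow (by norm_num) D
  have hacc := (accuracy_le S1 hD hN).1
  refine Runs.seq (T₁ := 1) (T₂ := 4 * s + 6 * n + 6 * N + 24) (Runs.readNat 0 s rfl trivial
    (by omega) hA.count (Q := fun A'' => A'' = A.setNat 2 s) rfl) (by omega) ?_
  rintro _ - rfl
  refine Runs.seq (T₁ := 1) (T₂ := 4 * s + 6 * n + 6 * N + 23) (Runs.recip 1 rfl trivial (by omega)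
    (by simpa [hA.accuracy] using hε)
    (by rw [CpxState.setNat_low, hA.accuracy, ← hE]; omega)
    (Q := fun A'' => A'' = (A.setNat 2 s).setNat 4 E)
    (by rw [CpxState.setNat_low, hA.accuracy])) (by omega) ?_
  rintro _ - rfl
  refine Runs.seq (T₁ := s * 4 + 3) (T₂ := 6 * n + 6 * N + 20) (readOrders_spec (m := m)
    (by simp) (fun j hj => by have := hm j hj; omega) hA.order (by omega) (by omega)
    (by rw [← hn]; omega)) (by omega) ?_
  intro A₁ F₁ k₁
  rw [← hn] at k₁
  have a2 : A₁.nat 2 = s := (F₁.nat 2 rfl).trans (by simp)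
  have a4 : A₁.nat 4 = E := (F₁.nat 4 rfl).trans (by simp)
  have alow : A₁.low = A.low := (F₁.low rfl).trans (by simp)
  refine Runs.seq (T₁ := 1) (T₂ := 6 * n + 6 * N + 19) (Runs.setNat B
    (by simp [NatExpr.eval, k₁, a2, hB]) ⟨⟨⟨trivial, trivial⟩, trivial⟩, trivial⟩ (by omega)
    (Q := fun A'' => A'' = A₁.setNat 0 B) rfl) (by omega) ?_
  rintro _ - rfl
  refine Runs.seq (T₁ := n * 6 + 3) (T₂ := 6 * N + 16) (readValues_spec (s := s) (n := n) (a := a)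
    (by simp) (by simp [a2]) (by simp [k₁]) (fun i hi => by simpa [alow] using hA.re i hi)
    (fun i hi => by simpa [alow] using hA.im i hi) (by omega) (by omega)
    (by rw [← hX]; omega)) (by omega) ?_
  rintro A₂ F₂ ⟨k₂, l₂⟩
  have b0 : A₂.nat 0 = B := (F₂.nat 0 rfl).trans (by simp)
  have b2 : A₂.nat 2 = s := (F₂.nat 2 rfl).trans (by simp [a2])
  have b3 : A₂.nat 3 = n := (F₂.nat 3 rfl).trans (by simp [k₁])
  have b4 : A₂.nat 4 = E := (F₂.nat 4 rfl).trans (by simp [a4])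
  refine Runs.seq (T₁ := 7) (T₂ := 6 * N + 9) (computeAccuracy_spec b3 b4 k₂ hn0 hD) (by omega) ?_
  intro A₃ F₃ k₃
  refine Runs.seq (T₁ := 3 * Nat.clog 2 D + 3) (T₂ := N * 4 + 5)
    (seriesLength_spec k₃ (by omega)) (by omega) ?_
  intro A₄ F₄ k₄
  rw [← hN] at k₄
  refine (computePi_spec ((F₄.nat 1 rfl).trans k₃) k₄ hN hacc
    (Nat.le_pow_clog (by norm_num) D)).mono le_rfl ?_
  intro A₅ F₅ k₅
  refine ⟨?_, ?_, ?_, ?_, ?_, ?_, k₅⟩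
  · exact (F₅.nat 0 rfl).trans ((F₄.nat 0 rfl).trans ((F₃.nat 0 rfl).trans b0))
  · exact (F₅.nat 1 rfl).trans ((F₄.nat 1 rfl).trans k₃)
  · exact (F₅.nat 2 rfl).trans ((F₄.nat 2 rfl).trans ((F₃.nat 2 rfl).trans b2))
  · exact (F₅.nat 3 rfl).trans ((F₄.nat 3 rfl).trans ((F₃.nat 3 rfl).trans b3))
  · exact (F₅.nat 5 rfl).trans k₄
  · rw [F₅.arr 0 rfl, F₄.arr 0 rfl, F₃.arr 0 rfl]
    exact l₂

end CpxProgram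

/-! ### All coordinates, output, and the total error and time -/

namespace CpxProgram

variable {B D N : ℕ} {A : CpxState}

/-- The transforms in all coordinates. -/
def transforms : CpxProgram :=
  forLoop 6 2 (.seq (.readNat 7 (.add (.lit 2) (.reg 6))) rotatePass)

theorem norm_iterRotateDft_le {m : ℕ → ℕ} {n s : ℕ} {x : ℕ → ℂ} {Y : ℝ}
    (hx : ∀ i < n, ‖x i‖ ≤ Y) (hdvd : ∀ j < s, m j ∣ n) {j : ℕ} (hj : j ≤ s) :
    ∀ i < n, ‖iterRotateDft m n x j i‖ ≤ (∏ i ∈ Finset.range j, m i : ℕ) * Y := by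
  induction j with
  | zero => simpa [iterRotateDft] using hx
  | succ j ih =>
    intro i hi
    have hn : n / m j * m j = n := Nat.div_mul_cancel (hdvd j hj)
    have := norm_rotateDft_le (l := n / m j) (m := m j) (x := iterRotateDft m n x j)
      (by rw [hn]; exact ih (by omega)) (by rw [hn]; exact hi)
    rw [Finset.prod_range_succ]
    refine this.trans (le_of_eq ?_)
    push_cast
    ring

/-- A pass multiplies the error by (4m_j)^11 ≤ m_j^33, as m_j ≥ 2. These factors multiply up to at
most n^33, uniformly in the number of coordinates. For s = 0 there is no pass and hence no error at
all. -/
theorem transforms_spec {s n : ℕ} {m : ℕ → ℕ} {x : ℕ → ℂ} {Y S : ℝ} (h0 : A.nat 0 = B)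
    (h1 : A.nat 1 = D) (h2 : A.nat 2 = s) (h3 : A.nat 3 = n) (h5 : A.nat 5 = N)
    (hlow : ∀ j < s, A.low (2 + j) = m j) (hsB : s + 2 ≤ B) (hm : ∀ j < s, 2 ≤ m j)
    (hn : n = ∏ i ∈ Finset.range s, m i) (hD : 2 ^ 30 * (N + 1) ^ 2 ≤ D) (hDN : D ≤ 2 ^ N)
    (hpi : ‖A.cpx 3 - Real.pi‖ ≤ 2 ^ 24 * N ^ 2 / D) (hnS : 2 ^ 40 * (n : ℝ) ≤ S)
    (hYS : Y ≤ S) (hSD : S ^ 64 ≤ D) (hμ : S ^ 60 * (2 ^ 27 * N ^ 2 / D) ≤ 1)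
    (hx : ∀ i < n, ‖x i‖ ≤ Y) (hY : 1 ≤ Y) (hA : ∀ i < n, A.arr 0 i = x i) :
    Runs B D transforms A
      ((∑ j ∈ Finset.range s, (1 + 300 * (n * Nat.clog 2 (2 * m j) + m j * N) + 2)) + 2)
      fun A' => ∀ i < n, ‖A'.arr 0 i - iterRotateDft m n x s i‖ ≤
          (n : ℝ) ^ 34 * Y * (2 ^ 27 * N ^ 2 / D) ∧ (s = 0 → A'.arr 0 i = x i) := by
  set μ : ℝ := 2 ^ 27 * N ^ 2 / D with hμdef
  have hμ0 : 0 ≤ μ := by positivity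
  set P : ℕ → ℕ := fun j => ∏ i ∈ Finset.range j, m i with hP
  have hP1 : ∀ j ≤ s, 1 ≤ P j := fun j hj => Nat.one_le_iff_ne_zero.2
    (Finset.prod_pos fun i hi => by
      have := hm i ((Finset.mem_range.1 hi).trans_le hj)
      omega).ne'
  have hPle : ∀ j ≤ s, P j ≤ n := fun j hj => by
    rw [hn]
    exact Finset.prod_le_prod_of_subset_of_one_le' (Finset.range_mono hj)
      fun i hi _ => by
        have := hm i (Finset.mem_range.1 hi)
        omega
  have hn1 : 1 ≤ n := (hP1 0 (Nat.zero_le _)).trans (hPle 0 (Nat.zero_le _))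
  have hn1' : (1 : ℝ) ≤ n := by exact_mod_cast hn1
  have hS1 : (2 : ℝ) ^ 40 ≤ S := le_trans (le_mul_of_one_le_right (by norm_num) hn1') hnS
  have hS1' : (1 : ℝ) ≤ S := le_trans (by norm_num) hS1
  have hnS' : (n : ℝ) ≤ S := le_trans (le_mul_of_one_le_left (by positivity) (by norm_num)) hnS
  have hdvd : ∀ j < s, m j ∣ n := fun j hj => by
    rw [hn]; exact Finset.dvd_prod_of_mem m (Finset.mem_range.2 hj)
  have hnD : n ≤ D := by
    have : (n : ℝ) ≤ D := hnS'.trans ((le_self_pow₀ hS1' (by norm_num)).trans hSD)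
    exact_mod_cast this
  have hDD : D ≤ D ^ 2 := Nat.le_self_pow (by norm_num) D
  have hsn : s ≤ n := by
    rw [hn]; exact s.lt_two_pow_self.le.trans (two_pow_le_prod hm)
  -- The errors start from nYμ rather than 0, because the intermediate values are bounded by nY and
  -- `rotatePass_spec` requires e ≥ (nY)·μ.
  set e : ℕ → ℝ := fun j => (P j : ℝ) ^ 33 * (n * Y * μ) with he
  have he0 : ∀ j, 0 ≤ e j := fun j => by positivity
  have hele : ∀ j ≤ s, e j ≤ (n : ℝ) ^ 34 * Y * μ := fun j hj => by
    have : (P j : ℝ) ≤ n := by exact_mod_cast hPle j hj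
    calc e j ≤ (n : ℝ) ^ 33 * (n * Y * μ) := by simp only [he]; gcongr
      _ = _ := by ring
  have hesmall : ∀ j ≤ s, e j ≤ 1 := fun j hj => by
    refine (hele j hj).trans (le_trans ?_ hμ)
    calc (n : ℝ) ^ 34 * Y * μ ≤ S ^ 34 * S * μ := by gcongr
      _ = S ^ 35 * μ := by ring
      _ ≤ S ^ 60 * μ := by gcongr; norm_num
  refine (Runs.forLoop' (fun j A' => ∀ i < n, ‖A'.arr 0 i - iterRotateDft m n x j i‖ ≤ e j ∧
    (j = 0 → A'.arr 0 i = x i)) (fun j => 1 + 300 * (n * Nat.clog 2 (2 * m j) + m j * N))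
    h2 (by omega) (by norm_num) rfl rfl ?_ ?_).mono le_rfl
    fun A' _ h i hi => ⟨(h i hi).1.trans (hele s le_rfl), (h i hi).2⟩
  · intro i hi
    simp only [CpxState.setNat_arr, iterRotateDft, hA i hi, sub_self, norm_zero]
    exact ⟨he0 0, fun _ => trivial⟩
  intro j hj A' F h6 hI
  have hmj := hm j hj
  have hmn : m j ≤ n := Nat.le_of_dvd hn1 (hdvd j hj)
  have hmn' : (4 * m j : ℝ) ≤ S := by
    have : (m j : ℝ) ≤ n := by exact_mod_cast hmn
    linarith
  have hlm : n / m j * m j = n := Nat.div_mul_cancel (hdvd j hj)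
  have hl0 : 0 < n / m j := Nat.div_pos hmn (by omega)
  refine Runs.seq (T₁ := 1) (Runs.readNat (2 + j) (m j) (by simp [NatExpr.eval, h6])
    ⟨trivial, trivial⟩ (by omega) (by rw [F.low rfl]; exact hlow j hj)
    (Q := fun A'' => A'' = A'.setNat 7 (m j)) rfl) le_rfl ?_
  rintro _ - rfl
  have hspec := rotatePass_spec (A := A'.setNat 7 (m j)) (B := B) (D := D) (N := N) (l := n / m j)
    (m := m j) (x := iterRotateDft m n x j) (Y := n * Y) (e := e j)
    (by simpa using (F.nat 0 rfl).trans h0) (by simpa using (F.nat 1 rfl).trans h1)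
    (by simpa [hlm] using (F.nat 3 rfl).trans h3) (by simpa using (F.nat 5 rfl).trans h5)
    (by simp) hl0 hmj hD hDN (by
      have := F.cpx 3 rfl
      simpa [this] using hpi) (by rw [hlm]; exact hnD)
    (by
      rw [hlm]
      intro i hi
      refine (norm_iterRotateDft_le hx hdvd hj.le i hi).trans ?_
      gcongr
      exact hPle j hj.le)
    (one_le_mul_of_one_le_of_one_le hn1' hY)
    (by rw [hlm]; exact fun i hi => (hI i hi).1)
    (le_mul_of_one_le_left (by positivity)
      (one_le_pow₀ (by exact_mod_cast hP1 j hj.le)))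
    (by
      refine le_trans ?_ hμ
      calc (4 * m j : ℝ) ^ 4 * μ ≤ S ^ 4 * μ := by gcongr
        _ ≤ S ^ 60 * μ := by gcongr; norm_num)
    (by
      refine le_trans ?_ hSD
      have h1 : (n : ℝ) * Y + e j ≤ 2 * S ^ 2 := by
        have h1 : (n : ℝ) * Y ≤ S * S := by gcongr
        have h2 := hesmall j hj.le
        have h3 : 1 ≤ S ^ 2 := one_le_pow₀ hS1'
        linarith
      calc 100 * ((4 * m j : ℝ) ^ 8 * (n * Y + e j)) ≤ 100 * (S ^ 8 * (2 * S ^ 2)) := by gcongr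
        _ = 200 * S ^ 10 := by ring
        _ ≤ S * S ^ 10 := by gcongr; linarith
        _ = S ^ 11 := by ring
        _ ≤ S ^ 64 := pow_le_pow_right₀ hS1' (by norm_num))
  rw [hlm] at hspec
  refine hspec.mono le_rfl fun A₂ _ h i hi => ⟨?_, by omega⟩
  simp only [CpxState.setNat_arr]
  refine (h i hi).trans ?_
  have hm' : (2 : ℝ) ≤ m j := by exact_mod_cast hmj
  have h4 : (4 * m j : ℝ) ≤ (m j : ℝ) ^ 3 := by
    have : (m j : ℝ) ^ 3 = m j * m j * m j := by ring
    rw [this]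
    gcongr
    nlinarith
  calc (4 * m j : ℝ) ^ 11 * e j ≤ ((m j : ℝ) ^ 3) ^ 11 * e j := by
        have := he0 j
        gcongr
    _ = e (j + 1) := by
      simp only [he, hP, Finset.prod_range_succ]
      push_cast
      ring

/-- Copies the array `0` to the first memory cells. -/
def output : CpxProgram :=
  forLoop 14 3 (.seq (.load 0 0 (.reg 14)) (.writeCpx (.mul (.lit 2) (.reg 14)) 0))

theorem output_spec {n : ℕ} (h0 : A.nat 0 = B) (h3 : A.nat 3 = n) (hB : 2 * n ≤ B)
    (hnD : n ≤ D ^ 2) :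
    Runs B D output A (n * 4 + 2) fun A' => ∀ i < n,
      A'.low (2 * i) = (A.arr 0 i).re ∧ A'.low (2 * i + 1) = (A.arr 0 i).im := by
  refine Runs.forLoop (fun j A' => ∀ i < j,
    A'.low (2 * i) = (A.arr 0 i).re ∧ A'.low (2 * i + 1) = (A.arr 0 i).im) 2 h3 hnD (by norm_num)
    rfl rfl (by simp) ?_
  intro j hj A' F h14 hI
  refine Runs.seq (T₁ := 1) (T₂ := 1) (Runs.load j (by simp [NatExpr.eval, h14]) (by norm_num)
    trivial ((F.nat 0 rfl).trans h0) (Q := fun A'' => A'' = A'.setCpx 0 (A.arr 0 j))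
    (by rw [F.arr 0 rfl])) le_rfl ?_
  rintro _ - rfl
  refine Runs.writeCpx (2 * j) (by simp [NatExpr.eval, h14]) ⟨trivial, trivial⟩ (by omega) ?_
  intro i hi
  simp only [CpxState.setNat_low, CpxState.setLow, CpxState.setCpx_cpx, Function.update_apply,
    if_true]
  rcases Nat.lt_succ_iff_lt_or_eq.1 hi with h | rfl
  · rw [if_neg (by omega), if_neg (by omega), if_neg (by omega), if_neg (by omega)]
    exact hI i h
  · simp

/-- The discrete Fourier transform of an Abelian group. -/
def groupDft : CpxProgram := .seq setup (.seq transforms output)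

/-- 2^⌈log₂ 2m⌉ < 4m ≤ m³ for m ≥ 2. Thus rounding up the logarithms in each coordinate costs only a
constant factor overall, even if there are many small coordinates. -/
theorem sum_clog_le {m : ℕ → ℕ} {s : ℕ} (hm : ∀ j < s, 2 ≤ m j) :
    2 ^ (∑ j ∈ Finset.range s, Nat.clog 2 (2 * m j)) ≤ (∏ i ∈ Finset.range s, m i) ^ 3 := by
  rw [← Finset.prod_pow_eq_pow_sum, ← Finset.prod_pow]
  refine Finset.prod_le_prod' fun j hj => ?_
  have hmj := hm j (Finset.mem_range.1 hj)
  have h1 : 1 ≤ Nat.clog 2 (2 * m j) := Nat.clog_pos (by norm_num) (by omega)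
  have h := (Nat.lt_clog_iff_pow_lt (b := 2) (x := 2 * m j) (y := Nat.clog 2 (2 * m j) - 1)
    (by norm_num)).1 (by omega)
  have h2 : 2 ^ Nat.clog 2 (2 * m j) = 2 * 2 ^ (Nat.clog 2 (2 * m j) - 1) := by
    rw [← pow_succ']; congr 1; omega
  have h3 : 4 * m j ≤ m j ^ 3 := by
    rw [pow_succ, sq]
    exact Nat.mul_le_mul_right _ (Nat.mul_le_mul hmj hmj)
  omega

/-- The product of two integers ≥ 2 is at least their sum. This bounds the cost of all tables
together by O(nN). -/
theorem sum_le_prod {m : ℕ → ℕ} {s : ℕ} (hm : ∀ j < s, 2 ≤ m j) :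
    ∑ j ∈ Finset.range s, m j ≤ ∏ j ∈ Finset.range s, m j := by
  induction s with
  | zero => simp
  | succ s ih =>
    rcases Nat.eq_zero_or_pos s with rfl | hs
    · simp
    have hm' : ∀ j < s, 2 ≤ m j := fun j hj => hm j (by omega)
    have h1 := ih hm'
    have h2 : 2 ≤ ∏ j ∈ Finset.range s, m j :=
      le_trans (by simpa using Nat.pow_le_pow_right (n := 2) (by norm_num) hs) (two_pow_le_prod hm')
    have h3 := hm s (by omega)
    rw [Finset.sum_range_succ, Finset.prod_range_succ]
    nlinarith

/-- n, X + 1 and 1/ε are all at most S, so the error n^34 (X+1) μ is at most S^35 μ, and S^60 μ ≤ 1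
makes it at most 1/S ≤ ε. -/
theorem groupDft_spec {s n : ℕ} {ε : ℝ} {m : ℕ → ℕ} {a : ℕ → ℂ} (hA : HoldsInput A s n ε m a)
    (hε : 0 < ε) (hm : ∀ j < s, 2 ≤ m j) (hn : n = ∏ i ∈ Finset.range s, m i)
    (hB : B = 2 * n + s + 2)
    (hD : D = inputScale n ⌊1 / ε⌋₊ (∑ i ∈ Finset.range n, (⌊Complex.normSq (a i)⌋₊ + 1)) ^ 64)
    (hN : N = 2 * Nat.clog 2 D) :
    Runs B D groupDft A
      (400 * (n * (∑ j ∈ Finset.range s, Nat.clog 2 (2 * m j) + N))) fun A' => ∃ z : ℕ → ℂ,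
        (∀ i < n, A'.low (2 * i) = (z i).re ∧ A'.low (2 * i + 1) = (z i).im) ∧
        ∀ i < n, ‖z i - iterRotateDft m n a s i‖ ≤ ε ∧ (s = 0 → z i = a i) := by
  set X := ∑ i ∈ Finset.range n, (⌊Complex.normSq (a i)⌋₊ + 1) with hX
  set S := inputScale n ⌊1 / ε⌋₊ X with hS
  have hn0 : 0 < n := by
    rw [hn]; exact lt_of_lt_of_le (by positivity) (two_pow_le_prod hm)
  have hsn : s < n := by
    rw [hn]; exact lt_of_lt_of_le s.lt_two_pow_self (two_pow_le_prod hm)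
  obtain ⟨S1, S2, S3, S4⟩ := le_inputScale hn0 ⌊1 / ε⌋₊ X
  rw [← hS] at S1 S2 S3 S4
  obtain ⟨hacc, hμ⟩ := accuracy_le S1 hD hN
  have hS1 : (1 : ℝ) ≤ S := by
    have : 1 ≤ S := by omega
    exact_mod_cast this
  have hSD : S ≤ D := hD ▸ Nat.le_self_pow (by norm_num) S
  have hDD : D ≤ D ^ 2 := Nat.le_self_pow (by norm_num) D
  -- D ≥ S ≥ 2^40; with N this large the multiples of n and the additive constants in the time are
  -- absorbed by n·N.
  have hN40 : 80 ≤ N := by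
    have h2 : 40 ≤ Nat.clog 2 D := by
      rw [← Nat.clog_pow 2 40 (by norm_num)]
      exact Nat.clog_mono_right 2 (S1.trans hSD)
    omega
  have hnorm : ∀ i < n, ‖a i‖ ≤ (X + 1 : ℕ) := by
    intro i hi
    have h1 : ⌊Complex.normSq (a i)⌋₊ + 1 ≤ X :=
      Finset.single_le_sum (f := fun i => ⌊Complex.normSq (a i)⌋₊ + 1)
        (fun _ _ => Nat.zero_le _) (Finset.mem_range.2 hi)
    have h2 := (Nat.lt_floor_add_one (Complex.normSq (a i))).le
    have h3 : ((⌊Complex.normSq (a i)⌋₊ + 1 : ℕ) : ℝ) ≤ X := by exact_mod_cast h1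
    rw [Complex.normSq_eq_norm_sq] at h2 h3
    push_cast at h3 ⊢
    -- From |a|² ≤ X and 2|a| ≤ |a|² + 1.
    nlinarith [sq_nonneg (‖a i‖ - 1)]
  have hsum : (∑ j ∈ Finset.range s, (1 + 300 * (n * Nat.clog 2 (2 * m j) + m j * N) + 2)) ≤
      3 * n + 300 * (n * ∑ j ∈ Finset.range s, Nat.clog 2 (2 * m j)) + 300 * (n * N) := by
    have h1 : (∑ j ∈ Finset.range s, (1 + 300 * (n * Nat.clog 2 (2 * m j) + m j * N) + 2)) =
        3 * s + 300 * (n * ∑ j ∈ Finset.range s, Nat.clog 2 (2 * m j)) +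
          300 * ((∑ j ∈ Finset.range s, m j) * N) := by
      simp only [Finset.sum_add_distrib, Finset.sum_const, Finset.card_range, smul_eq_mul,
        ← Finset.mul_sum, ← Finset.sum_mul]
      ring
    have h2 : (∑ j ∈ Finset.range s, m j) * N ≤ n * N :=
      Nat.mul_le_mul_right _ (hn ▸ sum_le_prod hm)
    omega
  have hnN : N ≤ n * N := Nat.le_mul_of_pos_left _ hn0
  have hnN' : 80 * n ≤ n * N := by rw [mul_comm]; exact Nat.mul_le_mul_left _ hN40
  refine Runs.seq (T₂ := (∑ j ∈ Finset.range s,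
    (1 + 300 * (n * Nat.clog 2 (2 * m j) + m j * N) + 2)) + 2 + (n * 4 + 2))
    (setup_spec hA hε hm hn hB hD hN) (by rw [mul_add]; omega) ?_
  rintro A₁ F₁ ⟨a0, a1, a2, a3, a5, aX, aπ⟩
  have alow : A₁.low = A.low := F₁.low rfl
  refine Runs.seq (transforms_spec (s := s) (n := n) (m := m) (x := a) (Y := (X + 1 : ℕ)) (S := S)
    a0 a1 a2 a3 a5 (by rw [alow]; exact hA.order) (by omega) hm hn hacc
    (by
      refine (Nat.le_pow_clog (by norm_num : 1 < 2) D).trans ?_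
      exact Nat.pow_le_pow_right (by norm_num) (by omega)) aπ (by exact_mod_cast S2)
    (by exact_mod_cast S4) (by rw [hD]; push_cast; exact le_rfl) hμ hnorm (by simp) aX) le_rfl ?_
  intro A₂ F₂ h₂
  refine (output_spec (n := n) ((F₂.nat 0 rfl).trans a0) ((F₂.nat 3 rfl).trans a3) (by omega)
    (by omega)).mono le_rfl fun A₃ _ h₃ => ⟨A₂.arr 0, h₃, fun i hi => ⟨(h₂ i hi).1.trans ?_,
      (h₂ i hi).2⟩⟩
  set μ : ℝ := 2 ^ 27 * N ^ 2 / D with hμdef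
  have hμ0 : 0 ≤ μ := by positivity
  have hnS : (n : ℝ) ≤ S := by
    have : n ≤ S := by omega
    exact_mod_cast this
  have hXS : ((X + 1 : ℕ) : ℝ) ≤ S := by exact_mod_cast S4
  have hεS : 1 / ε ≤ S := by
    have h1 : ((⌊1 / ε⌋₊ + 1 : ℕ) : ℝ) ≤ S := by exact_mod_cast S3
    push_cast at h1
    linarith [Nat.lt_floor_add_one (1 / ε)]
  have hS0 : (0 : ℝ) < S := by linarith
  have h1 : S * ((n : ℝ) ^ 34 * (X + 1 : ℕ) * μ) ≤ 1 := by
    refine le_trans ?_ hμ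
    calc S * ((n : ℝ) ^ 34 * (X + 1 : ℕ) * μ) ≤ S * ((S : ℝ) ^ 34 * S * μ) := by gcongr
      _ = (S : ℝ) ^ 36 * μ := by ring
      _ ≤ (S : ℝ) ^ 60 * μ := by gcongr; norm_num
  calc (n : ℝ) ^ 34 * (X + 1 : ℕ) * μ ≤ 1 / S := by rw [le_div_iff₀ hS0, mul_comm]; exact h1
    _ ≤ ε := by rwa [div_le_iff₀ hS0, ← div_le_iff₀' hε]

end CpxProgram

/-! ### Sizes and magnitudes -/

theorem abs_le_two_pow_ratSize (x : ℚ) : |(x : ℝ)| ≤ 2 ^ ratSize x := by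
  have h1 : x.num.natAbs ≤ 2 ^ ratSize x :=
    (natAbs_lt_of_intSize x.num).le.trans
      (Nat.pow_le_pow_right (by norm_num) (by unfold ratSize intSize; omega))
  have h2 : |(x : ℝ)| = (x.num.natAbs : ℝ) / x.den := by
    rw [Nat.cast_natAbs, Int.cast_abs, ← Nat.abs_cast x.den, ← abs_div, Rat.cast_def]
  rw [h2]
  refine (div_le_self (by positivity) ?_).trans (by exact_mod_cast h1)
  exact_mod_cast x.den_pos

theorem ratSize_re_le (z : RatComplex) : ratSize z.re ≤ z.size := Nat.le_add_right _ _

theorem ratSize_im_le (z : RatComplex) : ratSize z.im ≤ z.size := Nat.le_add_left _ _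

theorem normSq_toComplex_le (z : RatComplex) {γ : ℕ} (h : z.size ≤ γ) :
    Complex.normSq z.toComplex ≤ 2 ^ (2 * γ + 1) := by
  have key : ∀ x : ℚ, ratSize x ≤ γ → (x : ℝ) * x ≤ 2 ^ (2 * γ) := by
    intro x hx
    have h1 : |(x : ℝ)| ≤ 2 ^ γ :=
      (abs_le_two_pow_ratSize x).trans (pow_le_pow_right₀ (by norm_num) hx)
    rw [← abs_mul_abs_self, mul_comm 2 γ, pow_mul, sq]
    gcongr
  have h1 := key z.re ((ratSize_re_le z).trans h)
  have h2 := key z.im ((ratSize_im_le z).trans h)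
  rw [Complex.normSq_apply, pow_succ]
  simp only [RatComplex.toComplex]
  linarith

theorem clog_le_logb {S : ℕ} (hS : 2 ≤ S) {y : ℝ} (h : (S : ℝ) ≤ y) :
    (Nat.clog 2 S : ℝ) ≤ Real.logb 2 y + 1 := by
  have h1 : 1 ≤ Nat.clog 2 S := Nat.clog_pos (by norm_num) hS
  have h2 := (Nat.lt_clog_iff_pow_lt (b := 2) (x := S) (y := Nat.clog 2 S - 1) (by norm_num)).1
    (by omega)
  have h3 : ((2 : ℝ) ^ (Nat.clog 2 S - 1)) ≤ y := by
    refine le_trans ?_ h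
    exact_mod_cast h2.le
  have h4 := Real.logb_le_logb_of_le (b := 2) (by norm_num) (by positivity) h3
  rw [Real.logb_pow, Real.logb_self_eq_one (by norm_num), mul_one, Nat.cast_sub h1] at h4
  push_cast at h4
  linarith

theorem inputScale_le {n γ : ℕ} {ε : ℝ} {a : ℕ → ℂ} (hn : 0 < n) (hε : 0 < ε) (hε1 : ε < 1)
    (ha : ∀ i < n, Complex.normSq (a i) ≤ 2 ^ (2 * γ + 1)) :
    (inputScale n ⌊1 / ε⌋₊ (∑ i ∈ Finset.range n, (⌊Complex.normSq (a i)⌋₊ + 1)) : ℝ) ≤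
      2 ^ 40 * n * (2 * (1 / ε)) * (n * 2 ^ (2 * γ + 3)) := by
  have h1 : (1 : ℝ) ≤ 1 / ε := by rw [le_div_iff₀ hε]; linarith
  have h2 : (⌊1 / ε⌋₊ : ℝ) ≤ 1 / ε := Nat.floor_le (by positivity)
  have hn' : (1 : ℝ) ≤ n := by exact_mod_cast hn
  have h3 : ∀ i ∈ Finset.range n, ((⌊Complex.normSq (a i)⌋₊ : ℝ) + 1) ≤ 2 ^ (2 * γ + 2) := by
    intro i hi
    have h4 := Nat.floor_le (Complex.normSq_nonneg (a i))
    have h5 := ha i (Finset.mem_range.1 hi)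
    have h6 : (1 : ℝ) ≤ 2 ^ (2 * γ + 1) := one_le_pow₀ (by norm_num)
    rw [show (2 : ℝ) ^ (2 * γ + 2) = 2 * 2 ^ (2 * γ + 1) by ring]
    linarith
  have h4 := Finset.sum_le_card_nsmul _ _ _ h3
  rw [Finset.card_range, nsmul_eq_mul] at h4
  have h5 : (1 : ℝ) ≤ n * 2 ^ (2 * γ + 2) :=
    one_le_mul_of_one_le_of_one_le hn' (one_le_pow₀ (by norm_num))
  simp only [inputScale, Nat.cast_mul, Nat.cast_add, Nat.cast_pow, Nat.cast_sum, Nat.cast_ofNat,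
    Nat.cast_one]
  have h6 : (⌊1 / ε⌋₊ : ℝ) + 1 ≤ 2 * (1 / ε) := by linarith
  refine mul_le_mul (mul_le_mul_of_nonneg_left h6 (by positivity : (0 : ℝ) ≤ 2 ^ 40 * n)) ?_
    (by positivity) (by positivity)
  · rw [show (n : ℝ) * 2 ^ (2 * γ + 3) = 2 * (n * 2 ^ (2 * γ + 2)) by ring]
    linarith

/-! ### The initial configuration -/

theorem getD_flatMap_pair {n : ℕ} (f g : ℕ → ℚ) {i : ℕ} (hi : i < n) :
    ((List.range n).flatMap fun p => [f p, g p]).getD (2 * i) 0 = f i ∧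
      ((List.range n).flatMap fun p => [f p, g p]).getD (2 * i + 1) 0 = g i := by
  have hlen : ∀ k, ((List.range k).flatMap fun p => [f p, g p]).length = 2 * k := by
    intro k; simp [mul_comm]
  induction n with
  | zero => omega
  | succ n ih =>
    rw [List.range_succ, List.flatMap_append]
    rcases Nat.lt_succ_iff_lt_or_eq.1 hi with h | rfl
    · rw [List.getD_append _ _ _ _ (by rw [hlen]; omega),
        List.getD_append _ _ _ _ (by rw [hlen]; omega)]
      exact ih h
    · rw [List.getD_append_right _ _ _ _ (by rw [hlen]),
        List.getD_append_right _ _ _ _ (by rw [hlen]; omega), hlen]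
      simp

section input

variable {G : Type*} [AddCommGroup G] [Fintype G] {s : ℕ}

theorem length_inputList (b : Fin s → G) (α' : G → RatComplex) (ε : ℚ) :
    (inputList b α' ε).length = 2 * Fintype.card G + s + 2 := by
  simp [inputList]
  ring

theorem initialState_mem (b : Fin s → G) (α' : G → RatComplex) (ε : ℚ) :
    (initialState b α' ε).mem 0 = s ∧ (initialState b α' ε).mem 1 = ε ∧
      (∀ j < s, (initialState b α' ε).mem (2 + j) = basisOrders b j) ∧
      ∀ i < Fintype.card G, (initialState b α' ε).mem (2 + s + 2 * i) = (α' (eltAt b i)).re ∧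
        (initialState b α' ε).mem (2 + s + 2 * i + 1) = (α' (eltAt b i)).im := by
  refine ⟨rfl, rfl, fun j hj => ?_, fun i hi => ?_⟩
  · simp only [initialState, inputList]
    rw [List.append_assoc, List.getD_append_right _ _ _ _ (by simp),
      List.getD_append _ _ _ _ (by simpa using hj)]
    simp [hj, basisOrders]
  · have := getD_flatMap_pair (fun p => (α' (eltAt b p)).re) (fun p => (α' (eltAt b p)).im) hi
    simp only [initialState, inputList]
    rw [List.getD_append_right _ _ _ _ (by simp; omega),
      List.getD_append_right _ _ _ _ (by simp; omega)]
    simp only [List.length_append, List.length_cons, List.length_nil, List.length_ofFn]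
    rw [show 2 + s + 2 * i - (0 + 1 + 1 + s) = 2 * i by omega,
      show 2 + s + 2 * i + 1 - (0 + 1 + 1 + s) = 2 * i + 1 by omega]
    exact this

theorem initialState_mem_of_le (b : Fin s → G) (α' : G → RatComplex) (ε : ℚ) {a : ℕ}
    (ha : 2 * Fintype.card G + s + 2 ≤ a) : (initialState b α' ε).mem a = 0 :=
  List.getD_eq_default _ _ (by rw [length_inputList]; exact ha)

theorem size_le_maxSize {G : Type*} [Fintype G] (α' : G → RatComplex) (g : G) : (α' g).size ≤ maxSize α' :=
  Finset.le_sup (f := fun g => (α' g).size) (Finset.mem_univ g)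

theorem initialState_small (b : Fin s → G) (α' : G → RatComplex) (ε : ℚ) {D W : ℕ}
    (hs : s ≤ D ^ 2) (hb : ∀ j, addOrderOf (b j) ≤ D ^ 2)
    (hW : 3 * Nat.clog 2 (D + 1) + 3 + maxSize α' + ratSize ε ≤ W) :
    (initialState b α' ε).Small W := by
  have hnat : ∀ v : ℕ, v ≤ D ^ 2 → ratSize (v : ℚ) ≤ W := fun v hv =>
    (ratSize_natCast hv).trans (by omega)
  have h0 : ratSize 0 ≤ W := by simpa using hnat 0 (Nat.zero_le _)
  refine ⟨fun r => h0, fun a => ?_⟩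
  rcases lt_or_ge a (inputList b α' ε).length with h | h
  · have hmem : (initialState b α' ε).mem a ∈ inputList b α' ε := by
      simp only [initialState]
      rw [List.getD_eq_getElem _ _ h]
      exact List.getElem_mem h
    generalize (initialState b α' ε).mem a = x at hmem
    simp only [inputList, List.mem_append, List.mem_cons, List.mem_ofFn, List.mem_flatMap,
      List.not_mem_nil, or_false] at hmem
    rcases hmem with ((rfl | rfl) | ⟨j, rfl⟩) | ⟨p, _, rfl | rfl⟩
    · exact hnat s hs
    · omega
    · exact hnat _ (hb j)
    · exact ((ratSize_re_le _).trans (size_le_maxSize α' _)).trans (by omega)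
    · exact ((ratSize_im_le _).trans (size_le_maxSize α' _)).trans (by omega)
  · rw [length_inputList] at h
    rw [initialState_mem_of_le b α' ε h]
    exact h0

/-- The initial configuration of the machine with complex arrays. -/
noncomputable def initialCpxState (b : Fin s → G) (α' : G → RatComplex) (ε : ℚ) : CpxState where
  nat := fun _ => 0
  cpx := fun _ => 0
  arr := fun _ _ => 0
  low := fun a => ((initialState b α' ε).mem a : ℝ)

theorem represents_initial (b : Fin s → G) (α' : G → RatComplex) (ε : ℚ) :
    Represents (2 * Fintype.card G + s + 2) (initialState b α' ε) (initialCpxState b α' ε) := by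
  constructor
  · intro r; simp [initialState, initialCpxState]
  · intro r; simp [initialState, initialCpxState]
  · intro r; simp [initialState, initialCpxState]
  · intro a _; rfl
  · intro k _ i
    rw [initialState_mem_of_le b α' ε (by omega)]
    simp [initialCpxState]
  · intro k _ i
    rw [initialState_mem_of_le b α' ε (by omega)]
    simp [initialCpxState]

theorem holdsInput_initial (b : Fin s → G) (α' : G → RatComplex) (ε : ℚ) :
    CpxProgram.HoldsInput (initialCpxState b α' ε) s (Fintype.card G) ε (basisOrders b)
      fun i => (α' (eltAt b i)).toComplex := by
  obtain ⟨h1, h2, h3, h4⟩ := initialState_mem b α' ε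
  constructor
  · simp [initialCpxState, h1]
  · simp [initialCpxState, h2]
  · intro j hj; simp [initialCpxState, h3 j hj]
  · intro i hi; simp [initialCpxState, (h4 i hi).1, RatComplex.toComplex]
  · intro i hi; simp [initialCpxState, (h4 i hi).2, RatComplex.toComplex]

theorem norm_dft_sub_le {α α' : G → ℂ} {ε : ℝ} (h : ∀ g, ‖α g - α' g‖ ≤ ε)
    (χ : AddChar G Circle) : ‖dft α' χ - dft α χ‖ ≤ Fintype.card G * ε := by
  rw [dft, dft, ← Finset.sum_sub_distrib]
  refine (norm_sum_le _ _).trans ((Finset.sum_le_card_nsmul _ _ ε fun g _ => ?_).trans ?_)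
  · rw [← sub_mul, norm_mul, RCLike.norm_conj, Circle.norm_coe, mul_one, norm_sub_rev]
    exact h g
  · simp

end input

theorem mainTheorem5 :
    ∃ (P : RamProgram) (C K₁ K₂ K₃ : ℕ),
      ∀ (G : Type*) [AddCommGroup G] [Fintype G] (s : ℕ) (b : Fin s → G),
        IsGroupBasis b → (∀ j, b j ≠ 0) →
      ∀ (α' : G → RatComplex) (ε : ℚ), 0 < ε → ε < 1 → ε < 1 / (Fintype.card G : ℚ) ^ C →
      ∃ (w t : ℕ) (σ : RamState) (β : AddChar G Circle → RatComplex),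
        P.Exec w (initialState b α' ε) t σ ∧
        HoldsDualTable b σ.mem β ∧
        (∀ α : G → ℂ, (∀ g, ‖α g - (α' g).toComplex‖ ≤ (ε : ℝ)) →
          ∀ χ, ‖(β χ).toComplex - dft α χ‖ ≤ (Fintype.card G : ℝ) ^ K₁ * (ε : ℝ)) ∧
        (t : ℝ) ≤ K₂ * ((Fintype.card G : ℝ) *
          (Real.logb 2 (Fintype.card G) + maxSize α' + Real.logb 2 (1 / (ε : ℝ)))) ∧
        (w : ℝ) ≤ K₃ * (Real.logb 2 (Fintype.card G) + maxSize α' + ratSize ε) := by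
  set p := CpxProgram.groupDft with hp
  -- The factors `unitCost` and `growth` come from the simulation. 718000 = 400 · 1795, with 400
  -- from `groupDft_spec` and 1795 from the bound for the logarithms; 2691 is the corresponding
  -- factor for W. The exponent 2 satisfies 1 + n ≤ n² for n ≥ 2.
  refine ⟨p.toRam, 0, 2, p.toRam.unitCost * 718000, p.toRam.growth * 2691, ?_⟩
  intro G _ _ s b hb hb0 α' ε hε hε1 _
  set n := Fintype.card G with hn
  set γ := maxSize α' with hγ
  set a : ℕ → ℂ := fun i => (α' (eltAt b i)).toComplex with ha
  have hε' : (0 : ℝ) < ε := by exact_mod_cast hε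
  have hε1' : (ε : ℝ) < 1 := by exact_mod_cast hε1
  have hn0 : 0 < n := Fintype.card_pos
  have hn1 : (1 : ℝ) ≤ n := by exact_mod_cast hn0
  have hm : ∀ j < s, 2 ≤ basisOrders b j := by
    intro j hj
    have h1 := addOrderOf_pos (b ⟨j, hj⟩)
    have h2 : addOrderOf (b ⟨j, hj⟩) ≠ 1 := by
      rw [Ne, AddMonoid.addOrderOf_eq_one_iff]; exact hb0 _
    simp only [basisOrders, hj, dif_pos]
    omega
  have hcard : n = ∏ i ∈ Finset.range s, basisOrders b i := hb.card_eq
  set X := ∑ i ∈ Finset.range n, (⌊Complex.normSq (a i)⌋₊ + 1) with hX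
  set S := inputScale n ⌊1 / (ε : ℝ)⌋₊ X with hS
  obtain ⟨D, hD⟩ : ∃ D, D = S ^ 64 := ⟨_, rfl⟩
  obtain ⟨N, hN⟩ : ∃ N, N = 2 * Nat.clog 2 D := ⟨_, rfl⟩
  obtain ⟨S1, S2, S3, S4⟩ := le_inputScale hn0 ⌊1 / (ε : ℝ)⌋₊ X
  rw [← hS] at S1 S2 S3 S4
  have hSD : S ≤ D := hD ▸ Nat.le_self_pow (by norm_num) S
  have hDD : D ≤ D ^ 2 := Nat.le_self_pow (by norm_num) D
  have hsn : s ≤ n := by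
    rw [hcard]; exact s.lt_two_pow_self.le.trans (CpxProgram.two_pow_le_prod hm)
  have hbn : ∀ j, addOrderOf (b j) ≤ n := fun j => addOrderOf_le_card_univ
  -- Room for grid points and natural numbers up to D², and for the input numbers.
  obtain ⟨W, hW⟩ : ∃ W, W = 3 * Nat.clog 2 (D + 1) + 3 + γ + ratSize ε := ⟨_, rfl⟩
  obtain ⟨T, A', hexec, hT, z, hz, hzβ⟩ := CpxProgram.groupDft_spec
    (holdsInput_initial b α' ε) hε' hm hcard rfl hD hN
  obtain ⟨t, σ, ht, hrun, hrep, -⟩ := hexec.simulate (W := W) (w := p.toRam.growth * W)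
    (κ := p.toRam.unitCost) (by omega) (by omega) _ (represents_initial b α' ε)
    (initialState_small b α' ε (by omega) (fun j => (hbn j).trans (by omega)) hW.ge) le_rfl le_rfl
  choose pos hpos hchar using exists_isCharAt hb
  refine ⟨p.toRam.growth * W, t, σ, fun χ => ⟨σ.mem (2 * pos χ), σ.mem (2 * pos χ + 1)⟩, hrun,
    fun χ => ⟨pos χ, hpos χ, hchar χ, rfl, rfl⟩, ?_, ?_, ?_⟩
  · intro α hα χ
    have hlt := hpos χ
    have h1 : (⟨σ.mem (2 * pos χ), σ.mem (2 * pos χ + 1)⟩ : RatComplex).toComplex = z (pos χ) := by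
      apply Complex.ext
      · simp only [RatComplex.toComplex]
        rw [hrep.low _ (by omega), (hz _ hlt).1]
      · simp only [RatComplex.toComplex]
        rw [hrep.low _ (by omega), (hz _ hlt).2]
    have h2 := (hchar χ).dft_eq hb hlt fun g => (α' g).toComplex
    have h3 := norm_dft_sub_le hα χ
    obtain ⟨h4, h5⟩ := hzβ _ hlt
    rw [h1]
    -- For the trivial group n^2 · ε = ε leaves no room for an error of the program, and indeed its
    -- output is exact.
    rcases Nat.eq_zero_or_pos s with h0 | h0
    · have h6 : z (pos χ) = dft (fun g => (α' g).toComplex) χ := by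
        rw [h5 h0, ← h2]; subst h0; rfl
      have hn1' : n = 1 := by rw [hcard]; subst h0; simp
      rw [h6]
      refine h3.trans (le_of_eq ?_)
      rw [← hn, hn1']; norm_num
    · have hn2 : 2 ≤ n := by
        rw [hcard]
        exact le_trans (by simpa using Nat.pow_le_pow_right (n := 2) (by norm_num) h0)
          (CpxProgram.two_pow_le_prod hm)
      have hn2' : (2 : ℝ) ≤ n := by exact_mod_cast hn2
      rw [h2] at h4
      calc ‖z (pos χ) - dft α χ‖ ≤ ‖z (pos χ) - dft (fun g => (α' g).toComplex) χ‖ +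
            ‖dft (fun g => (α' g).toComplex) χ - dft α χ‖ := norm_sub_le_norm_sub_add_norm_sub _ _ _
        _ ≤ ε + n * ε := add_le_add h4 h3
        _ = (1 + n) * ε := by ring
        _ ≤ (n : ℝ) ^ 2 * ε := by gcongr; nlinarith
  all_goals
    -- A rational number has size at least 2, so γ ≥ 4. Additive constants are absorbed by γ, since
    -- log n vanishes for n = 1 and log(1/ε) can be arbitrarily small.
    have hγ4 : 4 ≤ γ := by
      refine le_trans ?_ (size_le_maxSize α' 0)
      have h1 := ratSize_pos (α' 0).re
      have h2 := ratSize_pos (α' 0).im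
      unfold RatComplex.size
      omega
    have hγ4' : (4 : ℝ) ≤ γ := by exact_mod_cast hγ4
    have hln : 0 ≤ Real.logb 2 n := Real.logb_nonneg (by norm_num) hn1
    have hε2 : 1 ≤ 1 / (ε : ℝ) := by rw [le_div_iff₀ hε']; linarith
    have hle : 0 ≤ Real.logb 2 (1 / (ε : ℝ)) := Real.logb_nonneg (by norm_num) hε2
    have hS' := inputScale_le (γ := γ) (a := a) hn0 hε' hε1' fun i _ =>
      normSq_toComplex_le _ (size_le_maxSize α' _)
    rw [← hX, ← hS] at hS'
    have hlog := clog_le_logb (by omega) hS'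
    rw [Real.logb_mul (by positivity) (by positivity),
      Real.logb_mul (by positivity) (by positivity), Real.logb_mul (by positivity) (by positivity),
      Real.logb_mul (by positivity) (by positivity), Real.logb_mul (by positivity) (by positivity),
      Real.logb_pow, Real.logb_pow, Real.logb_self_eq_one (by norm_num)] at hlog
    push_cast at hlog
  · have hNr : (N : ℝ) ≤ 128 * Nat.clog 2 S := by exact_mod_cast series_length_le hD hN
    have hR : ((∑ j ∈ Finset.range s, Nat.clog 2 (2 * basisOrders b j) : ℕ) : ℝ) ≤
        3 * Real.logb 2 n := by
      have h1 := CpxProgram.sum_clog_le hm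
      rw [← hcard] at h1
      have h2 : (2 : ℝ) ^ (∑ j ∈ Finset.range s, Nat.clog 2 (2 * basisOrders b j)) ≤
          (n : ℝ) ^ 3 := by exact_mod_cast h1
      have h3 := Real.logb_le_logb_of_le (b := 2) (by norm_num) (by positivity) h2
      rw [Real.logb_pow, Real.logb_pow, Real.logb_self_eq_one (by norm_num), mul_one] at h3
      exact_mod_cast h3
    set R := ∑ j ∈ Finset.range s, Nat.clog 2 (2 * basisOrders b j)
    have ht' : (t : ℝ) ≤ p.toRam.unitCost * (400 * (n * (R + N))) := by
      exact_mod_cast ht.trans (Nat.mul_le_mul_left _ hT)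
    refine ht'.trans ?_
    -- Here log₂ S is essentially bounded by 2 log₂ n + 2γ + log₂(1/ε) plus a constant, which `hγ4'`
    -- turns into a multiple of γ, and N ≤ 128⌈log₂ S⌉.
    have h6 : (R : ℝ) + N ≤ 1795 * (Real.logb 2 n + γ + Real.logb 2 (1 / (ε : ℝ))) := by linarith
    calc (p.toRam.unitCost : ℝ) * (400 * (n * (R + N))) ≤ p.toRam.unitCost * (400 * (n * (1795 *
          (Real.logb 2 n + γ + Real.logb 2 (1 / (ε : ℝ)))))) := by gcongr
      _ = _ := by push_cast; ring
  -- ε⁻¹ has size at most that of ε, so log₂(1/ε) is at most the size of ε.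
  · have hsize : Real.logb 2 (1 / (ε : ℝ)) ≤ ratSize ε := by
      have h1 := abs_le_two_pow_ratSize ε⁻¹
      have h2 : (2 : ℝ) ^ ratSize ε⁻¹ ≤ 2 ^ ratSize ε :=
        pow_le_pow_right₀ (by norm_num) (ratSize_inv ε hε.ne')
      have h3 : 1 / (ε : ℝ) ≤ 2 ^ ratSize ε := by
        refine le_trans ?_ (h1.trans h2)
        rw [one_div, Rat.cast_inv]
        exact le_abs_self _
      have h4 := Real.logb_le_logb_of_le (b := 2) (by norm_num) (by positivity) h3
      rwa [Real.logb_pow, Real.logb_self_eq_one (by norm_num), mul_one] at h4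
    have hclog : Nat.clog 2 (D + 1) ≤ 1 + 64 * Nat.clog 2 S := by
      apply Nat.clog_le_of_le_pow
      have h1 : D ≤ 2 ^ (64 * Nat.clog 2 S) := by
        rw [hD, mul_comm, pow_mul]
        exact Nat.pow_le_pow_left (Nat.le_pow_clog (by norm_num) S) 64
      rw [pow_add, pow_one]
      omega
    have hWr : (W : ℝ) ≤ 3 * (1 + 64 * Nat.clog 2 S) + 3 + γ + ratSize ε := by
      have : W ≤ 3 * (1 + 64 * Nat.clog 2 S) + 3 + γ + ratSize ε := by omega
      exact_mod_cast this
    have h6 : (W : ℝ) ≤ 2691 * (Real.logb 2 n + γ + ratSize ε) := by linarith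
    calc ((p.toRam.growth * W : ℕ) : ℝ) ≤ p.toRam.growth * (2691 *
          (Real.logb 2 n + γ + ratSize ε)) := by push_cast; gcongr
      _ = _ := by push_cast; ring
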